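/- **Setting.** A *text circuit* on $k$ wires consists of $k$ states (one noun for each wire, all nouns being different, also between different texts) followed by a finite sequence of boxes; a box has a label (a word) and acts on an ordered tuple of distinct wires. A *set of word embeddings* $V$ fixes a number of qubits per wire and assigns to each noun a quantum circuit that prepares a state of one wire from $|0\ldots0\rangle$, and to each word (for each number of inputs) a quantum circuit on its input wires; circuits are built from NOT gates and from an arbitrary library of named one- and two-qubit unitaries. It turns a text circuit $T$ into a quantum circuit $U_T$; put $\rho_T=U_T|0\rangle\langle 0|U_T^\dagger$. The problem QDisCoCirc-QA with precision $\varepsilon$ is: given $V$, a context $T$ and questions $Q_1,\dots,Q_l$, each having at most as many wires as $T$, output any $j$ with $\left|\operatorname{tr}(\rho_T(\rho_{Q_j}\otimes I))-\max_i\operatorname{tr}(\rho_T(\rho_{Q_i}\otimes I))\right|<\varepsilon$, where $\rho_{Q_i}$ is placed on the first wires of $T$. For every $k\ge 0$ let $\mathcal D_k$ be the following distribution of text circuits with $k$ wires. The number of boxes is random; it is at most a fixed polynomial in $k$, and for some $\gamma>4$ and $c>0$ it is at least $ck^\gamma$ with probability tending to $1$ as $k\to\infty$. The labels of the boxes are independent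 draws from a fixed distribution on a countable vocabulary which obeys Zipf's law (the frequency of the word of rank $r$ is proportional to a power of $r$) and Heaps' law with exponent $1/2$ (the expected number of distinct words among $N$ independent draws is asymptotic to a positive constant times $\sqrt N$). The numbers of inputs of the boxes are independent draws from a fixed distribution $A$ with $P(A=2)>0$ (cut off at $k$), and the inputs of a box are a uniformly random tuple of distinct wires. All these choices are independent. Fix $0\le\delta<\frac12$. An oracle *solves QDisCoCirc-QA on average at size $k$ with precision $\varepsilon$* if, with probability at least $1-\delta$ over independent $T\sim\mathcal D_k$ and $Q_1,Q_2\sim\mathcal D_1$, it answers the instance $(V,T,\{Q_1,Q_2\})$ correctly for **every** set of word embeddings $V$. The case $\delta=0$ is an oracle that is correct on almost all texts drawn. **Theorem.** There is a polynomial $f(m,n)$ such that: 1. There is a polynomial-time algorithm, which may draw samples from the distributions $\mathcal D_k$ and may query an oracle, with the following property. Let $0<\varepsilon<\frac17$, let $C$ be any quantum circuit on $n\ge1$ qubits with $m$ gates, each acting on one or two qubits (arbitrary unitaries, given by name), and let the oracle solve QDisCoCirc-QA on average at size $f(m,n)$ with precision $\varepsilon$. If measuring the first qubit of $C|0\ldots0\rangle$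 gives $1$ with probability at least $\frac23$, or with probability at most $\frac13$, then for every $r\in\mathbb N$ the algorithm, given $C$ and $r$, decides which of the two is the case, in time polynomial in the size of $C$ and $r$, with probability at least $1-2^{-r}$. 2. Hence QDisCoCirc-QA is, for worst-case word embeddings, average-case BQP-hard over texts drawn from $\mathcal D_{f(m,n)}$: for every $0<\varepsilon<\frac17$ and every promise problem in BQP there is an algorithm of the same kind such that, given any oracle that solves QDisCoCirc-QA (with embeddings built from Hadamard, $T$, CNOT and NOT gates) on average with precision $\varepsilon$ at all sizes $f(m,n)$, $m\ge0$, $n\ge1$, it decides the problem on an input $x$ in time polynomial in $|x|+r$ with probability at least $1-2^{-r}$. -/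

import Mathlib

noncomputable section

namespace QDisCo

/-- The probability of an event under a discrete distribution. -/
def prob {α : Type} (p : PMF α) (S : Set α) : ℝ := (p.toOuterMeasure S).toReal

/-! ### Machine model: structured programs over binary trees, with a step count -/

/-- Data of the machine: binary trees. -/
inductive Val : Type
  | nil : Val
  | cons : Val → Val → Val

namespace Val

/-- Number of nodes. -/
def size : Val → ℕ
  | nil => 1
  | cons a b => a.size + b.size + 1

def isNil : Val → Bool
  | nil => true
  | cons _ _ => false

def hd : Val → Val
  | nil => nil
  | cons a _ => a

def tl : Val → Val
  | nil => nil
  | cons _ b => b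

/-- Lists of trees, as right spines. -/
def ofList : List Val → Val
  | [] => nil
  | a :: l => cons a (ofList l)

/-- Unary numbers. -/
def ofNat : ℕ → Val
  | 0 => nil
  | n + 1 => cons nil (ofNat n)

/-- The length of the right spine; left inverse of `ofNat`. -/
def toNat : Val → ℕ
  | nil => 0
  | cons _ b => b.toNat + 1

def ofBool : Bool → Val
  | false => nil
  | true => cons nil nil

def ofBits (l : List Bool) : Val := ofList (l.map ofBool)

/-- Binary numbers, least significant bit first. -/
def ofNatBin (n : ℕ) : Val := ofBits n.bits

end Val

/-- Expressions over the variables `0, 1, 2, …` of a program. -/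
inductive Expr : Type
  | var : ℕ → Expr
  | nil : Expr
  | cons : Expr → Expr → Expr
  | hd : Expr → Expr
  | tl : Expr → Expr

abbrev Store : Type := ℕ → Val

def Expr.eval (s : Store) : Expr → Val
  | .var x => s x
  | .nil => .nil
  | .cons a b => .cons (a.eval s) (b.eval s)
  | .hd a => (a.eval s).hd
  | .tl a => (a.eval s).tl

/-- Programs. `sample x e` draws a text with as many wires as the unary number `e` says and puts
it into `x`; `query x e` puts the answer of the oracle to the query `e` into `x`. -/
inductive Cmd : Type
  | assign : ℕ → Expr → Cmd
  | seq : Cmd → Cmd → Cmd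
  | ite : Expr → Cmd → Cmd → Cmd
  | loop : Expr → Cmd → Cmd
  | sample : ℕ → Expr → Cmd
  | query : ℕ → Expr → Cmd

/-- What a program can access from outside: an oracle and a source of random texts. -/
structure Env where
  oracle : Val → ℕ
  draw : ℕ → PMF Val

/-- A configuration: the commands still to be executed, the store, and the time used so far. -/
structure Config where
  todo : List Cmd
  store : Store
  time : ℕ

/-- One step. Every command takes one unit of time; in addition a program pays for every node of a
query that it submits, of a request for a sample, and of the sample that it receives. -/
def step (E : Env) : Config → PMF Config
  | ⟨[], s, t⟩ => PMF.pure ⟨[], s, t⟩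
  | ⟨.assign x e :: cs, s, t⟩ => PMF.pure ⟨cs, Function.update s x (e.eval s), t + 1⟩
  | ⟨.seq a b :: cs, s, t⟩ => PMF.pure ⟨a :: b :: cs, s, t + 1⟩
  | ⟨.ite e a b :: cs, s, t⟩ =>
      PMF.pure ⟨(if (e.eval s).isNil then b else a) :: cs, s, t + 1⟩
  | ⟨.loop e a :: cs, s, t⟩ =>
      PMF.pure ⟨if (e.eval s).isNil then cs else a :: .loop e a :: cs, s, t + 1⟩
  | ⟨.sample x e :: cs, s, t⟩ =>
      (E.draw (e.eval s).toNat).map fun y =>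
        ⟨cs, Function.update s x y, t + 1 + (e.eval s).size + y.size⟩
  | ⟨.query x e :: cs, s, t⟩ =>
      PMF.pure ⟨cs, Function.update s x (Val.ofNat (E.oracle (e.eval s))),
        t + 1 + (e.eval s).size⟩

def runSteps (E : Env) : ℕ → Config → PMF Config
  | 0, c => PMF.pure c
  | n + 1, c => (step E c).bind (runSteps E n)

/-- The input is in variable `0`, all other variables are `nil`. -/
def initial (P : Cmd) (x : Val) : Config :=
  ⟨[P], fun i => if i = 0 then x else .nil, 0⟩

/-- The probability that `P`, on input `x`, halts in time at most `T` with its output (the value of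
variable `0`) in `S`. A step takes at least one unit of time, so `T` steps are enough to look at. -/
def haltProb (E : Env) (P : Cmd) (x : Val) (T : ℕ) (S : Set Val) : ℝ :=
  prob (runSteps E T (initial P x)) {c | c.todo = [] ∧ c.time ≤ T ∧ c.store 0 ∈ S}

/-- Outputs that mean "yes", respectively "no". -/
def accepting : Set Val := {v | v.isNil = false}

def rejecting : Set Val := {v | v.isNil = true}

/-! ### Quantum circuits with 1- and 2-qubit gates -/

/-- Operators on the qubits `ι`, in the computational basis. -/
abbrev Op (ι : Type) : Type := Matrix (ι → Bool) (ι → Bool) ℂ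

open Classical in
/-- `A ⊗ I`: the operator `A` on the qubits in the range of `e`, the identity on the others. -/
def tensorId {κ ι : Type} (e : κ ↪ ι) (A : Op κ) : Op ι :=
  Matrix.of fun x y => if ∀ i, i ∉ Set.range e → x i = y i then A (x ∘ e) (y ∘ e) else 0

/-- A library of elementary gates: named unitaries on one and on two qubits. -/
structure GateLib where
  one : List Bool → Matrix.unitaryGroup (Fin 1 → Bool) ℂ
  two : List Bool → Matrix.unitaryGroup (Fin 2 → Bool) ℂ

/-- The elementary gates on the qubits `ι`: the NOT gate and the gates of the library. -/
inductive Gate (ι : Type) : Type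
  | not : ι → Gate ι
  | one : List Bool → ι → Gate ι
  | two : List Bool → (Fin 2 ↪ ι) → Gate ι

namespace Gate

/-- The same gate on other qubits. -/
def map {ι κ : Type} (e : ι ↪ κ) : Gate ι → Gate κ
  | not i => not (e i)
  | one g i => one g (e i)
  | two g w => two g (w.trans e)

def single {ι : Type} (i : ι) : Fin 1 ↪ ι := ⟨fun _ => i, fun _ _ _ => Subsingleton.elim _ _⟩

/-- The operator of a gate. -/
def op {ι : Type} (L : GateLib) : Gate ι → Op ι
  | not i => tensorId (single i) (Matrix.of fun x y => if x 0 = y 0 then 0 else 1)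
  | one g i => tensorId (single i) (L.one g : Op (Fin 1))
  | two g w => tensorId w (L.two g : Op (Fin 2))

def enc {ι : Type} (e : ι → Val) : Gate ι → Val
  | not i => .ofList [.ofNat 0, e i]
  | one g i => .ofList [.ofNat 1, .ofBits g, e i]
  | two g w => .ofList [.ofNat 2, .ofBits g, e (w 0), e (w 1)]

end Gate

/-- The unitary of a circuit; the head of the list is applied first. -/
def circuitOp {ι : Type} [Fintype ι] [DecidableEq ι] (L : GateLib) : List (Gate ι) → Op ι
  | [] => 1
  | g :: c => circuitOp L c * g.op L

/-- `U |0…0⟩⟨0…0| U†`. -/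
def density {ι : Type} [Fintype ι] [DecidableEq ι] (U : Op ι) : Op ι :=
  U * Matrix.single (fun _ => false) (fun _ => false) 1 * U.conjTranspose

/-- A quantum circuit on at least one qubit. -/
structure QCircuit where
  qubits : ℕ
  pos : 0 < qubits
  gates : List (Gate (Fin qubits))

namespace QCircuit

/-- The probability of the outcome `1` when the first qubit of `C |0…0⟩` is measured. -/
def acceptProb (L : GateLib) (C : QCircuit) : ℝ :=
  ∑ x : Fin C.qubits → Bool,
    if x ⟨0, C.pos⟩ = true then ‖circuitOp L C.gates x (fun _ => false)‖ ^ 2 else 0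

def enc (C : QCircuit) : Val :=
  .cons (.ofNat C.qubits) (.ofList (C.gates.map (Gate.enc fun i => .ofNat i.val)))

end QCircuit

/-! ### BQP -/

def hadamard : Matrix (Fin 1 → Bool) (Fin 1 → Bool) ℂ :=
  Matrix.of fun x y => if x 0 && y 0 then -((√2 : ℝ) : ℂ)⁻¹ else ((√2 : ℝ) : ℂ)⁻¹

def tGate : Matrix (Fin 1 → Bool) (Fin 1 → Bool) ℂ :=
  Matrix.diagonal fun x => if x 0 then Complex.exp ((Real.pi / 4 : ℝ) * Complex.I) else 1

def cnot : Matrix (Fin 2 → Bool) (Fin 2 → Bool) ℂ :=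
  Matrix.of fun x y => if x 0 = y 0 ∧ x 1 = xor (y 0) (y 1) then 1 else 0

theorem hadamard_unitary : hadamard ∈ Matrix.unitaryGroup (Fin 1 → Bool) ℂ := by
  have h2 : (((√2 : ℝ) : ℂ))⁻¹ * (((√2 : ℝ) : ℂ))⁻¹ = 1 / 2 := by
    rw [← mul_inv, ← Complex.ofReal_mul, Real.mul_self_sqrt (by norm_num)]
    norm_num
  rw [Matrix.mem_unitaryGroup_iff]
  ext x y
  rw [Matrix.mul_apply, ← (Equiv.funUnique (Fin 1) Bool).symm.sum_comp]
  have hx : x = fun _ => x 0 := by funext i; rw [Subsingleton.elim i 0]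
  have hy : y = fun _ => y 0 := by funext i; rw [Subsingleton.elim i 0]
  rw [hx, hy]
  generalize x 0 = a
  generalize y 0 = b
  have e : ((fun _ : Fin 1 => a) = fun _ => b) ↔ a = b :=
    ⟨fun h => congrFun h 0, fun h => by rw [h]⟩
  simp only [Matrix.one_apply, e, Fintype.sum_bool]
  cases a <;> cases b <;>
    simp [hadamard, Matrix.star_apply, h2, Equiv.funUnique] <;> norm_num

theorem tGate_unitary : tGate ∈ Matrix.unitaryGroup (Fin 1 → Bool) ℂ := by
  rw [Matrix.mem_unitaryGroup_iff, tGate, Matrix.star_eq_conjTranspose,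
    Matrix.diagonal_conjTranspose, Matrix.diagonal_mul_diagonal, ← Matrix.diagonal_one]
  congr 1
  funext x
  cases h : x 0
  · simp [h]
  · simp only [h, if_true, Pi.star_apply, RCLike.star_def, ← Complex.exp_conj, map_mul,
      Complex.conj_ofReal, Complex.conj_I, ← Complex.exp_add]
    simp

theorem cnot_unitary : cnot ∈ Matrix.unitaryGroup (Fin 2 → Bool) ℂ := by
  rw [Matrix.mem_unitaryGroup_iff]
  ext x y
  rw [Matrix.mul_apply, ← (finTwoArrowEquiv Bool).symm.sum_comp, Fintype.sum_prod_type]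
  have e : x = y ↔ x 0 = y 0 ∧ x 1 = y 1 := by
    rw [funext_iff, Fin.forall_fin_two]
  simp only [Matrix.one_apply, e, Fintype.sum_bool, cnot, Matrix.star_apply, Matrix.of_apply]
  generalize x 0 = a
  generalize x 1 = b
  generalize y 0 = c
  generalize y 1 = d
  cases a <;> cases b <;> cases c <;> cases d <;> simp

/-- The universal gate set of the Hadamard gate, the T gate and the CNOT gate. -/
def standardLib : GateLib where
  one g := if g = [] then ⟨hadamard, hadamard_unitary⟩ else ⟨tGate, tGate_unitary⟩
  two _ := ⟨cnot, cnot_unitary⟩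

/-- The promise problem with yes-instances `yes` and no-instances `no` is in BQP: a program that
makes no use of its environment (it works in every environment) computes in polynomial time, from
`x`, a quantum circuit of polynomial size that accepts yes-instances with probability at least `2/3` and no-instances with probability at most
`1/3`. -/
def InBQP (yes no : Set (List Bool)) : Prop :=
  ∃ (P : Cmd) (t : Polynomial ℕ) (C : List Bool → QCircuit),
    (∀ (E : Env) (x : List Bool),
      haltProb E P (.ofBits x) (t.eval x.length) {(C x).enc} = 1 ∧
        (C x).enc.size ≤ t.eval x.length) ∧
    (∀ x ∈ yes, 2 / 3 ≤ (C x).acceptProb standardLib) ∧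
    (∀ x ∈ no, (C x).acceptProb standardLib ≤ 1 / 3)

/-! ### Text circuits and their random model -/

/-- A box: its label and the wires that it acts on. -/
structure Box (k : ℕ) where
  word : ℕ
  arity : ℕ
  inputs : Fin arity ↪ Fin k

/-- A text circuit without frames: one state for each wire (a noun of its own), followed by boxes
that act one after the other. -/
structure Text where
  wires : ℕ
  boxes : List (Box wires)

def Box.enc {k : ℕ} (b : Box k) : Val :=
  .ofList [.ofNatBin b.word, .ofNat b.arity,
    .ofList ((List.finRange b.arity).map fun i => .ofNat (b.inputs i).val)]

def Text.enc (T : Text) : Val := .cons (.ofNat T.wires) (.ofList (T.boxes.map Box.enc))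

/-- `n` independent draws. -/
def iid {α : Type} (p : PMF α) : ℕ → PMF (List α)
  | 0 => PMF.pure []
  | n + 1 => p.bind fun a => (iid p n).map fun l => a :: l

/-- Zipf's law, for words numbered by their frequency rank: the frequency of the word of rank
`r + 1` is proportional to a power of `r + 1`. -/
def Zipf (p : PMF ℕ) : Prop :=
  ∃ c s : ℝ, ∀ r : ℕ, (p r).toReal = c * ((r : ℝ) + 1) ^ (-s)

/-- The expected number of distinct words among `N` independent draws. -/
def expectedVocabulary (p : PMF ℕ) (N : ℕ) : ℝ :=
  ∑' l : List ℕ, (iid p N l).toReal * l.toFinset.card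

/-- Heaps' law with exponent `1/2`: the vocabulary grows like the square root of the length. -/
def Heaps (p : PMF ℕ) : Prop :=
  ∃ c : ℝ, 0 < c ∧
    Filter.Tendsto (fun N : ℕ => expectedVocabulary p N / √(N : ℝ)) Filter.atTop (nhds c)

instance nonempty_inputs (a k : ℕ) : Nonempty (Fin (min a k) ↪ Fin k) :=
  ⟨Fin.castLEEmb (min_le_right a k)⟩

/-- A random box on `k` wires: the label is drawn from `words`, the number of inputs from `arity`
(cut off at the number of wires), and the inputs uniformly among all choices of distinct wires. -/
def randomBox (words arity : PMF ℕ) (k : ℕ) : PMF (Box k) :=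
  words.bind fun r => arity.bind fun a =>
    (PMF.uniformOfFintype (Fin (min a k) ↪ Fin k)).map fun e => ⟨r, min a k, e⟩

/-- The data of a family of distributions of text circuits. -/
structure TextModel where
  /-- the distribution of the number of boxes of a text with `k` wires -/
  boxCount : ℕ → PMF ℕ
  /-- the distribution of the label of a box -/
  words : PMF ℕ
  /-- the distribution of the number of inputs of a box -/
  arity : PMF ℕ
  /-- with high probability there are `Ω(k ^ γ)` boxes, for some `γ > 4` -/
  many_boxes : ∃ γ : ℝ, 4 < γ ∧ ∃ c : ℝ, 0 < c ∧
    Filter.Tendsto (fun k : ℕ => prob (boxCount k) {w | c * (k : ℝ) ^ γ ≤ (w : ℝ)})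
      Filter.atTop (nhds 1)
  /-- texts are polynomially sized -/
  poly_boxes : ∃ b : Polynomial ℕ, ∀ k, ∀ w ∈ (boxCount k).support, w ≤ b.eval k
  zipf : Zipf words
  heaps : Heaps words
  arity_two : arity 2 ≠ 0

/-- The distribution of text circuits with `k` states. -/
def TextModel.dist (D : TextModel) (k : ℕ) : PMF Text :=
  (D.boxCount k).bind fun w => (iid (randomBox D.words D.arity k) w).map fun l => ⟨k, l⟩

/-! ### Word embeddings and question answering -/

/-- The circuit assigned to a word when it labels a box with `arity` inputs. -/
structure WordEntry (q : ℕ) where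
  word : ℕ
  arity : ℕ
  circuit : List (Gate (Fin arity × Fin q))

/-- The circuit that prepares the noun on wire `wire` of text number `text`. -/
structure StateEntry (q : ℕ) where
  text : ℕ
  wire : ℕ
  circuit : List (Gate (Fin q))

/-- A set of word embeddings with `q` qubits for each wire. Words that are not listed are mapped
to the identity, nouns that are not listed to `|0…0⟩`; of several entries for the same word the
first one counts. -/
structure Embedding where
  q : ℕ
  words : List (WordEntry q)
  states : List (StateEntry q)

namespace Embedding

def word (V : Embedding) (r a : ℕ) : List (Gate (Fin a × Fin V.q)) :=
  ((V.words.filterMap fun e =>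
    if h : e.word = r ∧ e.arity = a then some (h.2 ▸ e.circuit) else none).head?).getD []

def state (V : Embedding) (t i : ℕ) : List (Gate (Fin V.q)) :=
  ((V.states.filterMap fun e =>
    if e.text = t ∧ e.wire = i then some e.circuit else none).head?).getD []

/-- The quantum circuit of a text, read as text number `t`: the circuits of its nouns, then the
circuits of its boxes. -/
def compile (V : Embedding) (t : ℕ) (T : Text) : List (Gate (Fin T.wires × Fin V.q)) :=
  ((List.finRange T.wires).flatMap fun i : Fin T.wires =>
    (V.state t i).map (Gate.map ⟨fun j => (i, j), Prod.mk_right_injective i⟩)) ++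
  T.boxes.flatMap fun b =>
    (V.word b.word b.arity).map
      (Gate.map (b.inputs.prodMap (Function.Embedding.refl (Fin V.q))))

/-- The state `ρ` of a text. -/
def rho (L : GateLib) (V : Embedding) (t : ℕ) (T : Text) : Op (Fin T.wires × Fin V.q) :=
  density (circuitOp L (V.compile t T))

def enc (V : Embedding) : Val :=
  .ofList [.ofNat V.q,
    .ofList (V.words.map fun e => .ofList [.ofNatBin e.word, .ofNat e.arity,
      .ofList (e.circuit.map (Gate.enc fun i => .cons (.ofNat i.1.val) (.ofNat i.2.val)))]),
    .ofList (V.states.map fun e => .ofList [.ofNat e.text, .ofNat e.wire,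
      .ofList (e.circuit.map (Gate.enc fun i => .ofNat i.val))])]

end Embedding

/-- An instance of question answering. The wires of a question are compared with the first wires
of the context. The context is text number `0`, the questions are the texts number `1, 2, …`. -/
structure QAInstance where
  embedding : Embedding
  context : Text
  questions : List Text
  wires_le : ∀ Q ∈ questions, Q.wires ≤ context.wires

namespace QAInstance

/-- `tr (ρ_T (ρ_Q ⊗ I))` for the question number `i`, counted from `0`. -/
def overlap (L : GateLib) (I : QAInstance) (i : Fin I.questions.length) : ℝ :=
  (Matrix.trace (I.embedding.rho L 0 I.context *
    tensorId
      ((Fin.castLEEmb (I.wires_le _ (List.get_mem I.questions i))).prodMap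
        (Function.Embedding.refl (Fin I.embedding.q)))
      (I.embedding.rho L (i + 1) (I.questions.get i)))).re

/-- `j` is a correct answer with precision `ε`. -/
def IsAnswer (L : GateLib) (ε : ℝ) (I : QAInstance) (j : ℕ) : Prop :=
  ∃ h : j < I.questions.length, |I.overlap L ⟨j, h⟩ - ⨆ i, I.overlap L i| < ε

def enc (I : QAInstance) : Val :=
  .ofList [I.embedding.enc, I.context.enc, .ofList (I.questions.map Text.enc)]

end QAInstance

/-- A context with `k` wires and two questions with one wire each, drawn independently. -/
def drawTexts (D : TextModel) (k : ℕ) : PMF (Text × Text × Text) :=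
  (D.dist k).bind fun T => (D.dist 1).bind fun Q₁ => (D.dist 1).map fun Q₂ => (T, Q₁, Q₂)

/-- Except with probability at most `δ` over the texts, the oracle answers correctly for all word
embeddings. -/
def SolvesOnAverage (L : GateLib) (D : TextModel) (ε δ : ℝ) (k : ℕ) (O : Val → ℕ) : Prop :=
  1 - δ ≤ prob (drawTexts D k)
    {τ | ∀ I : QAInstance, I.context = τ.1 → I.questions = [τ.2.1, τ.2.2] →
      I.IsAnswer L ε (O I.enc)}

/-- The environment of a program: an oracle, and samples of the text distributions. -/
def textEnv (D : TextModel) (O : Val → ℕ) : Env where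
  oracle := O
  draw k := (D.dist k).map Text.enc

/-- A number `r` in unary, and a further input. -/
def withParam (r : ℕ) (x : Val) : Val := .cons (.ofNat r) x

/-- Average-case BQP-hardness over texts with `k` wires, `k` in `K`: every problem in BQP is
decided in polynomial time, with error probability at most `2 ^ (-r)` for any given `r`, with the
help of any oracle that solves question answering for texts drawn at random, up to a fraction `δ`
of them, and for all embeddings. -/
def AverageCaseBQPHard (D : TextModel) (ε δ : ℝ) (K : Set ℕ) : Prop :=
  ∀ yes no : Set (List Bool), InBQP yes no →
    ∃ (P : Cmd) (t : Polynomial ℕ), ∀ O : Val → ℕ,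
      (∀ k ∈ K, SolvesOnAverage standardLib D ε δ k O) →
      ∀ (x : List Bool) (r : ℕ),
        (x ∈ yes → 1 - (1 / 2 : ℝ) ^ r ≤
          haltProb (textEnv D O) P (withParam r (.ofBits x)) (t.eval (x.length + r)) accepting) ∧
        (x ∈ no → 1 - (1 / 2 : ℝ) ^ r ≤
          haltProb (textEnv D O) P (withParam r (.ofBits x)) (t.eval (x.length + r)) rejecting)

end QDisCo

end

noncomputable section

namespace QDisCo

open scoped ENNReal

/-! ### Discrete probability -/

/-! A whole circuit C fits into one box. Give every wire as many qubits as C has, take a box of the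
context that has two inputs, the first of them being the first wire, and let its word mean C, with
the first qubit of C on the first input and all others on the second. If this word labels no other
box and every other word means the identity, the context compiles to C alone. A question has one
wire, so no box of it has two inputs and only its noun matters; the nouns are |0…0⟩ and the basis
state whose first qubit is 1. The two overlaps are then the probabilities of the outcomes 0 and 1
for the first qubit of C (`overlap_splitInstance`). Under the promise they differ by at least 1/3 >
ε, so the answer tells the cases apart (`answer_of_isAnswer`).

Large random texts contain such a box with high probability (`exists_good_text`). Summability forces
a Zipf exponent s > 1, and Heaps' law forces s ≤ 2, because for s > 2 the vocabulary would be o(√N).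
Among N boxes, call words of rank at least R ≈ N^ω rare, with ω slightly above 2/(2s − 1). The
chance that some rare word occurs twice is about N² R^(1−2s), which tends to 0. The expected number
of suitable boxes with a rare word is of order N · k⁻¹ · R^(1−s), which tends to infinity because (s
− 1)/(2s − 1) ≤ 1/3 and k = O(N^(1/4)). The algorithm need not know R: as R is a power of two, the
suitable box whose rank has the most bits carries a rare word as soon as any suitable box does
(`GoodText.split`).

One round on fresh texts is right with probability at least 1 − δ − η > 1/2, and a majority vote
over independent rounds amplifies this (`votes_success`). The time limit is absolute while words can
be arbitrarily long, so a round with oversized texts counts as a failure; this is affordable because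
long words are exponentially rare in their length. Together this gives `decideCircuit_success`. For
a problem in BQP, the program that computes the circuit runs first, as a part of the algorithm
(`success_subprogram`). -/

theorem toOuterMeasure_add_compl {α : Type} (p : PMF α) (S : Set α) :
    p.toOuterMeasure S + p.toOuterMeasure Sᶜ = 1 := by
  rw [PMF.toOuterMeasure_apply, PMF.toOuterMeasure_apply, ← ENNReal.tsum_add, ← p.tsum_coe]
  refine tsum_congr fun a => ?_
  exact congrFun (Set.indicator_self_add_compl S p) a

theorem toOuterMeasure_le_one {α : Type} (p : PMF α) (S : Set α) : p.toOuterMeasure S ≤ 1 :=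
  le_self_add.trans (toOuterMeasure_add_compl p S).le

theorem ofReal_prob {α : Type} (p : PMF α) (S : Set α) :
    ENNReal.ofReal (prob p S) = p.toOuterMeasure S :=
  ENNReal.ofReal_toReal (ne_top_of_le_ne_top ENNReal.one_ne_top (toOuterMeasure_le_one p S))

theorem prob_nonneg {α : Type} (p : PMF α) (S : Set α) : 0 ≤ prob p S := ENNReal.toReal_nonneg

theorem prob_le_one {α : Type} (p : PMF α) (S : Set α) : prob p S ≤ 1 :=
  ENNReal.toReal_le_of_le_ofReal zero_le_one (by simpa using toOuterMeasure_le_one p S)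

theorem prob_add_compl {α : Type} (p : PMF α) (S : Set α) : prob p S + prob p Sᶜ = 1 := by
  rw [prob, prob, ← ENNReal.toReal_add, toOuterMeasure_add_compl, ENNReal.toReal_one]
  all_goals exact ne_top_of_le_ne_top ENNReal.one_ne_top (toOuterMeasure_le_one p _)

theorem prob_mono {α : Type} (p : PMF α) {S T : Set α} (h : S ⊆ T) : prob p S ≤ prob p T :=
  ENNReal.toReal_mono (ne_top_of_le_ne_top ENNReal.one_ne_top (toOuterMeasure_le_one p T))
    (MeasureTheory.measure_mono h)

theorem prob_union_le {α : Type} (p : PMF α) (S T : Set α) :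
    prob p (S ∪ T) ≤ prob p S + prob p T := by
  rw [prob, prob, prob, ← ENNReal.toReal_add]
  · refine ENNReal.toReal_mono ?_ (MeasureTheory.measure_union_le S T)
    exact ENNReal.add_ne_top.2
      ⟨ne_top_of_le_ne_top ENNReal.one_ne_top (toOuterMeasure_le_one p S),
        ne_top_of_le_ne_top ENNReal.one_ne_top (toOuterMeasure_le_one p T)⟩
  all_goals exact ne_top_of_le_ne_top ENNReal.one_ne_top (toOuterMeasure_le_one p _)

theorem tsum_map_mul {α β : Type} (p : PMF α) (f : α → β) (g : β → ℝ≥0∞) :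
    ∑' b, p.map f b * g b = ∑' a, p a * g (f a) := by
  classical
  simp only [PMF.map_apply, ← ENNReal.tsum_mul_right]
  rw [ENNReal.tsum_comm]
  refine tsum_congr fun a => ?_
  rw [tsum_eq_single (f a)]
  · simp
  · intro b hb
    simp [hb]

/-- A lower bound for a mixture from lower bounds on a set of outcomes. -/
theorem mul_le_toOuterMeasure_bind {α β : Type} (p : PMF α) (f : α → PMF β) (S : Set α)
    (T : Set β) (v : ℝ≥0∞) (h : ∀ a ∈ S, v ≤ (f a).toOuterMeasure T) :
    p.toOuterMeasure S * v ≤ (p.bind f).toOuterMeasure T := by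
  rw [PMF.toOuterMeasure_bind_apply, PMF.toOuterMeasure_apply, ← ENNReal.tsum_mul_right]
  refine ENNReal.tsum_le_tsum fun a => ?_
  by_cases ha : a ∈ S
  · rw [Set.indicator_of_mem ha]
    exact mul_le_mul_right (h a ha) _
  · rw [Set.indicator_of_notMem ha, zero_mul]
    exact zero_le

/-- An upper bound for a mixture: outcomes outside of `S` count in full. -/
theorem toOuterMeasure_bind_le {α β : Type} (p : PMF α) (f : α → PMF β) (S : Set α)
    (T : Set β) (v : ℝ≥0∞) (h : ∀ a ∈ S, (f a).toOuterMeasure T ≤ v) :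
    (p.bind f).toOuterMeasure T ≤ v + p.toOuterMeasure Sᶜ := by
  rw [PMF.toOuterMeasure_bind_apply, PMF.toOuterMeasure_apply]
  calc ∑' a, p a * (f a).toOuterMeasure T ≤ ∑' a, (p a * v + Sᶜ.indicator p a) := by
        refine ENNReal.tsum_le_tsum fun a => ?_
        by_cases ha : a ∈ S
        · exact (mul_le_mul_right (h a ha) _).trans le_self_add
        · rw [Set.indicator_of_mem (show a ∈ Sᶜ from ha)]
          refine le_trans ?_ le_add_self
          exact (mul_le_mul_right (toOuterMeasure_le_one _ _) _).trans (mul_one _).le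
    _ = v + ∑' a, Sᶜ.indicator p a := by
        rw [ENNReal.tsum_add, ENNReal.tsum_mul_right, p.tsum_coe, one_mul]

theorem toOuterMeasure_bind_le_of_support {α β : Type} (p : PMF α) (f : α → PMF β)
    (T : Set β) (v : ℝ≥0∞) (h : ∀ a ∈ p.support, (f a).toOuterMeasure T ≤ v) :
    (p.bind f).toOuterMeasure T ≤ v := by
  refine (toOuterMeasure_bind_le p f p.support T v h).trans ?_
  rw [(p.toOuterMeasure_apply_eq_zero_iff _).2 disjoint_compl_right, add_zero]

theorem iid_forall {α : Type} (p : PMF α) (S : Set α) (n : ℕ) :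
    (iid p n).toOuterMeasure {l | ∀ a ∈ l, a ∈ S} = p.toOuterMeasure S ^ n := by
  induction n with
  | zero => simp [iid, PMF.toOuterMeasure_pure_apply]
  | succ n ih =>
    rw [iid, PMF.toOuterMeasure_bind_apply, pow_succ', ← ih, PMF.toOuterMeasure_apply,
      ← ENNReal.tsum_mul_right]
    refine tsum_congr fun a => ?_
    rw [PMF.toOuterMeasure_map_apply]
    by_cases ha : a ∈ S
    · rw [Set.indicator_of_mem ha]
      congr 2
      ext l
      simp [ha]
    · rw [Set.indicator_of_notMem ha, zero_mul]
      have : ((fun l => a :: l) ⁻¹' {l : List α | ∀ a ∈ l, a ∈ S}) = ∅ := by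
        ext l
        simp [ha]
      rw [this]
      simp

theorem iid_exists_le {α : Type} (p : PMF α) (S : Set α) (n : ℕ) :
    (iid p n).toOuterMeasure {l | ∃ a ∈ l, a ∈ S} ≤ n * p.toOuterMeasure S := by
  induction n with
  | zero => simp [iid, PMF.toOuterMeasure_pure_apply]
  | succ n ih =>
    rw [iid]
    refine (toOuterMeasure_bind_le p _ Sᶜ _ (n * p.toOuterMeasure S) ?_).trans ?_
    · intro a ha
      rw [PMF.toOuterMeasure_map_apply]
      refine le_trans (MeasureTheory.measure_mono ?_) ih
      rintro l ⟨b, hb, hbS⟩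
      rcases List.mem_cons.1 hb with rfl | hb
      · exact absurd hbS ha
      · exact ⟨b, hb, hbS⟩
    · rw [compl_compl]
      push_cast
      rw [add_mul, one_mul]

/-- Union bound over pairs, with the sum on the right as the probability that two independent draws
are related. A new draw adds n pairs, and n² + n ≤ (n + 1)². -/
theorem iid_not_pairwise_le {α : Type} (p : PMF α) (c : α → α → Prop) (n : ℕ) :
    (iid p n).toOuterMeasure {l | ¬ l.Pairwise fun a b => ¬ c a b} ≤
      (n : ℝ≥0∞) ^ 2 * ∑' a, p a * p.toOuterMeasure {b | c a b} := by
  induction n with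
  | zero => simp [iid, PMF.toOuterMeasure_pure_apply]
  | succ n ih =>
    set κ := ∑' a, p a * p.toOuterMeasure {b | c a b} with hκ
    rw [iid, PMF.toOuterMeasure_bind_apply]
    calc ∑' a, p a * ((iid p n).map fun l => a :: l).toOuterMeasure
            {l | ¬ l.Pairwise fun a b => ¬ c a b}
        ≤ ∑' a, (p a * ((n : ℝ≥0∞) ^ 2 * κ) + n * (p a * p.toOuterMeasure {b | c a b})) := by
          refine ENNReal.tsum_le_tsum fun a => ?_
          rw [PMF.toOuterMeasure_map_apply, mul_left_comm (n : ℝ≥0∞), ← mul_add]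
          refine mul_le_mul_right ?_ _
          refine le_trans (MeasureTheory.measure_mono (t :=
            {l | ¬ l.Pairwise fun a b => ¬ c a b} ∪ {l | ∃ b ∈ l, b ∈ {b | c a b}}) ?_)
            ((MeasureTheory.measure_union_le _ _).trans (add_le_add ih (iid_exists_le p _ n)))
          intro l hl
          by_contra h
          simp only [Set.mem_union, Set.mem_ofPred_eq, not_or, not_not, not_exists, not_and] at h
          exact hl (List.pairwise_cons.2 ⟨h.2, h.1⟩)
      _ = ((n : ℝ≥0∞) ^ 2 + n) * κ := by
          rw [ENNReal.tsum_add, ENNReal.tsum_mul_right, ENNReal.tsum_mul_left, p.tsum_coe, one_mul,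
            add_mul]
      _ ≤ ((n + 1 : ℕ) : ℝ≥0∞) ^ 2 * κ := by
          refine mul_le_mul_left ?_ _
          have : n ^ 2 + n ≤ (n + 1) ^ 2 := by nlinarith
          exact_mod_cast this

theorem length_of_mem_support_iid {α : Type} (p : PMF α) (n : ℕ) :
    ∀ l ∈ (iid p n).support, l.length = n := by
  induction n with
  | zero => simp [iid]
  | succ n ih =>
    intro l hl
    simp only [iid, PMF.mem_support_bind_iff, PMF.support_map, Set.mem_image] at hl
    obtain ⟨a, _, l', hl', rfl⟩ := hl
    simp [ih l' hl']

/-! ### Random boxes -/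

theorem map_word_randomBox (words arity : PMF ℕ) (k : ℕ) :
    (randomBox words arity k).map Box.word = words := by
  simp only [randomBox, PMF.map_bind, PMF.map_comp]
  conv_rhs => rw [← PMF.bind_pure words]
  congr 1
  funext r
  have : ∀ a, (PMF.uniformOfFintype (Fin (min a k) ↪ Fin k)).map
      (Box.word ∘ fun e => (⟨r, min a k, e⟩ : Box k)) = PMF.pure r := fun a =>
    PMF.map_const _ r
  simp only [this]
  exact PMF.bind_const _ _

theorem randomBox_word (words arity : PMF ℕ) (k : ℕ) (W : Set ℕ) :
    (randomBox words arity k).toOuterMeasure {b | b.word ∈ W} = words.toOuterMeasure W := by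
  conv_rhs => rw [← map_word_randomBox words arity k]
  rw [PMF.toOuterMeasure_map_apply]
  rfl

/-- By symmetry: exchanging the wires j and 0 is a bijection between the injections that start with
j and those that start with 0, so the first input is uniform. -/
theorem uniform_first_input (m k : ℕ) (hm : 1 ≤ m) [Nonempty (Fin m ↪ Fin k)] :
    (PMF.uniformOfFintype (Fin m ↪ Fin k)).toOuterMeasure
      {e | ∀ i : Fin m, i.val = 0 → (e i).val = 0} = (k : ℝ≥0∞)⁻¹ := by
  classical
  obtain ⟨e₀⟩ := ‹Nonempty (Fin m ↪ Fin k)›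
  let z : Fin m := ⟨0, hm⟩
  have hk : 0 < k := (e₀ z).pos
  let w : Fin k := ⟨0, hk⟩
  have hset : {e : Fin m ↪ Fin k | ∀ i : Fin m, i.val = 0 → (e i).val = 0} = {e | e z = w} := by
    ext e
    constructor
    · intro h
      exact Fin.ext (h z rfl)
    · intro h i hi
      have : i = z := Fin.ext hi
      rw [this, show e z = w from h]
  have hcard : ∀ j : Fin k, Fintype.card {e : Fin m ↪ Fin k | e z = j} =
      Fintype.card {e : Fin m ↪ Fin k | e z = w} := by
    intro j
    refine Fintype.card_congr ⟨fun e => ⟨e.1.trans (Equiv.swap j w).toEmbedding, ?_⟩,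
      fun e => ⟨e.1.trans (Equiv.swap j w).toEmbedding, ?_⟩, ?_, ?_⟩
    · have := e.2
      simp only [Set.mem_ofPred_eq] at this ⊢
      simp [this]
    · have := e.2
      simp only [Set.mem_ofPred_eq] at this ⊢
      simp [this]
    · intro e
      ext i
      simp
    · intro e
      ext i
      simp
  have htot : Fintype.card (Fin m ↪ Fin k) =
      k * Fintype.card {e : Fin m ↪ Fin k | e z = w} := by
    have h1 : Fintype.card (Fin m ↪ Fin k) =
        ∑ j : Fin k, Fintype.card {e : Fin m ↪ Fin k | e z = j} := by
      rw [← Finset.card_univ, Finset.card_eq_sum_card_fiberwise (f := fun e => e z)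
        (t := Finset.univ) (fun _ _ => Finset.mem_coe.2 (Finset.mem_univ _))]
      refine Finset.sum_congr rfl fun j _ => ?_
      rw [← Set.toFinset_card]
      congr 1
      ext e
      simp
    rw [h1, Finset.sum_congr rfl fun j _ => hcard j]
    simp
  rw [hset, PMF.toOuterMeasure_uniformOfFintype_apply, htot]
  have hne : (Fintype.card {e : Fin m ↪ Fin k | e z = w} : ℝ≥0∞) ≠ 0 := by
    intro h0
    have h1 : Fintype.card {e : Fin m ↪ Fin k | e z = w} = 0 := by exact_mod_cast h0
    rw [h1, mul_zero] at htot
    exact (Fintype.card_pos_iff.2 ⟨e₀⟩).ne' htot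
  push_cast
  rw [ENNReal.div_eq_inv_mul, ENNReal.mul_inv (Or.inr (ENNReal.natCast_ne_top _))
    (Or.inl (ENNReal.natCast_ne_top k)), mul_assoc,
    ENNReal.inv_mul_cancel hne (ENNReal.natCast_ne_top _), mul_one]

end QDisCo

end

noncomputable section

namespace QDisCo

/-! ### Tensoring with the identity -/

section TensorId

variable {κ ι μ : Type}

/-- A bit string that agrees with `x` off the range of `e` is determined by its restriction along
`e`; the inverse of the restriction is `Function.extend`. This reindexing drives the
multiplicativity of `tensorId` and the computation of overlaps. -/
theorem sum_agree_off_range [Fintype κ] [Fintype ι] {M : Type*} [AddCommMonoid M]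
    [DecidableEq ι] [DecidableEq κ]
    (e : κ ↪ ι) (x : ι → Bool) (F : (κ → Bool) → M)
    [DecidablePred fun z : ι → Bool => ∀ i, i ∉ Set.range e → z i = x i] :
    (∑ z : ι → Bool, if ∀ i, i ∉ Set.range e → z i = x i then F (z ∘ e) else 0) = ∑ w, F w := by
  rw [← Finset.sum_filter]
  refine Finset.sum_nbij' (fun z => z ∘ e) (fun w => Function.extend e w x) ?_ ?_ ?_ ?_ ?_
  · intro z _; exact Finset.mem_univ _
  · intro w _
    simp only [Finset.mem_filter, Finset.mem_univ, true_and]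
    intro i hi
    exact Function.extend_apply' _ _ _ (by simpa using hi)
  · intro z hz
    simp only [Finset.mem_filter, Finset.mem_univ, true_and] at hz
    funext i
    by_cases hi : i ∈ Set.range e
    · obtain ⟨j, rfl⟩ := hi
      simp [e.injective.extend_apply]
    · rw [Function.extend_apply' _ _ _ (by simpa using hi), hz i hi]
  · intro w _
    funext j
    simp [e.injective.extend_apply]
  · intro z _; rfl

theorem tensorId_apply (e : κ ↪ ι) (A : Op κ) (x y : ι → Bool)
    [Decidable (∀ i, i ∉ Set.range e → x i = y i)] :
    tensorId e A x y = if ∀ i, i ∉ Set.range e → x i = y i then A (x ∘ e) (y ∘ e) else 0 := by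
  simp only [tensorId, Matrix.of_apply]
  congr

open Classical in
theorem tensorId_mul [Fintype κ] [Fintype ι] [DecidableEq κ] [DecidableEq ι] (e : κ ↪ ι) (A B : Op κ) :
    tensorId e (A * B) = tensorId e A * tensorId e B := by
  ext x y
  rw [Matrix.mul_apply, tensorId_apply]
  simp only [tensorId_apply]
  split_ifs with h
  · rw [Matrix.mul_apply, ← sum_agree_off_range e x]
    refine Finset.sum_congr rfl fun z _ => ?_
    by_cases hz : ∀ i, i ∉ Set.range e → z i = x i
    · rw [if_pos hz, if_pos fun i hi => (hz i hi).symm,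
        if_pos fun i hi => (hz i hi).trans (h i hi)]
    · rw [if_neg hz, if_neg fun h' => hz fun i hi => (h' i hi).symm, zero_mul]
  · symm
    refine Finset.sum_eq_zero fun z _ => ?_
    by_cases hz : ∀ i, i ∉ Set.range e → x i = z i
    · rw [if_neg (c := ∀ i, i ∉ Set.range e → z i = y i)
        fun h' => h fun i hi => (hz i hi).trans (h' i hi), mul_zero]
    · rw [if_neg hz, zero_mul]

open Classical in
theorem tensorId_one [Fintype κ] [Fintype ι] [DecidableEq κ] [DecidableEq ι] (e : κ ↪ ι) :
    tensorId e (1 : Op κ) = 1 := by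
  ext x y
  rw [tensorId_apply, Matrix.one_apply, Matrix.one_apply]
  by_cases h : x = y
  · subst h; simp
  · rw [if_neg h]
    split_ifs with h1 h2
    · refine absurd (funext fun i => ?_) h
      by_cases hi : i ∈ Set.range e
      · obtain ⟨j, rfl⟩ := hi
        exact congrFun h2 j
      · exact h1 i hi
    · rfl
    · rfl

open Classical in
theorem tensorId_trans (f : μ ↪ κ) (e : κ ↪ ι) (A : Op μ) :
    tensorId (f.trans e) A = tensorId e (tensorId f A) := by
  ext x y
  rw [tensorId_apply, tensorId_apply, tensorId_apply]
  by_cases h : ∀ i, i ∉ Set.range e → x i = y i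
  · rw [if_pos h]
    have key : (∀ i, i ∉ Set.range (f.trans e) → x i = y i) ↔
        ∀ j, j ∉ Set.range f → (x ∘ e) j = (y ∘ e) j := by
      constructor
      · intro h' j hj
        refine h' (e j) ?_
        rintro ⟨a, ha⟩
        exact hj ⟨a, e.injective ha⟩
      · intro h' i hi
        by_cases hi' : i ∈ Set.range e
        · obtain ⟨j, rfl⟩ := hi'
          refine h' j ?_
          rintro ⟨a, rfl⟩
          exact hi ⟨a, rfl⟩
        · exact h i hi'
    simp only [key]
    rfl
  · rw [if_neg h, if_neg]
    intro h'
    refine h fun i hi => h' i ?_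
    rintro ⟨a, rfl⟩
    exact hi ⟨f a, rfl⟩

open Classical in
theorem star_tensorId (e : κ ↪ ι) (A : Op κ) :
    star (tensorId e A) = tensorId e (star A) := by
  ext x y
  rw [Matrix.star_apply, tensorId_apply, tensorId_apply, Matrix.star_apply]
  by_cases h : ∀ i, i ∉ Set.range e → x i = y i
  · rw [if_pos h, if_pos fun i hi => (h i hi).symm]
  · rw [if_neg h, if_neg fun h' => h fun i hi => (h' i hi).symm, star_zero]

theorem tensorId_unitary [Fintype κ] [Fintype ι] [DecidableEq κ] [DecidableEq ι] (e : κ ↪ ι)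
    {A : Op κ} (hA : A ∈ Matrix.unitaryGroup (κ → Bool) ℂ) :
    tensorId e A ∈ Matrix.unitaryGroup (ι → Bool) ℂ := by
  rw [Matrix.mem_unitaryGroup_iff] at hA ⊢
  rw [star_tensorId, ← tensorId_mul, hA, tensorId_one]

end TensorId

/-! ### Circuits -/

section Circuits

variable {ι κ : Type} [Fintype ι] [DecidableEq ι]

/-- The NOT gate. -/
def notGate : Op (Fin 1) := Matrix.of fun x y => if x 0 = y 0 then 0 else 1

theorem notGate_unitary : notGate ∈ Matrix.unitaryGroup (Fin 1 → Bool) ℂ := by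
  rw [Matrix.mem_unitaryGroup_iff]
  ext x y
  rw [Matrix.mul_apply, ← (Equiv.funUnique (Fin 1) Bool).symm.sum_comp]
  have e : x = y ↔ x 0 = y 0 := by rw [funext_iff, Fin.forall_fin_one]
  simp only [Matrix.one_apply, e, Fintype.sum_bool, notGate, Matrix.star_apply, Matrix.of_apply]
  generalize x 0 = a
  generalize y 0 = b
  cases a <;> cases b <;> simp [Equiv.funUnique]

theorem Gate.op_unitary (L : GateLib) (g : Gate ι) :
    g.op L ∈ Matrix.unitaryGroup (ι → Bool) ℂ := by
  cases g with
  | not i => exact tensorId_unitary _ notGate_unitary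
  | one g i => exact tensorId_unitary _ (L.one g).2
  | two g w => exact tensorId_unitary _ (L.two g).2

theorem circuitOp_unitary (L : GateLib) (c : List (Gate ι)) :
    circuitOp L c ∈ Matrix.unitaryGroup (ι → Bool) ℂ := by
  induction c with
  | nil => exact one_mem _
  | cons g c ih => exact mul_mem ih (g.op_unitary L)

omit [Fintype ι] [DecidableEq ι] in
theorem Gate.op_map (L : GateLib) (e : ι ↪ κ) (g : Gate ι) :
    (g.map e).op L = tensorId e (g.op L) := by
  cases g with
  | not i => exact tensorId_trans (Gate.single i) e _
  | one g i => exact tensorId_trans (Gate.single i) e _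
  | two g w => exact tensorId_trans w e _

theorem circuitOp_map [Fintype κ] [DecidableEq κ] (L : GateLib) (e : ι ↪ κ) (c : List (Gate ι)) :
    circuitOp L (c.map (Gate.map e)) = tensorId e (circuitOp L c) := by
  induction c with
  | nil => exact (tensorId_one e).symm
  | cons g c ih =>
    rw [List.map_cons, circuitOp, circuitOp, ih, Gate.op_map, tensorId_mul]

theorem sum_norm_sq_column {U : Op ι} (hU : U ∈ Matrix.unitaryGroup (ι → Bool) ℂ)
    (y : ι → Bool) : ∑ x, ‖U x y‖ ^ 2 = 1 := by
  have h := congrFun (congrFun ((Matrix.mem_unitaryGroup_iff').1 hU) y) y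
  rw [Matrix.mul_apply, Matrix.one_apply_eq] at h
  have h2 : ∀ x, star U y x * U x y = ((‖U x y‖ ^ 2 : ℝ) : ℂ) := by
    intro x
    rw [Matrix.star_apply, RCLike.star_def, ← Complex.normSq_eq_conj_mul_self,
      Complex.normSq_eq_norm_sq]
  simp only [h2] at h
  exact_mod_cast h

theorem density_apply (U : Op ι) (x y : ι → Bool) :
    density U x y = U x (fun _ => false) * star (U y fun _ => false) := by
  rw [density, Matrix.mul_apply, Finset.sum_eq_single (fun _ => false)]
  · rw [Matrix.mul_single_apply_same, mul_one, Matrix.conjTranspose_apply]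
  · intro z _ hz
    rw [Matrix.mul_single_apply_of_ne _ _ _ _ _ hz, zero_mul]
  · simp

open Classical in
/-- The overlap with a computational basis state on some of the qubits. -/
theorem trace_density_mul_tensorId [Fintype κ] [DecidableEq κ] (U : Op ι) (g : κ ↪ ι) (z : κ → Bool) :
    (Matrix.trace (density U * tensorId g (Matrix.single z z 1))).re =
      ∑ x : ι → Bool, if x ∘ g = z then ‖U x fun _ => false‖ ^ 2 else 0 := by
  rw [Matrix.trace, Complex.re_sum]
  refine Finset.sum_congr rfl fun x _ => ?_
  rw [Matrix.diag_apply, Matrix.mul_apply, Finset.sum_eq_single x]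
  · rw [tensorId_apply, if_pos fun _ _ => rfl, density_apply, Matrix.single_apply]
    by_cases h : x ∘ g = z
    · rw [if_pos h, if_pos ⟨h.symm, h.symm⟩, mul_one, RCLike.star_def, Complex.mul_conj,
        Complex.ofReal_re, Complex.normSq_eq_norm_sq]
    · rw [if_neg h, if_neg fun h' => h h'.1.symm, mul_zero, Complex.zero_re]
  · intro y _ hy
    rw [tensorId_apply, Matrix.single_apply]
    split_ifs with h1 h2
    · refine absurd (funext fun i => ?_) hy
      by_cases hi : i ∈ Set.range g
      · obtain ⟨j, rfl⟩ := hi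
        exact (congrFun h2.1 j).symm.trans (congrFun h2.2 j)
      · exact h1 i hi
    · rw [mul_zero]
    · rw [mul_zero]
  · simp

end Circuits

/-! ### A circuit in a single box -/

section OneBox

variable (L : GateLib) (C : QCircuit)

/-- The first qubit goes to the first of two wires, all others to the second wire. -/
def splitEmb : Fin C.qubits ↪ Fin 2 × Fin C.qubits :=
  ⟨fun i => (if i.val = 0 then 0 else 1, i), fun _ _ h => (Prod.ext_iff.1 h).2⟩

/-- The embedding that maps the word `w` with two inputs to the circuit `C`, and the second
question to the basis state in which the first qubit is `1`. -/
def splitEmbedding (w : ℕ) : Embedding where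
  q := C.qubits
  words := [⟨w, 2, C.gates.map (Gate.map (splitEmb C))⟩]
  states := [⟨2, 0, [Gate.not ⟨0, C.pos⟩]⟩]

theorem splitEmbedding_word_self (w : ℕ) :
    (splitEmbedding C w).word w 2 = C.gates.map (Gate.map (splitEmb C)) := by
  simp [Embedding.word, splitEmbedding]

theorem splitEmbedding_word_of_ne {w r a : ℕ} (h : ¬(r = w ∧ a = 2)) :
    (splitEmbedding C w).word r a = [] := by
  have h' : ¬(w = r ∧ 2 = a) := fun h' => h ⟨h'.1.symm, h'.2.symm⟩
  simp only [Embedding.word, splitEmbedding]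
  rw [List.filterMap_cons_none (by rw [dif_neg h'])]
  rfl

theorem splitEmbedding_state_of_ne {w t : ℕ} (h : t ≠ 2) (i : ℕ) :
    (splitEmbedding C w).state t i = [] := by
  have h' : ¬(2 = t ∧ 0 = i) := fun h' => h h'.1.symm
  simp only [Embedding.state, splitEmbedding]
  rw [List.filterMap_cons_none (by rw [if_neg h'])]
  rfl

theorem splitEmbedding_state_two (w : ℕ) :
    (splitEmbedding C w).state 2 0 = [Gate.not ⟨0, C.pos⟩] := by
  simp [Embedding.state, splitEmbedding]

/-- A box with two inputs, the first of which is the first wire. -/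
def IsCandidate {k : ℕ} (b : Box k) : Prop :=
  b.arity = 2 ∧ ∀ i : Fin b.arity, i.val = 0 → (b.inputs i).val = 0

/-- The qubits that the circuit uses if the box acts on the first wire and on the wire `v`. -/
def placeEmb {k : ℕ} (u v : Fin k) : Fin C.qubits ↪ Fin k × Fin C.qubits :=
  ⟨fun i => (if i.val = 0 then u else v, i), fun _ _ h => (Prod.ext_iff.1 h).2⟩

theorem placeEmb_apply {k : ℕ} (u v : Fin k) (i : Fin C.qubits) :
    placeEmb C u v i = (if i.val = 0 then u else v, i) := rfl

theorem compile_eq_nil (V : Embedding) (t : ℕ) (T : Text)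
    (hs : ∀ i : Fin T.wires, V.state t i = []) (hw : ∀ b ∈ T.boxes, V.word b.word b.arity = []) :
    V.compile t T = [] := by
  rw [Embedding.compile, List.append_eq_nil_iff, List.flatMap_eq_nil_iff, List.flatMap_eq_nil_iff]
  exact ⟨fun i _ => by rw [hs i]; rfl, fun b hb => by rw [hw b hb]; rfl⟩

/-- Nouns of text number 0 have no entry, and the word of `b` labels no other box, so every other
part of the text compiles to the empty circuit. -/
theorem compile_context {k : ℕ} (l₁ l₂ : List (Box k)) (b : Box k) (hb : IsCandidate b)
    (h₁ : ∀ c ∈ l₁, c.word ≠ b.word) (h₂ : ∀ c ∈ l₂, c.word ≠ b.word) :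
    ∃ u v : Fin k, u ≠ v ∧ u.val = 0 ∧
      (splitEmbedding C b.word).compile 0 ⟨k, l₁ ++ b :: l₂⟩ =
        C.gates.map (Gate.map (placeEmb C u v)) := by
  obtain ⟨w, a, inp⟩ := b
  obtain ⟨ha, h0⟩ := hb
  dsimp only at ha
  subst ha
  have huv : inp 0 ≠ inp 1 := fun h => absurd (inp.injective h) (by decide)
  refine ⟨inp 0, inp 1, huv, h0 0 rfl, ?_⟩
  rw [Embedding.compile]
  have e1 : ((List.finRange k).flatMap fun i : Fin k =>
      ((splitEmbedding C w).state 0 i).map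
        (Gate.map (⟨fun j => (i, j), Prod.mk_right_injective i⟩ :
          Fin (splitEmbedding C w).q ↪ Fin k × Fin (splitEmbedding C w).q))) = [] := by
    rw [List.flatMap_eq_nil_iff]
    intro i _
    rw [splitEmbedding_state_of_ne C (by decide)]
    rfl
  have e2 : ∀ l : List (Box k), (∀ c ∈ l, c.word ≠ w) →
      l.flatMap (fun c => ((splitEmbedding C w).word c.word c.arity).map
        (Gate.map (c.inputs.prodMap (Function.Embedding.refl (Fin (splitEmbedding C w).q))))) =
          [] := by
    intro l hl
    rw [List.flatMap_eq_nil_iff]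
    intro c hc
    rw [splitEmbedding_word_of_ne C fun h => hl c hc h.1]
    rfl
  dsimp only
  rw [e1, List.flatMap_append, List.flatMap_cons, e2 l₁ h₁, e2 l₂ h₂, splitEmbedding_word_self,
    List.nil_append, List.nil_append, List.append_nil]
  refine List.map_map.trans ?_
  refine List.map_congr_left fun g _ => ?_
  have key : ∀ i : Fin C.qubits, (inp.prodMap (Function.Embedding.refl (Fin C.qubits)))
      (splitEmb C i) = placeEmb C (inp 0) (inp 1) i := by
    intro i
    refine Prod.ext ?_ rfl
    change inp (if i.val = 0 then 0 else 1) = if i.val = 0 then inp 0 else inp 1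
    split_ifs <;> rfl
  have key2 : (splitEmb C).trans (inp.prodMap (Function.Embedding.refl (Fin C.qubits))) =
      placeEmb C (inp 0) (inp 1) := Function.Embedding.ext key
  rw [← key2]
  cases g <;> rfl

/-- The probability of the outcome `b` for the first qubit of `C |0…0⟩`. -/
def outcomeProb (b : Bool) : ℝ :=
  ∑ x : Fin C.qubits → Bool,
    if x ⟨0, C.pos⟩ = b then ‖circuitOp L C.gates x (fun _ => false)‖ ^ 2 else 0

theorem outcomeProb_false : outcomeProb L C false = 1 - C.acceptProb L := by
  rw [← sum_norm_sq_column (circuitOp_unitary L C.gates) fun _ => false, outcomeProb,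
    QCircuit.acceptProb, eq_sub_iff_add_eq, ← Finset.sum_add_distrib]
  refine Finset.sum_congr rfl fun x _ => ?_
  cases x ⟨0, C.pos⟩ <;> simp

/-- The basis state of one wire in which the first qubit is `b`. -/
def basisState (b : Bool) : Fin 1 × Fin C.qubits → Bool := fun p => (p.2.val == 0) && b

-- Qubits outside the image of `placeEmb` stay in state 0. Among them are all qubits of the wire `u`
-- except the first one, so comparing the whole wire with a basis state amounts to reading off the
-- first qubit.
open Classical in
theorem sum_placed {k : ℕ} (u v : Fin k) (huv : u ≠ v)
    (g : Fin 1 × Fin C.qubits ↪ Fin k × Fin C.qubits)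
    (hg : ∀ p, g p = (u, p.2)) (b : Bool) :
    (∑ x : Fin k × Fin C.qubits → Bool, if x ∘ g = basisState C b then
      ‖tensorId (placeEmb C u v) (circuitOp L C.gates) x fun _ => false‖ ^ 2 else 0) =
      outcomeProb L C b := by
  rw [outcomeProb, ← sum_agree_off_range (placeEmb C u v) (fun _ => false)]
  refine Finset.sum_congr rfl fun x _ => ?_
  rw [tensorId_apply]
  by_cases h : ∀ i, i ∉ Set.range (placeEmb C u v) → x i = false
  · rw [if_pos h, if_pos h]
    have key : x ∘ g = basisState C b ↔ (x ∘ placeEmb C u v) ⟨0, C.pos⟩ = b := by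
      constructor
      · intro hx
        have := congrFun hx (0, ⟨0, C.pos⟩)
        simpa [hg, basisState, placeEmb_apply] using this
      · intro hx
        funext p
        rw [Function.comp_apply, hg, basisState]
        by_cases hp : p.2.val = 0
        · have : p.2 = ⟨0, C.pos⟩ := Fin.ext hp
          rw [this]
          simpa [placeEmb_apply] using hx
        · rw [h]
          · simp [hp]
          -- A later qubit of the wire `u` could lie in the image only if `v` were `u`.
          · rintro ⟨i, hi⟩
            rw [placeEmb_apply, Prod.mk.injEq] at hi
            rw [hi.2, if_neg hp] at hi
            exact huv hi.1.symm
    simp only [key]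
    rfl
  · rw [if_neg h, if_neg h]
    simp

theorem density_one {ι : Type} [Fintype ι] [DecidableEq ι] :
    density (1 : Op ι) = Matrix.single (fun _ => false) (fun _ => false) 1 := by
  simp [density]

theorem density_not {ι : Type} [Fintype ι] [DecidableEq ι] (i : ι) :
    density ((Gate.not i).op L) = Matrix.single (fun j => decide (j = i)) (fun j => decide (j = i)) 1 := by
  classical
  have key : ∀ x : ι → Bool, (Gate.not i).op L x (fun _ => false) =
      if (fun j => decide (j = i)) = x then 1 else 0 := by
    intro x
    have hr : ∀ j, j ∉ Set.range (Gate.single i) ↔ j ≠ i := by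
      intro j
      constructor
      · rintro h rfl
        exact h ⟨0, rfl⟩
      · rintro h ⟨_, rfl⟩
        exact h rfl
    rw [Gate.op, tensorId_apply, Matrix.of_apply]
    have hs : Gate.single i 0 = i := rfl
    simp only [hr, Function.comp_apply, hs]
    by_cases h : (fun j => decide (j = i)) = x
    · subst h
      simp
    · rw [if_neg h]
      split_ifs with h1 h2
      · rfl
      · refine absurd (funext fun j => ?_) h
        by_cases hj : j = i
        · subst hj; simpa using h2
        · rw [h1 j hj]; simpa using hj
      · rfl
  ext x y
  rw [density_apply, key, key, Matrix.single_apply]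
  by_cases h1 : (fun j => decide (j = i)) = x <;> by_cases h2 : (fun j => decide (j = i)) = y <;>
    simp [h1, h2]

variable {L C}

/-- A box on a single wire cannot have two distinct inputs, so the only word with an entry never
acts and the noun alone decides the state. The numbers 1 and 2 are those of the two questions. -/
theorem rho_question (w : ℕ) (b : Bool) (Q : List (Box 1)) :
    (splitEmbedding C w).rho L (if b then 2 else 1) ⟨1, Q⟩ =
      Matrix.single (basisState C b) (basisState C b) 1 := by
  have hQ : ∀ c ∈ Q, (splitEmbedding C w).word c.word c.arity = [] := by
    intro c _
    refine splitEmbedding_word_of_ne C fun h => ?_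
    have := Fintype.card_le_of_embedding c.inputs
    simp only [Fintype.card_fin] at this
    omega
  rw [Embedding.rho]
  cases b
  · rw [if_neg (by decide), compile_eq_nil _ _ _ (fun i => splitEmbedding_state_of_ne C (by decide) _)
      hQ]
    refine density_one.trans ?_
    have : basisState C false = fun _ => false := by funext p; simp [basisState]
    rw [this]
    rfl
  · have hc : (splitEmbedding C w).compile 2 ⟨1, Q⟩ = [Gate.not (0, ⟨0, C.pos⟩)] := by
      rw [Embedding.compile]
      have : Q.flatMap (fun c => ((splitEmbedding C w).word c.word c.arity).map
        (Gate.map (c.inputs.prodMap (Function.Embedding.refl (Fin (splitEmbedding C w).q))))) =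
          [] := by
        rw [List.flatMap_eq_nil_iff]
        intro c hc
        rw [hQ c hc]
        rfl
      dsimp only
      rw [this, List.append_nil]
      have h1 : List.finRange 1 = [0] := rfl
      rw [h1, List.flatMap_cons, List.flatMap_nil, List.append_nil]
      have h2 : (splitEmbedding C w).state 2 ((0 : Fin 1) : ℕ) = [Gate.not ⟨0, C.pos⟩] :=
        splitEmbedding_state_two C w
      rw [h2]
      rfl
    rw [if_pos rfl, hc]
    have h2 : circuitOp L [Gate.not ((0 : Fin 1), (⟨0, C.pos⟩ : Fin C.qubits))] =
      (Gate.not ((0 : Fin 1), (⟨0, C.pos⟩ : Fin C.qubits))).op L := one_mul _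
    have h3 : (fun j : Fin 1 × Fin C.qubits => decide (j = (0, ⟨0, C.pos⟩))) =
        basisState C true := by
      funext p
      simp [basisState, Prod.ext_iff, Fin.ext_iff, beq_eq_decide]
    have h4 : density ((Gate.not ((0 : Fin 1), (⟨0, C.pos⟩ : Fin C.qubits))).op L) =
        Matrix.single (basisState C true) (basisState C true) 1 := by
      rw [density_not, h3]
    exact (congrArg density h2).trans h4

/-- The instance whose embedding puts `C` into the box with the label `w`. -/
def splitInstance (C : QCircuit) (w : ℕ) (T Q₁ Q₂ : Text) (h₁ : Q₁.wires ≤ T.wires)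
    (h₂ : Q₂.wires ≤ T.wires) : QAInstance where
  embedding := splitEmbedding C w
  context := T
  questions := [Q₁, Q₂]
  wires_le := by
    intro Q hQ
    rcases List.mem_pair.1 hQ with rfl | rfl
    exacts [h₁, h₂]

/-- This turns the comparison of texts into a measurement: `sum_placed` applies because the first
wire of the context is the first input of the chosen box. -/
theorem overlap_splitInstance {k : ℕ} (l₁ l₂ : List (Box k)) (b : Box k) (hb : IsCandidate b)
    (h₁ : ∀ c ∈ l₁, c.word ≠ b.word) (h₂ : ∀ c ∈ l₂, c.word ≠ b.word) (q₁ q₂ : List (Box 1))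
    (hk : 1 ≤ k) (i : Fin 2) :
    (splitInstance C b.word ⟨k, l₁ ++ b :: l₂⟩ ⟨1, q₁⟩ ⟨1, q₂⟩ hk hk).overlap L i =
      outcomeProb L C (i == 1) := by
  obtain ⟨u, v, huv, hu, hc⟩ := compile_context C l₁ l₂ b hb h₁ h₂
  have hT : (splitEmbedding C b.word).rho L 0 ⟨k, l₁ ++ b :: l₂⟩ =
      density (tensorId (placeEmb C u v) (circuitOp L C.gates)) := by
    rw [Embedding.rho, hc]
    congr 1
    exact circuitOp_map L _ _
  have key : ∀ (β : Bool) (Q : List (Box 1)) (t : ℕ), t = (if β then 2 else 1) →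
      (Matrix.trace ((splitEmbedding C b.word).rho L 0 ⟨k, l₁ ++ b :: l₂⟩ *
        tensorId ((Fin.castLEEmb hk).prodMap
          (Function.Embedding.refl (Fin (splitEmbedding C b.word).q)))
          ((splitEmbedding C b.word).rho L t ⟨1, Q⟩))).re = outcomeProb L C β := by
    intro β Q t ht
    subst ht
    rw [rho_question, hT]
    refine (trace_density_mul_tensorId _ _ _).trans ?_
    refine sum_placed L C u v huv _ ?_ β
    rintro ⟨p, q⟩
    refine Prod.ext (Fin.ext ?_) rfl
    rw [hu]
    have := p.2
    change p.val = 0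
    omega
  fin_cases i
  · exact key false q₁ 1 rfl
  · exact key true q₂ 2 rfl

/-- The overlaps are 1 − p and p, with p the acceptance probability. Under either promise the worse
one lies at least 1/3 below the maximum, too far for precision ε. -/
theorem answer_of_isAnswer {k : ℕ} (l₁ l₂ : List (Box k)) (b : Box k) (hb : IsCandidate b)
    (h₁ : ∀ c ∈ l₁, c.word ≠ b.word) (h₂ : ∀ c ∈ l₂, c.word ≠ b.word) (q₁ q₂ : List (Box 1))
    (hk : 1 ≤ k) {ε : ℝ} (hε : ε < 1 / 7) {j : ℕ}
    (hj : (splitInstance C b.word ⟨k, l₁ ++ b :: l₂⟩ ⟨1, q₁⟩ ⟨1, q₂⟩ hk hk).IsAnswer L ε j) :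
    (2 / 3 ≤ C.acceptProb L → j ≠ 0) ∧ (C.acceptProb L ≤ 1 / 3 → j = 0) := by
  obtain ⟨hj2, hlt⟩ := hj
  have hov := overlap_splitInstance (L := L) (C := C) l₁ l₂ b hb h₁ h₂ q₁ q₂ hk
  let I := splitInstance C b.word ⟨k, l₁ ++ b :: l₂⟩ ⟨1, q₁⟩ ⟨1, q₂⟩ hk hk
  change ∀ i : Fin 2, I.overlap L i = _ at hov
  have h0 : I.overlap L (0 : Fin 2) = 1 - C.acceptProb L := (hov 0).trans (outcomeProb_false L C)
  have h1 : I.overlap L (1 : Fin 2) = C.acceptProb L := hov 1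
  have hle : ∀ i : Fin 2, I.overlap L i ≤ ⨆ i, I.overlap L i := fun i =>
    le_ciSup (Set.finite_range (I.overlap L)).bddAbove i
  have hl0 := hle 0
  have hl1 := hle 1
  have hj3 : j < 2 := hj2
  have hlt' := abs_lt.1 hlt
  interval_cases j
  · change -ε < I.overlap L (0 : Fin 2) - _ ∧ _ at hlt'
    refine ⟨fun h => ?_, fun _ => rfl⟩
    exfalso
    linarith [hlt'.1]
  · change -ε < I.overlap L (1 : Fin 2) - _ ∧ _ at hlt'
    refine ⟨fun _ => one_ne_zero, fun h => ?_⟩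
    exfalso
    linarith [hlt'.1]

end OneBox

end QDisCo

end

noncomputable section

namespace QDisCo

open scoped ENNReal
open Filter Topology

/-! ### Zipf's law and Heaps' law -/

theorem summable_zipf {v : ℝ} (hv : 1 < v) : Summable fun r : ℕ => ((r : ℝ) + 1) ^ (-v) := by
  have h := (summable_nat_add_iff 1).2 (Real.summable_nat_rpow_inv.2 hv)
  refine h.congr fun r => ?_
  rw [Real.rpow_neg (by positivity)]
  push_cast
  rfl

theorem one_lt_of_summable_zipf {v : ℝ} (h : Summable fun r : ℕ => ((r : ℝ) + 1) ^ (-v)) :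
    1 < v := by
  refine Real.summable_nat_rpow_inv.1 ((summable_nat_add_iff 1).1 (h.congr fun r => ?_))
  rw [Real.rpow_neg (by positivity)]
  push_cast
  rfl

theorem toReal_tsum_one (p : PMF ℕ) : HasSum (fun r => (p r).toReal) 1 := by
  have h : ∑' r, (p r).toReal = 1 := by
    rw [← ENNReal.tsum_toReal_eq fun r => p.apply_ne_top r, p.tsum_coe, ENNReal.toReal_one]
  rw [← h]
  refine Summable.hasSum (ENNReal.summable_toReal ?_)
  rw [p.tsum_coe]
  exact ENNReal.one_ne_top

/-- The parameters of a distribution that obeys Zipf's law. -/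
theorem Zipf.exponent {p : PMF ℕ} (h : Zipf p) :
    ∃ c s : ℝ, 0 < c ∧ 1 < s ∧ ∀ r : ℕ, (p r).toReal = c * ((r : ℝ) + 1) ^ (-s) := by
  obtain ⟨c, s, hcs⟩ := h
  have h1 := toReal_tsum_one p
  have hc0 : 0 ≤ c := by
    have := hcs 0
    norm_num at this
    rw [← this]
    exact ENNReal.toReal_nonneg
  have hc : 0 < c := by
    refine lt_of_le_of_ne hc0 fun h0 => ?_
    have h2 : (fun r => (p r).toReal) = fun _ => 0 := by
      funext r
      rw [hcs, ← h0, zero_mul]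
    rw [h2] at h1
    exact zero_ne_one (hasSum_zero.unique h1)
  refine ⟨c, s, hc, one_lt_of_summable_zipf ?_, hcs⟩
  have h3 := h1.summable.mul_left c⁻¹
  refine h3.congr fun r => ?_
  rw [hcs]
  field_simp

/-- Linearity of expectation: the vocabulary is the sum over `r` of the indicator that `r` occurs,
and this event has probability at most 1 and at most N times the frequency of `r`. -/
theorem expectedVocabulary_le (p : PMF ℕ) (N : ℕ) :
    expectedVocabulary p N ≤ ∑' r, min 1 (N * (p r).toReal) := by
  classical
  have hne : ∀ l, (iid p N) l ≠ ⊤ := fun l => PMF.apply_ne_top _ l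
  have h1 : expectedVocabulary p N =
      (∑' l : List ℕ, iid p N l * (l.toFinset.card : ℝ≥0∞)).toReal := by
    rw [ENNReal.tsum_toReal_eq fun l => ENNReal.mul_ne_top (hne l) (ENNReal.natCast_ne_top _)]
    simp [expectedVocabulary]
  have h2 : ∑' l : List ℕ, iid p N l * (l.toFinset.card : ℝ≥0∞) =
      ∑' r : ℕ, (iid p N).toOuterMeasure {l | ∃ a ∈ l, a ∈ ({r} : Set ℕ)} := by
    simp only [PMF.toOuterMeasure_apply]
    rw [ENNReal.tsum_comm]
    refine tsum_congr fun l => ?_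
    have : (l.toFinset.card : ℝ≥0∞) = ∑' r : ℕ, if r ∈ l then 1 else 0 := by
      rw [tsum_eq_sum (s := l.toFinset)]
      · rw [Finset.sum_congr rfl fun r hr => if_pos (List.mem_toFinset.1 hr)]
        simp
      · intro r hr
        exact if_neg fun h => hr (List.mem_toFinset.2 h)
    rw [this, ← ENNReal.tsum_mul_left]
    refine tsum_congr fun r => ?_
    simp [Set.indicator_apply]
  have hle : ∀ r, ((iid p N).toOuterMeasure {l | ∃ a ∈ l, a ∈ ({r} : Set ℕ)}).toReal ≤
      min 1 (N * (p r).toReal) := by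
    intro r
    refine le_min (prob_le_one _ _) ?_
    have h3 := iid_exists_le p {r} N
    rw [PMF.toOuterMeasure_apply_singleton] at h3
    have h4 := ENNReal.toReal_mono
      (ENNReal.mul_ne_top (ENNReal.natCast_ne_top N) (p.apply_ne_top r)) h3
    simpa using h4
  have hs : Summable fun r => min 1 (N * (p r).toReal) :=
    Summable.of_nonneg_of_le (fun r => le_min zero_le_one (by positivity))
      (fun r => min_le_right _ _) ((toReal_tsum_one p).summable.mul_left _)
  rw [h1, h2, ENNReal.tsum_toReal_eq fun r =>
    ne_top_of_le_ne_top ENNReal.one_ne_top (toOuterMeasure_le_one _ _)]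
  exact Summable.tsum_le_tsum hle
    (Summable.of_nonneg_of_le (fun r => ENNReal.toReal_nonneg) hle hs) hs

/-- A vocabulary that grows at least like the square root forces a heavy tail. -/
theorem Heaps.exponent_le_two {p : PMF ℕ} (h : Heaps p) {c s : ℝ} (hc : 0 < c)
    (hp : ∀ r : ℕ, (p r).toReal = c * ((r : ℝ) + 1) ^ (-s)) : s ≤ 2 := by
  by_contra! hs
  obtain ⟨C, hC, hlim⟩ := h
  have hdom : Tendsto (fun N : ℕ => ∑' r, min 1 (N * (p r).toReal) / √(N : ℝ)) atTop
      (𝓝 (∑' _ : ℕ, (0 : ℝ))) := by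
    -- Since min 1 x ≤ √x, the terms are at most √(p r) for every N. These are summable because s >
    -- 2 makes the exponent s/2 exceed 1; each single term is at most 1/√N.
    refine tendsto_tsum_of_dominated_convergence (bound := fun r => √((p r).toReal)) ?_ ?_ ?_
    · have h1 := (summable_zipf (v := s / 2) (by linarith)).mul_left √c
      refine h1.congr fun r => ?_
      rw [hp, Real.sqrt_mul hc.le, Real.sqrt_eq_rpow (((r : ℝ) + 1) ^ (-s)),
        ← Real.rpow_mul (by positivity)]
      congr 2
      ring
    · intro r
      have h1 : Tendsto (fun N : ℕ => (√(N : ℝ))⁻¹) atTop (𝓝 0) :=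
        tendsto_inv_atTop_zero.comp (Real.tendsto_sqrt_atTop.comp tendsto_natCast_atTop_atTop)
      refine squeeze_zero (fun N => by positivity) (fun N => ?_) h1
      rw [div_eq_mul_inv]
      exact mul_le_of_le_one_left (by positivity) (min_le_left _ _)
    · refine Eventually.of_forall fun N r => ?_
      rw [Real.norm_of_nonneg (by positivity)]
      refine div_le_of_le_mul₀ (by positivity) (by positivity) ?_
      rw [← Real.sqrt_mul ENNReal.toReal_nonneg]
      refine Real.le_sqrt_of_sq_le ?_
      have h0 : 0 ≤ (N : ℝ) * (p r).toReal := by positivity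
      rcases le_total 1 ((N : ℝ) * (p r).toReal) with h1 | h1
      · rw [min_eq_left h1]; linarith
      · rw [min_eq_right h1]; nlinarith
  rw [tsum_zero] at hdom
  have : C ≤ 0 := by
    refine le_of_tendsto_of_tendsto' hlim hdom fun N => ?_
    rw [tsum_div_const]
    exact div_le_div_of_nonneg_right (expectedVocabulary_le p N) (by positivity)
  linarith

/-- Tail sums of powers. -/
theorem zipf_tail {u v : ℝ} (hv : 0 ≤ v) (huv : 1 < u - v) : ∃ C : ℝ, 0 < C ∧ ∀ R : ℕ, 0 < R →
    ∑' r : ℕ, (if R ≤ r then ENNReal.ofReal (((r : ℝ) + 1) ^ (-u)) else 0) ≤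
      ENNReal.ofReal (C * (R : ℝ) ^ (-v)) := by
  have hsum := summable_zipf huv
  have hpos : 0 < ∑' r : ℕ, ((r : ℝ) + 1) ^ (-(u - v)) :=
    hsum.tsum_pos (fun r => by positivity) 0 (by positivity)
  -- The factor (r + 1)^(−v) is split off and bounded by R^(−v); the constant is the full sum of
  -- what remains. This loses a little in the exponent, for which `exists_threshold` leaves room.
  refine ⟨_, hpos, fun R hR => ?_⟩
  have hR' : (0 : ℝ) < R := by exact_mod_cast hR
  rw [mul_comm, ENNReal.ofReal_mul (by positivity),
    ENNReal.ofReal_tsum_of_nonneg (fun r => by positivity) hsum, ← ENNReal.tsum_mul_left]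
  refine ENNReal.tsum_le_tsum fun r => ?_
  split_ifs with h
  · rw [← ENNReal.ofReal_mul (by positivity)]
    refine ENNReal.ofReal_le_ofReal ?_
    have h1 : ((r : ℝ) + 1) ^ (-u) = ((r : ℝ) + 1) ^ (-v) * ((r : ℝ) + 1) ^ (-(u - v)) := by
      rw [← Real.rpow_add (by positivity)]
      congr 1
      ring
    rw [h1]
    refine mul_le_mul_of_nonneg_right ?_ (by positivity)
    refine Real.rpow_le_rpow_of_nonpos hR' ?_ (by linarith)
    have : (R : ℝ) ≤ r := by exact_mod_cast h
    linarith
  · exact zero_le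

/-! ### Long, rare and repeated words -/

section Words

variable {p : PMF ℕ} {c s : ℝ}

theorem apply_eq_ofReal (hp : ∀ r : ℕ, (p r).toReal = c * ((r : ℝ) + 1) ^ (-s)) (r : ℕ) :
    p r = ENNReal.ofReal (c * ((r : ℝ) + 1) ^ (-s)) := by
  rw [← hp, ENNReal.ofReal_toReal (p.apply_ne_top r)]

/-- Long words are rare. -/
theorem long_word_le (hc : 0 < c) (hs : 1 < s)
    (hp : ∀ r : ℕ, (p r).toReal = c * ((r : ℝ) + 1) ^ (-s)) :
    ∃ C τ : ℝ, 0 < C ∧ 0 < τ ∧ ∀ l : ℕ,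
      p.toOuterMeasure {r | 2 ^ l ≤ r} ≤ ENNReal.ofReal (C * ((2 : ℝ) ^ (-τ)) ^ l) := by
  -- Any decay exponent strictly between 0 and s − 1 would do; half of s − 1 is taken.
  obtain ⟨C, hC, h⟩ := zipf_tail (u := s) (v := (s - 1) / 2) (by linarith) (by linarith)
  refine ⟨c * C, (s - 1) / 2, by positivity, by linarith, fun l => ?_⟩
  have h1 := h (2 ^ l) (by positivity)
  rw [PMF.toOuterMeasure_apply, mul_assoc, ENNReal.ofReal_mul hc.le]
  have h2 : (((2 ^ l : ℕ) : ℝ)) ^ (-((s - 1) / 2)) = ((2 : ℝ) ^ (-((s - 1) / 2))) ^ l := by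
    push_cast
    rw [← Real.rpow_natCast, ← Real.rpow_natCast, ← Real.rpow_mul (by norm_num),
      ← Real.rpow_mul (by norm_num), mul_comm]
  rw [h2] at h1
  refine le_trans ?_ (mul_le_mul_right h1 _)
  rw [← ENNReal.tsum_mul_left]
  refine ENNReal.tsum_le_tsum fun r => ?_
  rw [Set.indicator_apply, apply_eq_ofReal hp, ENNReal.ofReal_mul hc.le]
  simp only [Set.mem_ofPred_eq]
  split_ifs <;> simp

/-- Rare words make up a sizable part of a text. -/
theorem le_rare_words (hc : 0 < c) (hs : 1 < s)
    (hp : ∀ r : ℕ, (p r).toReal = c * ((r : ℝ) + 1) ^ (-s)) (R : ℕ) (hR : 0 < R) :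
    ENNReal.ofReal (c * 2 ^ (-s) * (R : ℝ) ^ (1 - s)) ≤ p.toOuterMeasure {r | R ≤ r} := by
  have hR' : (0 : ℝ) < R := by exact_mod_cast hR
  -- The R ranks from R to 2R − 1 suffice: each has frequency at least c (2R)^(−s).
  calc ENNReal.ofReal (c * 2 ^ (-s) * (R : ℝ) ^ (1 - s))
      = ∑ _r ∈ Finset.Ico R (2 * R), ENNReal.ofReal (c * (2 * (R : ℝ)) ^ (-s)) := by
        rw [Finset.sum_const, Nat.card_Ico, nsmul_eq_mul, ← ENNReal.ofReal_natCast,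
          ← ENNReal.ofReal_mul (by positivity)]
        congr 1
        have h2 : 2 * R - R = R := by omega
        rw [h2, Real.mul_rpow (by norm_num) hR'.le, sub_eq_add_neg, Real.rpow_add hR',
          Real.rpow_one]
        ring
    _ ≤ ∑ r ∈ Finset.Ico R (2 * R), p r := by
        refine Finset.sum_le_sum fun r hr => ?_
        rw [apply_eq_ofReal hp]
        refine ENNReal.ofReal_le_ofReal (mul_le_mul_of_nonneg_left ?_ hc.le)
        refine Real.rpow_le_rpow_of_nonpos (by positivity) ?_ (by linarith)
        have : r + 1 ≤ 2 * R := (Finset.mem_Ico.1 hr).2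
        exact_mod_cast this
    _ = ∑ r ∈ Finset.Ico R (2 * R), {r | R ≤ r}.indicator p r := by
        refine Finset.sum_congr rfl fun r hr => ?_
        rw [Set.indicator_of_mem]
        exact (Finset.mem_Ico.1 hr).1
    _ ≤ p.toOuterMeasure {r | R ≤ r} := by
        rw [PMF.toOuterMeasure_apply]
        exact ENNReal.sum_le_tsum _

/-- Two draws rarely give the same rare word. -/
theorem rare_collision_le (hc : 0 < c)
    (hp : ∀ r : ℕ, (p r).toReal = c * ((r : ℝ) + 1) ^ (-s)) {a : ℝ} (ha : 0 ≤ a)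
    (has : a < 2 * s - 1) : ∃ C : ℝ, 0 < C ∧ ∀ R : ℕ, 0 < R →
      ∑' r, p r * (if R ≤ r then p r else 0) ≤ ENNReal.ofReal (C * (R : ℝ) ^ (-a)) := by
  obtain ⟨C, hC, h⟩ := zipf_tail (u := 2 * s) (v := a) ha (by linarith)
  refine ⟨c ^ 2 * C, by positivity, fun R hR => ?_⟩
  rw [mul_assoc, ENNReal.ofReal_mul (by positivity)]
  refine le_trans ?_ (mul_le_mul_right (h R hR) _)
  rw [← ENNReal.tsum_mul_left]
  refine ENNReal.tsum_le_tsum fun r => ?_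
  rw [apply_eq_ofReal hp]
  split_ifs
  · rw [← ENNReal.ofReal_mul (by positivity), ← ENNReal.ofReal_mul (by positivity)]
    refine ENNReal.ofReal_le_ofReal (le_of_eq ?_)
    have : ((r : ℝ) + 1) ^ (-(2 * s)) = ((r : ℝ) + 1) ^ (-s) * ((r : ℝ) + 1) ^ (-s) := by
      rw [← Real.rpow_add (by positivity)]
      congr 1
      ring
    rw [this]
    ring
  · simp

end Words

/-- The choice of the threshold from which on words count as rare. -/
theorem exists_threshold {s a₂ B C c₀ η : ℝ} (hs : 1 < s) (hs2 : s ≤ 2) (ha₂ : 0 < a₂) (hB : 0 < B)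
    (hC : 0 < C) (hc₀ : 0 < c₀) (hη : 0 < η) :
    ∃ N₀ : ℝ, ∀ N k : ℕ, N₀ ≤ N → 1 ≤ k → c₀ * (k : ℝ) ^ 4 ≤ N → ∃ j : ℕ,
      Real.exp (-(N * (a₂ * (k : ℝ)⁻¹ * (B * ((2 ^ j : ℕ) : ℝ) ^ (1 - s))))) ≤ η ∧
      (N : ℝ) ^ 2 * (C * ((2 ^ j : ℕ) : ℝ) ^ (-((2 * s - 1) * (26 / 27)))) ≤ η := by
  -- The threshold is about N^ω. The factor 26/27 is the loss in the tail sum, and ω (2s − 1)(26/27)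
  -- = 52/25 exceeds 2, so collisions vanish like N^(−2/25). As (s − 1)/(2s − 1) ≤ 1/3 for s ≤ 2,
  -- also ω (s − 1) ≤ 18/25. Rare words thus number at least about N^(7/25), and 7/25 > 1/4 pays for
  -- the factor 1/k.
  set ω : ℝ := 54 / (25 * (2 * s - 1)) with hω
  have hs3 : 0 < 2 * s - 1 := by linarith
  have hω0 : 0 < ω := by positivity
  have hν : 7 / 25 ≤ 1 - ω * (s - 1) := by
    have : ω * (s - 1) ≤ 18 / 25 := by
      rw [hω, div_mul_eq_mul_div, div_le_iff₀ (by positivity)]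
      linarith
    linarith
  set ν : ℝ := 1 - ω * (s - 1) with hνd
  have hωa : ω * ((2 * s - 1) * (26 / 27)) = 52 / 25 := by
    rw [hω]
    field_simp
    norm_num
  set A : ℝ := a₂ * B * 2 ^ (1 - s) * c₀ ^ (1 / 4 : ℝ) with hA
  have hA0 : 0 < A := by positivity
  have l1 : Tendsto (fun x : ℝ => Real.exp (-(A * x ^ (ν - 1 / 4)))) atTop (𝓝 0) :=
    Real.tendsto_exp_neg_atTop_nhds_zero.comp
      ((tendsto_rpow_atTop (by linarith)).const_mul_atTop hA0)
  have l2 : Tendsto (fun x : ℝ => C * x ^ (-(2 / 25 : ℝ))) atTop (𝓝 0) := by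
    simpa using (tendsto_rpow_neg_atTop (by norm_num : (0 : ℝ) < 2 / 25)).const_mul C
  obtain ⟨N₀, hN₀⟩ := eventually_atTop.1
    (((l1.eventually_le_const hη).and (l2.eventually_le_const hη)).and (eventually_ge_atTop 1))
  refine ⟨N₀, fun N k hN hk hkN => ?_⟩
  obtain ⟨⟨e1, e2⟩, hN1⟩ := hN₀ N hN
  have hNpos : (0 : ℝ) < N := by linarith
  have hkpos : (0 : ℝ) < k := by exact_mod_cast hk
  have hx1 : 1 ≤ (N : ℝ) ^ ω := Real.one_le_rpow hN1 hω0.le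
  -- Rounding N^ω up to a power of two: 2^(i+1) exceeds N^ω, as collisions require, and is at most 2
  -- N^ω, as the supply of rare words requires.
  obtain ⟨i, hi1, hi2⟩ := exists_nat_pow_near hx1 (by norm_num : (1 : ℝ) < 2)
  have hR : (((2 ^ (i + 1) : ℕ) : ℝ)) = 2 ^ (i + 1) := by push_cast; rfl
  refine ⟨i + 1, ?_, ?_⟩
  · refine le_trans (Real.exp_le_exp.2 (neg_le_neg ?_)) e1
    rw [hR]
    have hup : (2 : ℝ) ^ (i + 1) ≤ 2 * (N : ℝ) ^ ω := by
      rw [pow_succ']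
      linarith
    have h1 : 2 ^ (1 - s) * (N : ℝ) ^ (-(ω * (s - 1))) ≤ ((2 : ℝ) ^ (i + 1)) ^ (1 - s) := by
      have := Real.rpow_le_rpow_of_nonpos (by positivity) hup (by linarith : 1 - s ≤ 0)
      rw [Real.mul_rpow (by norm_num) (by positivity), ← Real.rpow_mul hNpos.le] at this
      have e : ω * (1 - s) = -(ω * (s - 1)) := by ring
      rwa [e] at this
    -- The fourth root of c₀ k⁴ ≤ N.
    have h2 : c₀ ^ (1 / 4 : ℝ) * (N : ℝ) ^ (-(1 / 4 : ℝ)) ≤ (k : ℝ)⁻¹ := by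
      have h3 : (c₀ * (k : ℝ) ^ 4) ^ (1 / 4 : ℝ) ≤ (N : ℝ) ^ (1 / 4 : ℝ) :=
        Real.rpow_le_rpow (by positivity) hkN (by norm_num)
      have h4 : ((k : ℝ) ^ 4) ^ (1 / 4 : ℝ) = k := by
        rw [← Real.rpow_natCast, ← Real.rpow_mul hkpos.le]
        norm_num
      rw [Real.mul_rpow hc₀.le (by positivity), h4] at h3
      rw [Real.rpow_neg hNpos.le, ← div_eq_mul_inv, div_le_iff₀ (by positivity),
        inv_mul_eq_div, le_div_iff₀ hkpos]
      exact h3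
    have h5 : A * (N : ℝ) ^ (ν - 1 / 4) =
        N * (a₂ * (c₀ ^ (1 / 4 : ℝ) * (N : ℝ) ^ (-(1 / 4 : ℝ))) *
          (B * (2 ^ (1 - s) * (N : ℝ) ^ (-(ω * (s - 1)))))) := by
      have : ν - 1 / 4 = 1 + (-(1 / 4 : ℝ)) + (-(ω * (s - 1))) := by rw [hνd]; ring
      rw [this, Real.rpow_add hNpos, Real.rpow_add hNpos, Real.rpow_one, hA]
      ring
    rw [h5]
    gcongr
  · refine le_trans ?_ e2
    rw [hR]
    have h1 : ((2 : ℝ) ^ (i + 1)) ^ (-((2 * s - 1) * (26 / 27))) ≤ (N : ℝ) ^ (-(52 / 25 : ℝ)) := by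
      have := Real.rpow_le_rpow_of_nonpos (by positivity) hi2.le
        (by linarith : -((2 * s - 1) * (26 / 27)) ≤ 0)
      rw [← Real.rpow_mul hNpos.le, mul_neg, hωa] at this
      exact this
    calc (N : ℝ) ^ 2 * (C * ((2 : ℝ) ^ (i + 1)) ^ (-((2 * s - 1) * (26 / 27))))
        ≤ (N : ℝ) ^ 2 * (C * (N : ℝ) ^ (-(52 / 25 : ℝ))) := by gcongr
      _ = C * (N : ℝ) ^ (-(2 / 25 : ℝ)) := by
        have : -(2 / 25 : ℝ) = 2 + -(52 / 25) := by norm_num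
        rw [this, Real.rpow_add hNpos, Real.rpow_two]
        ring

/-! ### Texts with a box for the circuit -/

/-- For some threshold, no word from the threshold on occurs twice, and one such word labels a box
whose first of two inputs is the first wire. -/
def GoodText (T : Text) : Prop :=
  ∃ j : ℕ, (∃ b ∈ T.boxes, IsCandidate b ∧ 2 ^ j ≤ b.word) ∧
    T.boxes.Pairwise fun b b' => ¬(b.word = b'.word ∧ 2 ^ j ≤ b.word)

/-- Label, number of inputs and inputs are drawn independently; given two inputs, the first one is
the first wire with probability 1/k. The cut-off of the arity is harmless because k ≥ 2. -/
theorem le_candidate (words arity : PMF ℕ) (k R : ℕ) (hk : 2 ≤ k) :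
    words.toOuterMeasure {r | R ≤ r} * (arity 2 * (k : ℝ≥0∞)⁻¹) ≤
      (randomBox words arity k).toOuterMeasure {b | IsCandidate b ∧ R ≤ b.word} := by
  rw [randomBox]
  refine mul_le_toOuterMeasure_bind _ _ _ _ _ fun r hr => ?_
  refine le_trans ?_ (mul_le_toOuterMeasure_bind _ _ {2} _ (k : ℝ≥0∞)⁻¹ fun a ha => ?_)
  · rw [PMF.toOuterMeasure_apply_singleton]
  · have ha : a = 2 := ha
    subst ha
    rw [PMF.toOuterMeasure_map_apply,
      ← uniform_first_input (min 2 k) k (by rw [min_eq_left hk]; norm_num)]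
    refine MeasureTheory.measure_mono fun e he => ?_
    exact ⟨⟨min_eq_left hk, he⟩, hr⟩

/-- All N independent boxes must fail, which has probability (1 − x)^N ≤ exp(−N x), where x is the
chance that one box succeeds. -/
theorem no_candidate_le (words arity : PMF ℕ) (k R N : ℕ) (hk : 2 ≤ k) {β : ℝ} (hβ : 0 ≤ β)
    (h : ENNReal.ofReal β ≤ words.toOuterMeasure {r | R ≤ r}) :
    (iid (randomBox words arity k) N).toOuterMeasure
      {l | ¬ ∃ b ∈ l, IsCandidate b ∧ R ≤ b.word} ≤
      ENNReal.ofReal (Real.exp (-(N * ((arity 2).toReal * (k : ℝ)⁻¹ * β)))) := by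
  set q := randomBox words arity k with hq
  set S : Set (Box k) := {b | IsCandidate b ∧ R ≤ b.word} with hS
  have h1 : {l : List (Box k) | ¬ ∃ b ∈ l, IsCandidate b ∧ R ≤ b.word} =
      {l | ∀ b ∈ l, b ∈ Sᶜ} := by
    ext l
    simp [hS]
  have h2 : (arity 2).toReal * (k : ℝ)⁻¹ * β ≤ prob q S := by
    have h3 := (mul_le_mul_left h _).trans (le_candidate words arity k R hk)
    have h4 := ENNReal.toReal_mono
      (ne_top_of_le_ne_top ENNReal.one_ne_top (toOuterMeasure_le_one _ _)) h3
    rw [ENNReal.toReal_mul, ENNReal.toReal_mul, ENNReal.toReal_ofReal hβ, ENNReal.toReal_inv,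
      ENNReal.toReal_natCast, mul_comm] at h4
    exact h4
  rw [h1, iid_forall, ← ofReal_prob, ← ENNReal.ofReal_pow (prob_nonneg _ _)]
  refine ENNReal.ofReal_le_ofReal ?_
  have h5 := prob_add_compl q S
  have h6 := Real.add_one_le_exp (-prob q S)
  calc prob q Sᶜ ^ N ≤ Real.exp (-prob q S) ^ N :=
        pow_le_pow_left₀ (prob_nonneg _ _) (by linarith) N
    _ = Real.exp (N * -prob q S) := (Real.exp_nat_mul _ N).symm
    _ ≤ _ := by
        refine Real.exp_le_exp.2 ?_
        rw [mul_neg]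
        exact neg_le_neg (mul_le_mul_of_nonneg_left h2 (Nat.cast_nonneg N))

/-- The pair bound for the relation "same rare word"; its probability depends on the labels only,
hence the passage to the law of the labels. -/
theorem collision_le (words arity : PMF ℕ) (k R N : ℕ) :
    (iid (randomBox words arity k) N).toOuterMeasure
      {l | ¬ l.Pairwise fun b b' => ¬(b.word = b'.word ∧ R ≤ b.word)} ≤
      (N : ℝ≥0∞) ^ 2 * ∑' r, words r * (if R ≤ r then words r else 0) := by
  refine (iid_not_pairwise_le _ _ N).trans (mul_le_mul_right (le_of_eq ?_) _)
  conv_rhs => rw [← map_word_randomBox words arity k, tsum_map_mul, map_word_randomBox]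
  refine tsum_congr fun b => ?_
  congr 1
  split_ifs with h
  · rw [← PMF.toOuterMeasure_apply_singleton, ← randomBox_word words arity k]
    congr 1
    ext b'
    simp [h, eq_comm]
  · have : {b' : Box k | b.word = b'.word ∧ R ≤ b.word} = ∅ := by
      ext b'
      simp [h]
    rw [this]
    simp

/-- Large random texts have room for a circuit, with high probability. -/
theorem exists_good_text (D : TextModel) {η : ℝ} (hη : 0 < η) :
    ∃ K : ℕ, 2 ≤ K ∧ ∀ k, K ≤ k →
      (D.dist k).toOuterMeasure {T | ¬ GoodText T} ≤ ENNReal.ofReal η := by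
  obtain ⟨c, s, hc, hs, hp⟩ := D.zipf.exponent
  have hs2 := D.heaps.exponent_le_two hc hp
  obtain ⟨γ, hγ, c₀, hc₀, hlim⟩ := D.many_boxes
  obtain ⟨C, hC, hcol⟩ := rare_collision_le hc hp (a := (2 * s - 1) * (26 / 27))
    (by nlinarith) (by nlinarith)
  have ha₂ : 0 < (D.arity 2).toReal :=
    ENNReal.toReal_pos D.arity_two (D.arity.apply_ne_top 2)
  obtain ⟨N₀, hN₀⟩ := exists_threshold (η := η / 3) (B := c * 2 ^ (-s)) hs hs2 ha₂
    (by positivity) hC hc₀ (by positivity)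
  have l1 : ∀ᶠ k : ℕ in atTop, 1 - η / 3 ≤
      prob (D.boxCount k) {w | c₀ * (k : ℝ) ^ γ ≤ (w : ℝ)} :=
    hlim.eventually_const_le (by linarith)
  have l2 : ∀ᶠ k : ℕ in atTop, N₀ ≤ c₀ * (k : ℝ) ^ γ :=
    (((tendsto_rpow_atTop (by linarith)).comp tendsto_natCast_atTop_atTop).const_mul_atTop
      hc₀).eventually_ge_atTop N₀
  obtain ⟨K, hK⟩ := eventually_atTop.1 (l1.and l2)
  refine ⟨max K 2, le_max_right _ _, fun k hk => ?_⟩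
  have hk2 : 2 ≤ k := (le_max_right _ _).trans hk
  obtain ⟨h1, h2⟩ := hK k ((le_max_left _ _).trans hk)
  -- One third of the error for each way to fail: no suitable box with a rare word, a repeated rare
  -- word, too few boxes.
  have hsplit : ENNReal.ofReal η =
      (ENNReal.ofReal (η / 3) + ENNReal.ofReal (η / 3)) + ENNReal.ofReal (η / 3) := by
    rw [← ENNReal.ofReal_add (by positivity) (by positivity),
      ← ENNReal.ofReal_add (by positivity) (by positivity)]
    congr 1
    ring
  rw [hsplit, TextModel.dist]
  refine (toOuterMeasure_bind_le (D.boxCount k) _ {w : ℕ | c₀ * (k : ℝ) ^ γ ≤ (w : ℝ)} _ _ ?_).trans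
    (add_le_add le_rfl ?_)
  · intro N hN
    have hN : c₀ * (k : ℝ) ^ γ ≤ (N : ℝ) := hN
    have hkγ : (k : ℝ) ^ 4 ≤ (k : ℝ) ^ γ := by
      rw [← Real.rpow_natCast]
      exact Real.rpow_le_rpow_of_exponent_le (by exact_mod_cast (by omega : 1 ≤ k))
        (by push_cast; linarith)
    obtain ⟨j, hj1, hj2⟩ := hN₀ N k (h2.trans hN) (by omega)
      ((mul_le_mul_of_nonneg_left hkγ hc₀.le).trans hN)
    rw [PMF.toOuterMeasure_map_apply]
    refine le_trans (MeasureTheory.measure_mono (t :=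
      {l | ¬ ∃ b ∈ l, IsCandidate b ∧ 2 ^ j ≤ b.word} ∪
      {l | ¬ l.Pairwise fun b b' => ¬(b.word = b'.word ∧ 2 ^ j ≤ b.word)}) ?_)
      ((MeasureTheory.measure_union_le _ _).trans (add_le_add ?_ ?_))
    · intro l hl
      by_contra h
      simp only [Set.mem_union, Set.mem_ofPred_eq, not_or, not_not] at h
      exact hl ⟨j, h.1, h.2⟩
    · refine (no_candidate_le D.words D.arity k (2 ^ j) N hk2 (by positivity)
        (le_rare_words hc hs hp (2 ^ j) (by positivity))).trans (ENNReal.ofReal_le_ofReal hj1)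
    · refine (collision_le D.words D.arity k (2 ^ j) N).trans ?_
      refine le_trans (mul_le_mul_right (hcol (2 ^ j) (by positivity)) _) ?_
      rw [← ENNReal.ofReal_natCast, ← ENNReal.ofReal_pow (Nat.cast_nonneg N),
        ← ENNReal.ofReal_mul (by positivity)]
      exact ENNReal.ofReal_le_ofReal hj2
  · rw [← ofReal_prob]
    refine ENNReal.ofReal_le_ofReal ?_
    have := prob_add_compl (D.boxCount k) {w | c₀ * (k : ℝ) ^ γ ≤ (w : ℝ)}
    linarith

end QDisCo

end

noncomputable section

namespace QDisCo

open scoped ENNReal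

/-! ### Running programs -/

/-- The probability of halting within `n` steps, at time at most `T`, with an output in `S`. -/
def win (E : Env) (S : Set Val) (n T : ℕ) (c : Config) : ℝ≥0∞ :=
  (runSteps E n c).toOuterMeasure {c | c.todo = [] ∧ c.time ≤ T ∧ c.store 0 ∈ S}

/-- The probability of executing the commands `l` from the store `s` within time `τ`, with an
output in `S`. -/
def success (E : Env) (S : Set Val) (τ : ℕ) (l : List Cmd) (s : Store) : ℝ≥0∞ :=
  win E S τ τ ⟨l, s, 0⟩

section Win

variable (E : Env) (S : Set Val)

theorem win_succ (n T : ℕ) (c : Config) :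
    win E S (n + 1) T c = ∑' c', step E c c' * win E S n T c' :=
  PMF.toOuterMeasure_bind_apply _ _ _

theorem win_succ_of_pure {n T : ℕ} {c c' : Config} (h : step E c = PMF.pure c') :
    win E S (n + 1) T c = win E S n T c' := by
  rw [win, runSteps, h, PMF.pure_bind, win]

theorem step_shift (d : ℕ) (l : List Cmd) (s : Store) (t : ℕ) :
    step E ⟨l, s, t + d⟩ = (step E ⟨l, s, t⟩).map fun c => ⟨c.todo, c.store, c.time + d⟩ := by
  rcases l with _ | ⟨c, cs⟩
  · simp [step, PMF.pure_map]
  · cases c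
    case sample x e =>
      simp only [step, PMF.map_comp]
      congr 1
      funext y
      simp only [Function.comp_apply, Config.mk.injEq, true_and]
      omega
    all_goals
      simp only [step, PMF.pure_map]
      congr 2
      try omega

/-- No step reads the clock, so the clock and the deadline can be moved together. Hence `success`
may always start at time 0. -/
theorem win_shift (n T d : ℕ) (l : List Cmd) (s : Store) (t : ℕ) :
    win E S n (T + d) ⟨l, s, t + d⟩ = win E S n T ⟨l, s, t⟩ := by
  induction n generalizing l s t with
  | zero =>
    rw [win, win, runSteps, runSteps, PMF.toOuterMeasure_pure_apply,
      PMF.toOuterMeasure_pure_apply]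
    have key : (l = [] ∧ t + d ≤ T + d ∧ s 0 ∈ S) ↔ (l = [] ∧ t ≤ T ∧ s 0 ∈ S) :=
      and_congr_right fun _ => and_congr_left fun _ => Nat.add_le_add_iff_right
    by_cases h : l = [] ∧ t ≤ T ∧ s 0 ∈ S
    · exact (if_pos (key.2 h)).trans (if_pos h).symm
    · exact (if_neg fun h' => h (key.1 h')).trans (if_neg h).symm
  | succ n ih =>
    rw [win_succ, win_succ, step_shift, tsum_map_mul]
    exact tsum_congr fun c => by rw [ih]

theorem win_mono_time {n T T' : ℕ} (h : T ≤ T') (c : Config) : win E S n T c ≤ win E S n T' c :=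
  MeasureTheory.measure_mono fun _ hc => ⟨hc.1, hc.2.1.trans h, hc.2.2⟩

theorem win_nil (n T : ℕ) (s : Store) (t : ℕ) : win E S n T ⟨[], s, t⟩ = win E S 0 T ⟨[], s, t⟩ := by
  induction n with
  | zero => rfl
  | succ n ih => rw [win_succ_of_pure E S (c' := ⟨[], s, t⟩) rfl, ih]

/-- A halted configuration stays put, so additional steps lose nothing. -/
theorem win_le_succ (n T : ℕ) (c : Config) : win E S n T c ≤ win E S (n + 1) T c := by
  induction n generalizing c with
  | zero =>
    obtain ⟨l, s, t⟩ := c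
    rcases l with _ | ⟨a, l⟩
    · rw [win_nil E S (0 + 1)]
    · rw [win, runSteps, PMF.toOuterMeasure_pure_apply, if_neg]
      · exact zero_le
      · rintro ⟨h, -⟩
        exact List.cons_ne_nil _ _ h
  | succ n ih =>
    rw [win_succ, win_succ E S (n + 1)]
    exact ENNReal.tsum_le_tsum fun c' => mul_le_mul_right (ih c') _

theorem win_mono {n n' T T' : ℕ} (hn : n ≤ n') (hT : T ≤ T') (c : Config) :
    win E S n T c ≤ win E S n' T' c :=
  (monotone_nat_of_le_succ (fun n => win_le_succ E S n T c) hn).trans (win_mono_time E S hT c)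

theorem success_mono {τ τ' : ℕ} (h : τ ≤ τ') (l : List Cmd) (s : Store) :
    success E S τ l s ≤ success E S τ' l s :=
  win_mono E S h h _

theorem success_le_win (τ T n t : ℕ) (hn : τ ≤ n) (hT : τ + t ≤ T) (l : List Cmd) (s : Store) :
    success E S τ l s ≤ win E S n T ⟨l, s, t⟩ := by
  rw [success, ← win_shift E S τ τ t l s 0, zero_add]
  exact win_mono E S hn hT _

/-- The backward rule for a deterministic step: a bound for what follows becomes a bound for the
whole, with the cost of the step added to the budget. `Ensures` quantifies over all continuations so
that such rules compose. -/
theorem success_of_step {l l' : List Cmd} {s s' : Store} (d : ℕ) (τ : ℕ)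
    (h : step E ⟨l, s, 0⟩ = PMF.pure ⟨l', s', d + 1⟩) :
    success E S τ l' s' ≤ success E S (τ + (d + 1)) l s := by
  rw [success.eq_1 E S (τ + (d + 1)), ← add_assoc, win_succ_of_pure E S h]
  exact success_le_win E S _ _ _ _ (by omega) (by omega) _ _

theorem success_nil {s : Store} (h : s 0 ∈ S) : success E S 0 [] s = 1 := by
  rw [success, win, runSteps, PMF.toOuterMeasure_pure_apply, if_pos ⟨rfl, le_rfl, h⟩]

/-- A sample costs its own size, which has no bound in advance. Only samples of at most `B` nodes
are credited, which keeps the time budget uniform. -/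
theorem success_sample (x : ℕ) (e : Expr) (l : List Cmd) (s : Store) (τ B : ℕ) :
    ∑' y, E.draw (e.eval s).toNat y *
      (if y.size ≤ B then success E S τ l (Function.update s x y) else 0) ≤
    success E S (τ + (1 + (e.eval s).size + B)) (.sample x e :: l) s := by
  have h : τ + (1 + (e.eval s).size + B) = (τ + ((e.eval s).size + B)) + 1 := by omega
  rw [h, success.eq_1 E S (_ + 1), win_succ, step, tsum_map_mul]
  refine ENNReal.tsum_le_tsum fun y => mul_le_mul_right ?_ _
  split_ifs with hy
  · exact success_le_win E S _ _ _ _ (by omega) (by omega) _ _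
  · exact zero_le

theorem haltProb_eq_success (P : Cmd) (x : Val) (T : ℕ) :
    haltProb E P x T S = (success E S T [P] fun i => if i = 0 then x else .nil).toReal := rfl

end Win

/-! ### Deterministic commands -/

/-- From the store `s` the command `c` leads, within time `n`, to the store `s'`. -/
def Ensures (E : Env) (c : Cmd) (s s' : Store) (n : ℕ) : Prop :=
  ∀ S τ l, success E S τ l s' ≤ success E S (τ + n) (c :: l) s

namespace Ensures

variable {E : Env} {s s' s'' : Store} {m n : ℕ} {a b : Cmd} {e : Expr}

theorem mono (h : Ensures E a s s' m) (hmn : m ≤ n) : Ensures E a s s' n := fun S τ l =>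
  (h S τ l).trans (success_mono E S (by omega) _ _)

theorem assign (x : ℕ) (e : Expr) : Ensures E (.assign x e) s (Function.update s x (e.eval s)) 1 :=
  fun S τ _ => success_of_step E S 0 τ rfl

theorem query (x : ℕ) (e : Expr) :
    Ensures E (.query x e) s (Function.update s x (.ofNat (E.oracle (e.eval s))))
      ((e.eval s).size + 1) := fun S τ l =>
  success_of_step E S (e.eval s).size τ (by rw [step]; congr 2; omega)

theorem seq (ha : Ensures E a s s' m) (hb : Ensures E b s' s'' n) :
    Ensures E (.seq a b) s s'' (m + n + 1) := fun S τ l =>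
  (hb S τ l).trans ((ha S (τ + n) (b :: l)).trans ((success_of_step E S 0 _ rfl).trans
    (success_mono E S (by omega) _ _)))

theorem ite_nil (h : (e.eval s).isNil = true) (hb : Ensures E b s s' n) :
    Ensures E (.ite e a b) s s' (n + 1) := fun S τ l =>
  (hb S τ l).trans (success_of_step E S 0 _ (by rw [step, if_pos h]))

theorem ite_cons (h : (e.eval s).isNil = false) (ha : Ensures E a s s' n) :
    Ensures E (.ite e a b) s s' (n + 1) := fun S τ l =>
  (ha S τ l).trans (success_of_step E S 0 _ (by rw [step, if_neg (by rw [h]; decide)]))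

theorem loop_nil (h : (e.eval s).isNil = true) : Ensures E (.loop e a) s s 1 := fun S τ l =>
  success_of_step E S 0 _ (by rw [step, if_pos h])

theorem loop_cons (h : (e.eval s).isNil = false) (ha : Ensures E a s s' m)
    (hl : Ensures E (.loop e a) s' s'' n) : Ensures E (.loop e a) s s'' (m + n + 1) := fun S τ l =>
  (hl S τ l).trans ((ha S (τ + n) (.loop e a :: l)).trans
    ((success_of_step E S 0 _ (by rw [step, if_neg (by rw [h]; decide)])).trans
      (success_mono E S (by omega) _ _)))

end Ensures

/-- Execute `body` for every entry of the list in the variable `l`, with the entry in `h`. -/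
def forEach (l h : ℕ) (body : Cmd) : Cmd :=
  .loop (.var l) (.seq (.assign h (.hd (.var l))) (.seq (.assign l (.tl (.var l))) body))

/-- The loop rule, with an invariant indexed by an accumulator. `hst` lets the invariant survive the
bookkeeping in `l` and `h`. A pass costs 5 units besides the body: the loop test, two assignments
and two sequencings; the final 1 is the failing test. -/
theorem forEach_ensures {E : Env} {α β : Type} (Inv : α → Store → Prop) (f : α → β → α)
    (enc : β → Val) {l h : ℕ} (hlh : l ≠ h) (body : Cmd) (cost : ℕ)
    (hst : ∀ a s u v, Inv a s → Inv a (Function.update (Function.update s h u) l v))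
    (xs : List β)
    (hbody : ∀ a s, ∀ b ∈ xs, Inv a s → s h = enc b →
      ∃ s', Ensures E body s s' cost ∧ Inv (f a b) s' ∧ s' l = s l)
    (a : α) (s : Store) (hs : Inv a s) (hl : s l = .ofList (xs.map enc)) :
    ∃ s', Ensures E (forEach l h body) s s' (xs.length * (cost + 5) + 1) ∧
      Inv (xs.foldl f a) s' := by
  induction xs generalizing a s with
  | nil =>
    refine ⟨s, (Ensures.loop_nil ?_).mono (by simp), hs⟩
    rw [Expr.eval, hl]
    rfl
  | cons b xs ih =>
    have hl' : s l = .cons (enc b) (.ofList (xs.map enc)) := hl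
    set s₂ := Function.update (Function.update s h (enc b)) l (.ofList (xs.map enc)) with hs₂
    obtain ⟨s₃, h1, h2, h3⟩ := hbody a s₂ b List.mem_cons_self (hst a s _ _ hs)
      (by rw [hs₂, Function.update_of_ne hlh.symm, Function.update_self])
    obtain ⟨s₄, h4, h5⟩ := ih (fun a s b hb => hbody a s b (List.mem_cons_of_mem _ hb))
      (f a b) s₃ h2 (by rw [h3, hs₂, Function.update_self])
    refine ⟨s₄, ?_, h5⟩
    have e1 : Ensures E (.assign h (.hd (.var l))) s (Function.update s h (enc b)) 1 := by
      have := Ensures.assign (E := E) (s := s) h (.hd (.var l))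
      rwa [Expr.eval, Expr.eval, hl', Val.hd] at this
    have e2 : Ensures E (.assign l (.tl (.var l))) (Function.update s h (enc b)) s₂ 1 := by
      have := Ensures.assign (E := E) (s := Function.update s h (enc b)) l (.tl (.var l))
      rwa [Expr.eval, Expr.eval, Function.update_of_ne hlh, hl', Val.tl] at this
    refine (Ensures.loop_cons ?_ (e1.seq (e2.seq h1)) h4).mono ?_
    · rw [Expr.eval, hl']
      rfl
    · simp only [List.length_cons]
      ring_nf
      omega

/-! ### Running a program inside of another one -/

def Expr.bound : Expr → ℕ
  | .var x => x + 1
  | .nil => 0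
  | .cons a b => max a.bound b.bound
  | .hd a => a.bound
  | .tl a => a.bound

/-- The variables of a program are below its bound. -/
def Cmd.bound : Cmd → ℕ
  | .assign x e => max (x + 1) e.bound
  | .seq a b => max a.bound b.bound
  | .ite e a b => max e.bound (max a.bound b.bound)
  | .loop e a => max e.bound a.bound
  | .sample x e => max (x + 1) e.bound
  | .query x e => max (x + 1) e.bound

/-- The store `s` below `b`, and `s₀` from `b` on. -/
def mergeStore (b : ℕ) (s₀ s : Store) : Store := fun i => if i < b then s i else s₀ i

theorem Expr.eval_mergeStore {b : ℕ} (s₀ s : Store) {e : Expr} (h : e.bound ≤ b) :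
    e.eval (mergeStore b s₀ s) = e.eval s := by
  induction e with
  | var x => exact if_pos h
  | nil => rfl
  | cons e₁ e₂ h₁ h₂ =>
    rw [Expr.bound, max_le_iff] at h
    rw [Expr.eval, Expr.eval, h₁ h.1, h₂ h.2]
  | hd e h₁ => rw [Expr.eval, Expr.eval, h₁ h]
  | tl e h₁ => rw [Expr.eval, Expr.eval, h₁ h]

theorem update_mergeStore {b : ℕ} (s₀ s : Store) {x : ℕ} (h : x + 1 ≤ b) (v : Val) :
    Function.update (mergeStore b s₀ s) x v = mergeStore b s₀ (Function.update s x v) := by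
  funext i
  simp only [Function.update_apply, mergeStore]
  split_ifs <;> first | rfl | omega

/-- A command whose variables are below `b` neither reads nor writes anything from `b` on, so its
step commutes with changing that part of the store. -/
theorem step_mergeStore (E : Env) {b : ℕ} (s₀ : Store) (c : Config)
    (h : ∀ a ∈ c.todo, a.bound ≤ b) :
    step E ⟨c.todo, mergeStore b s₀ c.store, c.time⟩ =
      (step E c).map fun c => ⟨c.todo, mergeStore b s₀ c.store, c.time⟩ := by
  obtain ⟨l, s, t⟩ := c
  rcases l with _ | ⟨a, l⟩
  · simp [step, PMF.pure_map]
  · have ha : a.bound ≤ b := h a List.mem_cons_self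
    cases a with
    | assign x e =>
      rw [Cmd.bound, max_le_iff] at ha
      simp only [step, PMF.pure_map, Expr.eval_mergeStore s₀ s ha.2, update_mergeStore s₀ s ha.1]
    | seq a₁ a₂ => simp only [step, PMF.pure_map]
    | ite e a₁ a₂ =>
      rw [Cmd.bound, max_le_iff] at ha
      simp only [step, PMF.pure_map, Expr.eval_mergeStore s₀ s ha.1]
    | loop e a₁ =>
      rw [Cmd.bound, max_le_iff] at ha
      simp only [step, PMF.pure_map, Expr.eval_mergeStore s₀ s ha.1]
    | sample x e =>
      rw [Cmd.bound, max_le_iff] at ha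
      simp only [step, PMF.map_comp, Expr.eval_mergeStore s₀ s ha.2, update_mergeStore s₀ s ha.1]
      rfl
    | query x e =>
      rw [Cmd.bound, max_le_iff] at ha
      simp only [step, PMF.pure_map, Expr.eval_mergeStore s₀ s ha.2, update_mergeStore s₀ s ha.1]

theorem bound_of_mem_support_step (E : Env) {b : ℕ} (c : Config)
    (h : ∀ a ∈ c.todo, a.bound ≤ b) :
    ∀ c' ∈ (step E c).support, ∀ a ∈ c'.todo, a.bound ≤ b := by
  obtain ⟨l, s, t⟩ := c
  rcases l with _ | ⟨a, l⟩
  · intro c' hc'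
    simp only [step, PMF.support_pure, Set.mem_singleton_iff] at hc'
    subst hc'
    exact h
  · have ha : a.bound ≤ b := h a List.mem_cons_self
    have hl : ∀ a ∈ l, a.bound ≤ b := fun a ha => h a (List.mem_cons_of_mem _ ha)
    intro c' hc'
    cases a with
    | sample x e =>
      simp only [step, PMF.support_map, Set.mem_image] at hc'
      obtain ⟨y, _, rfl⟩ := hc'
      exact hl
    | _ =>
      simp only [step, PMF.support_pure, Set.mem_singleton_iff] at hc'
      subst hc'
      simp only [Cmd.bound, max_le_iff] at ha
      first
      | exact hl
      | (intro a' ha'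
         split_ifs at ha' <;> simp only [List.mem_cons] at ha' <;> grind [Cmd.bound])
      | (intro a' ha'
         simp only [List.mem_cons] at ha'
         grind [Cmd.bound])

theorem runSteps_mergeStore (E : Env) {b : ℕ} (s₀ : Store) (n : ℕ) (c : Config)
    (h : ∀ a ∈ c.todo, a.bound ≤ b) :
    runSteps E n ⟨c.todo, mergeStore b s₀ c.store, c.time⟩ =
      (runSteps E n c).map fun c => ⟨c.todo, mergeStore b s₀ c.store, c.time⟩ := by
  induction n generalizing c with
  | zero => simp [runSteps, PMF.pure_map]
  | succ n ih =>
    rw [runSteps, step_mergeStore E s₀ c h, PMF.bind_map, runSteps, PMF.map_bind]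
    refine PMF.ext fun d => ?_
    rw [PMF.bind_apply, PMF.bind_apply]
    refine tsum_congr fun c' => ?_
    by_cases hc' : c' ∈ (step E c).support
    · rw [Function.comp_apply, ih c' (bound_of_mem_support_step E c h c' hc')]
    · rw [(PMF.apply_eq_zero_iff _ _).2 hc', zero_mul, zero_mul]

theorem step_append (E : Env) (a : Cmd) (l rest : List Cmd) (s : Store) (t : ℕ) :
    step E ⟨a :: l ++ rest, s, t⟩ =
      (step E ⟨a :: l, s, t⟩).map fun c => ⟨c.todo ++ rest, c.store, c.time⟩ := by
  cases a with
  | sample x e => simp only [List.cons_append, step, PMF.map_comp]; rfl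
  | ite e a b => simp only [List.cons_append, step, PMF.pure_map]
  | loop e a =>
    simp only [List.cons_append, step, PMF.pure_map]
    split_ifs <;> rfl
  | _ => simp only [List.cons_append, step, PMF.pure_map]

/-- Running `c` to a halt in `A` and then `rest`: from every outcome in `A` the rest succeeds with
probability at least `v`, so the bounds multiply. -/
theorem win_append (E : Env) (S : Set Val) (A : Set Config) (rest : List Cmd) (m T : ℕ) (v : ℝ≥0∞)
    (h : ∀ c ∈ A, c.todo = [] ∧ v ≤ win E S m T ⟨rest, c.store, c.time⟩) (n : ℕ) (c : Config) :
    (runSteps E n c).toOuterMeasure A * v ≤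
      win E S (n + m) T ⟨c.todo ++ rest, c.store, c.time⟩ := by
  induction n generalizing c with
  | zero =>
    rw [runSteps, PMF.toOuterMeasure_pure_apply]
    split_ifs with hc
    · rw [(h c hc).1, one_mul, zero_add]
      exact (h c hc).2
    · rw [zero_mul]
      exact zero_le
  | succ n ih =>
    have e : n + 1 + m = n + m + 1 := by omega
    obtain ⟨l, s, t⟩ := c
    rcases l with _ | ⟨a, l⟩
    · rw [runSteps, step, PMF.pure_bind, e]
      -- The first part has already halted; its surplus step is granted to the rest.
      exact (ih _).trans (win_le_succ E S _ _ _)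
    · rw [runSteps, PMF.toOuterMeasure_bind_apply, ← ENNReal.tsum_mul_right, e, win_succ,
        step_append, tsum_map_mul]
      refine ENNReal.tsum_le_tsum fun c' => ?_
      rw [mul_assoc]
      exact mul_le_mul_right (ih c') _

/-- A program with a certain output can be run as a part of a larger program. -/
theorem success_subprogram (E : Env) (S : Set Val) (P : Cmd) {b : ℕ} (hb : P.bound ≤ b)
    (hb0 : 0 < b) (x y : Val) (n τ : ℕ) (hP : haltProb E P x n {y} = 1) (rest : List Cmd)
    (s : Store) (hs0 : s 0 = x) (hs : ∀ i, i ≠ 0 → i < b → s i = .nil) (v : ℝ≥0∞)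
    (h : ∀ s', s' 0 = y → (∀ i, b ≤ i → s' i = s i) → v ≤ success E S τ rest s') :
    v ≤ success E S (τ + n) (P :: rest) s := by
  set A : Set Config := {c | c.todo = [] ∧ c.time ≤ n ∧ c.store 0 = y ∧
    ∀ i, b ≤ i → c.store i = s i} with hA
  have h1 := win_append E S A rest τ (τ + n) v (fun c hc => ⟨hc.1, (h c.store hc.2.2.1
    hc.2.2.2).trans (success_le_win E S _ _ _ _ le_rfl (by have := hc.2.1; omega) _ _)⟩) n
    ⟨[P], s, 0⟩
  have h2 : (runSteps E n ⟨[P], s, 0⟩).toOuterMeasure A = 1 := by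
    -- The guarantee for `P` is about a clean store. Below `b` the store `s` is clean, and what lies
    -- above is carried along untouched.
    have hm : s = mergeStore b s (fun i => if i = 0 then x else .nil) := by
      funext i
      rw [mergeStore]
      split_ifs with h3 h4
      · rw [h4, hs0]
      · exact hs i h4 h3
      · rfl
    have h4 := runSteps_mergeStore E s n (initial P x) (b := b)
      (by simpa [initial] using hb)
    simp only [initial] at h4
    rw [← hm] at h4
    rw [h4, PMF.toOuterMeasure_map_apply]
    refine le_antisymm (toOuterMeasure_le_one _ _) ?_
    rw [haltProb] at hP
    have h5 := ofReal_prob (runSteps E n (initial P x))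
      {c | c.todo = [] ∧ c.time ≤ n ∧ c.store 0 ∈ ({y} : Set Val)}
    rw [hP, ENNReal.ofReal_one] at h5
    rw [h5]
    refine MeasureTheory.measure_mono ?_
    rintro c ⟨c1, c2, c3⟩
    refine ⟨c1, c2, ?_, fun i hi => ?_⟩
    · exact (if_pos hb0).trans c3
    · exact if_neg (by omega)
  rw [h2, one_mul] at h1
  rw [success, add_comm]
  rw [add_comm n] at h1
  rw [add_comm n]
  exact h1

end QDisCo

end

noncomputable section

namespace QDisCo

open scoped ENNReal

/-! ### Data -/

namespace Val

theorem ofNat_eq_ofList (n : ℕ) :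
    ofNat n = ofList ((List.replicate n ()).map fun _ => nil) := by
  induction n with
  | zero => rfl
  | succ n ih => rw [ofNat, ih, List.replicate_succ]; rfl

theorem toNat_ofNat (n : ℕ) : (ofNat n).toNat = n := by
  induction n with
  | zero => rfl
  | succ n ih => rw [ofNat, toNat, ih]

theorem isNil_ofNat (n : ℕ) : (ofNat n).isNil = decide (n = 0) := by
  cases n <;> rfl

theorem size_ofNat (n : ℕ) : (ofNat n).size = 2 * n + 1 := by
  induction n with
  | zero => rfl
  | succ n ih => rw [ofNat, size, ih, size]; omega

theorem tl_ofNat (n : ℕ) : (ofNat n).tl = ofNat (n - 1) := by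
  cases n <;> rfl

theorem isNil_ofBits (l : List Bool) : (ofBits l).isNil = l.isEmpty := by
  cases l <;> rfl

theorem tl_ofBits (l : List Bool) : (ofBits l).tl = ofBits l.tail := by
  cases l <;> rfl

theorem length_le_size_ofList {α : Type} (f : α → Val) (l : List α) :
    l.length ≤ (ofList (l.map f)).size := by
  induction l with
  | nil => simp
  | cons a l ih =>
    simp only [List.map_cons, ofList, size, List.length_cons]
    omega

theorem size_le_size_ofList {α : Type} (f : α → Val) (l : List α) {a : α} (ha : a ∈ l) :
    (f a).size ≤ (ofList (l.map f)).size := by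
  induction l with
  | nil => simp at ha
  | cons b l ih =>
    simp only [List.map_cons, ofList, size]
    rcases List.mem_cons.1 ha with rfl | h
    · omega
    · have := ih h
      omega

theorem size_ofList_le_mul {α : Type} (f g : α → Val) (c : ℕ) (hc : 1 ≤ c) (l : List α)
    (h : ∀ a ∈ l, (g a).size ≤ c * (f a).size) :
    (ofList (l.map g)).size ≤ c * (ofList (l.map f)).size := by
  induction l with
  | nil => simpa [ofList, size] using hc
  | cons a l ih =>
    have h1 := h a List.mem_cons_self
    have h2 := ih fun b hb => h b (List.mem_cons_of_mem _ hb)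
    simp only [List.map_cons, ofList, size]
    nlinarith

theorem size_ofList_le_length {α : Type} (f : α → Val) (c : ℕ) (l : List α)
    (h : ∀ a ∈ l, (f a).size ≤ c) : (ofList (l.map f)).size ≤ l.length * (c + 1) + 1 := by
  induction l with
  | nil => simp [ofList, size]
  | cons a l ih =>
    have h1 := h a List.mem_cons_self
    have h2 := ih fun b hb => h b (List.mem_cons_of_mem _ hb)
    simp only [List.map_cons, ofList, size, List.length_cons]
    nlinarith

theorem size_ofBits_le (l : List Bool) : (ofBits l).size ≤ l.length * 4 + 1 :=
  size_ofList_le_length ofBool 3 l fun a _ => by cases a <;> simp [ofBool, size]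

end Val

/-- The store is unchanged except for the variables in `M`. -/
def Agree (M : Finset ℕ) (s s' : Store) : Prop := ∀ i ∉ M, s' i = s i

theorem Agree.trans {M M' : Finset ℕ} {s s' s'' : Store} (h : Agree M s s') (h' : Agree M' s' s'')
    : Agree (M ∪ M') s s'' := fun i hi => by
  rw [Finset.mem_union, not_or] at hi
  rw [h' i hi.2, h i hi.1]

theorem Agree.mono {M M' : Finset ℕ} {s s' : Store} (h : Agree M s s') (hM : M ⊆ M') :
    Agree M' s s' := fun i hi => h i fun h' => hi (hM h')

theorem Agree.update (s : Store) (x : ℕ) (v : Val) : Agree {x} s (Function.update s x v) :=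
  fun i hi => Function.update_of_ne (by simpa using hi) _ _

/-! ### The choice of a box -/

open Classical in
/-- The word of the box if the circuit can be put into it and there is no longer one yet. -/
def longerWord {k : ℕ} (best : List Bool) (b : Box k) : List Bool :=
  if IsCandidate b ∧ best.length ≤ b.word.bits.length then b.word.bits else best

/-- Induction from the right end, where the fold looks last. The empty word stands for "no box found
yet". -/
theorem foldl_longerWord {k : ℕ} (l : List (Box k)) :
    (l.foldl longerWord [] = [] ∨ ∃ b ∈ l, IsCandidate b ∧ l.foldl longerWord [] = b.word.bits) ∧
      ∀ b ∈ l, IsCandidate b → b.word.bits.length ≤ (l.foldl longerWord []).length := by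
  induction l using List.reverseRecOn with
  | nil => simp
  | append_singleton l b ih =>
    obtain ⟨h1, h2⟩ := ih
    rw [List.foldl_append, List.foldl_cons, List.foldl_nil]
    set best := l.foldl longerWord []
    rw [longerWord]
    split_ifs with hb
    · refine ⟨Or.inr ⟨b, by simp, hb.1, rfl⟩, fun c hc hcc => ?_⟩
      rcases List.mem_append.1 hc with hc | hc
      · exact (h2 c hc hcc).trans hb.2
      · rw [List.mem_singleton.1 hc]
    · constructor
      · rcases h1 with h1 | ⟨c, hc, h3, h4⟩
        · exact Or.inl h1
        · exact Or.inr ⟨c, List.mem_append_left _ hc, h3, h4⟩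
      · intro c hc hcc
        rcases List.mem_append.1 hc with hc | hc
        · exact h2 c hc hcc
        · rw [List.mem_singleton.1 hc] at hcc ⊢
          by_contra h
          exact hb ⟨hcc, by omega⟩

/-- The threshold 2^j is unknown to the search, but being at least 2^j is the same as having more
than j bits. So the longest word among suitable boxes reaches the threshold if any does, and no word
from the threshold on is repeated anywhere in the text. -/
theorem GoodText.split {T : Text} (h : GoodText T) : ∃ l₁ b l₂, T.boxes = l₁ ++ b :: l₂ ∧
    IsCandidate b ∧ (∀ c ∈ l₁, c.word ≠ b.word) ∧ (∀ c ∈ l₂, c.word ≠ b.word) ∧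
    T.boxes.foldl longerWord [] = b.word.bits := by
  obtain ⟨j, ⟨b₀, hb₀, hc₀, hj₀⟩, hp⟩ := h
  obtain ⟨h1, h2⟩ := foldl_longerWord T.boxes
  have hlen : ∀ n : ℕ, j < n.bits.length ↔ 2 ^ j ≤ n := fun n => by
    rw [Nat.size_eq_bits_len, Nat.lt_size]
  have h3 := h2 b₀ hb₀ hc₀
  have h4 := (hlen _).2 hj₀
  rcases h1 with h1 | ⟨b, hb, hc, h5⟩
  · rw [h1, List.length_nil] at h3
    omega
  · have h6 : 2 ^ j ≤ b.word := by
      rw [← hlen, ← h5]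
      omega
    obtain ⟨l₁, l₂, h7⟩ := List.append_of_mem hb
    refine ⟨l₁, b, l₂, h7, hc, ?_, ?_, h5⟩
    · intro c hc' he
      rw [h7, List.pairwise_append] at hp
      exact hp.2.2 c hc' b List.mem_cons_self ⟨he, he ▸ h6⟩
    · intro c hc' he
      rw [h7, List.pairwise_append, List.pairwise_cons] at hp
      exact hp.2.1.1 c hc' ⟨he.symm, h6⟩

/-! ### Programs -/

namespace Prog

/-- The variables of the programs: 0 input and output; 1 rounds left; 2 qubits of the circuit; 3
wires of a context; 4, 5, 6, 20, 21, 23 lists and entries during the preparation; 7 and 22 scratch;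
8 translated gates; 9 and 10 votes; 11, 12, 13 the texts; 14 to 18 the search for a box; 19 the
answer of the oracle. -/
def one : Expr := .cons .nil .nil

def two : Expr := .cons .nil one

def skip : Cmd := .assign 7 .nil

/-- Add `a` to a unary number. -/
def addNat : ℕ → Expr → Expr
  | 0, e => e
  | a + 1, e => .cons .nil (addNat a e)

theorem eval_addNat (a : ℕ) (e : Expr) (s : Store) (n : ℕ) (h : e.eval s = .ofNat n) :
    (addNat a e).eval s = .ofNat (n + a) := by
  induction a with
  | zero => exact h
  | succ a ih => rw [addNat, Expr.eval, ih]; rfl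

theorem skip_ensures (E : Env) (s : Store) : ∃ s', Ensures E skip s s' 1 ∧ Agree {7} s s' :=
  ⟨_, Ensures.assign _ _, Agree.update _ _ _⟩

/-- Drop as many entries from the list in `18` as there are in the list in `17`. -/
def dropLoop : Cmd :=
  .loop (.var 17) (.seq (.assign 17 (.tl (.var 17))) (.assign 18 (.tl (.var 18))))

theorem dropLoop_ensures (E : Env) (l₁ l₂ : List Bool) (s : Store) (h₁ : s 17 = .ofBits l₁)
    (h₂ : s 18 = .ofBits l₂) : ∃ s', Ensures E dropLoop s s' (4 * l₁.length + 1) ∧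
      s' 18 = .ofBits (l₂.drop l₁.length) ∧ Agree {17, 18} s s' := by
  induction l₁ generalizing l₂ s with
  | nil =>
    refine ⟨s, Ensures.loop_nil ?_, by simpa using h₂, fun _ _ => rfl⟩
    rw [Expr.eval, h₁]
    rfl
  | cons a l₁ ih =>
    have e1 := Ensures.assign (E := E) (s := s) 17 (.tl (.var 17))
    have e2 := Ensures.assign (E := E)
      (s := Function.update s 17 ((Expr.tl (.var 17)).eval s)) 18 (.tl (.var 18))
    obtain ⟨s', h3, h4, h5⟩ := ih l₂.tail (s := Function.update (Function.update s 17
      ((Expr.tl (.var 17)).eval s)) 18 ((Expr.tl (.var 18)).eval (Function.update s 17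
      ((Expr.tl (.var 17)).eval s))))
      (by simp [Expr.eval, h₁, Val.tl_ofBits]) (by simp [Expr.eval, h₂, Val.tl_ofBits])
    refine ⟨s', (Ensures.loop_cons ?_ (e1.seq e2) h3).mono ?_, ?_, ?_⟩
    · rw [Expr.eval, h₁]
      rfl
    · simp only [List.length_cons]
      omega
    · rw [h4, List.length_cons, List.drop_tail]
    · refine Agree.mono (((Agree.update _ _ _).trans (Agree.update _ _ _)).trans h5) ?_
      decide

/-- Lengths are compared without arithmetic: as many entries as the new word has are dropped from
the best word so far, and nothing is left exactly if the new word is at least as long. -/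
def keepLonger : Cmd :=
  .seq (.assign 17 (.hd (.var 15))) (.seq (.assign 18 (.var 16)) (.seq dropLoop
    (.ite (.var 18) skip (.assign 16 (.hd (.var 15))))))

theorem keepLonger_ensures (E : Env) (w best : List Bool) (v : Val) (s : Store)
    (h₁ : s 15 = .cons (.ofBits w) v) (h₂ : s 16 = .ofBits best) :
    ∃ s', Ensures E keepLonger s s' (4 * w.length + 8) ∧
      s' 16 = .ofBits (if best.length ≤ w.length then w else best) ∧
      Agree {7, 16, 17, 18} s s' := by
  have e1 := Ensures.assign (E := E) (s := s) 17 (.hd (.var 15))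
  set s₁ := Function.update s 17 ((Expr.hd (.var 15)).eval s) with hs₁
  have e2 := Ensures.assign (E := E) (s := s₁) 18 (.var 16)
  set s₂ := Function.update s₁ 18 ((Expr.var 16).eval s₁) with hs₂
  obtain ⟨s₃, e3, h4, h5⟩ := dropLoop_ensures E w best s₂
    (by simp [hs₂, hs₁, Expr.eval, h₁, Val.hd]) (by simp [hs₂, hs₁, Expr.eval, h₂])
  have a1 : Agree {17, 18} s s₃ :=
    (((Agree.update _ _ _).trans (Agree.update _ _ _)).trans h5).mono (by decide)
  have a15 : s₃ 15 = s 15 := a1 15 (by decide)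
  have a16 : s₃ 16 = s 16 := a1 16 (by decide)
  by_cases hl : best.length ≤ w.length
  · refine ⟨_, (e1.seq (e2.seq (e3.seq (Ensures.ite_nil ?_ (Ensures.assign _ _))))).mono ?_, ?_,
      ?_⟩
    · rw [Expr.eval, h4, List.drop_eq_nil_of_le hl]
      rfl
    · omega
    · rw [Function.update_self, if_pos hl, Expr.eval, Expr.eval, a15, h₁]
      rfl
    · exact (a1.trans (Agree.update _ _ _)).mono (by decide)
  · obtain ⟨s₄, e4, a4⟩ := skip_ensures E s₃
    refine ⟨s₄, (e1.seq (e2.seq (e3.seq (Ensures.ite_cons ?_ e4)))).mono ?_, ?_, ?_⟩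
    · rw [Expr.eval, h4, Val.isNil_ofBits]
      simpa using hl
    · omega
    · rw [a4 16 (by decide), a16, h₂, if_neg hl]
    · exact (a1.trans a4).mono (by decide)

/-- Look at the box in `15`, and keep its word in `16` if it is suitable. -/
def examine : Cmd :=
  .ite (.tl (.hd (.tl (.var 15))))
    (.ite (.tl (.tl (.hd (.tl (.var 15))))) skip
      (.ite (.hd (.hd (.tl (.tl (.var 15))))) skip keepLonger)) skip

theorem examine_ensures (E : Env) {k : ℕ} (b : Box k) (best : List Bool) (s : Store)
    (h₁ : s 15 = b.enc) (h₂ : s 16 = .ofBits best) :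
    ∃ s', Ensures E examine s s' (4 * b.word.bits.length + 11) ∧
      s' 16 = .ofBits (longerWord best b) ∧ Agree {7, 16, 17, 18} s s' := by
  obtain ⟨s₁, e1, a1⟩ := skip_ensures E s
  have hskip : s₁ 16 = .ofBits best := by rw [a1 16 (by decide), h₂]
  have ha1 : Agree {7, 16, 17, 18} s s₁ := a1.mono (by decide)
  obtain ⟨w, a, inp⟩ := b
  -- The program reads the arity off its unary form: the tail is empty for 0 and 1, and the second
  -- tail is nonempty from 3 on.
  match a, inp, h₁ with
  | 0, inp, h₁ =>
    refine ⟨s₁, (Ensures.ite_nil ?_ e1).mono (by omega), ?_, ha1⟩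
    · simp only [Expr.eval, h₁]; rfl
    · rw [hskip, longerWord, if_neg fun h => absurd h.1.1 (by simp)]
  | 1, inp, h₁ =>
    refine ⟨s₁, (Ensures.ite_nil ?_ e1).mono (by omega), ?_, ha1⟩
    · simp only [Expr.eval, h₁]; rfl
    · rw [hskip, longerWord, if_neg fun h => absurd h.1.1 (by simp)]
  | a + 3, inp, h₁ =>
    refine ⟨s₁, (Ensures.ite_cons ?_ (Ensures.ite_cons ?_ e1)).mono (by omega), ?_, ha1⟩
    · simp only [Expr.eval, h₁]; rfl
    · simp only [Expr.eval, h₁]; rfl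
    · rw [hskip, longerWord, if_neg fun h => absurd h.1.1 (by simp)]
  | 2, inp, h₁ =>
    have hinp : ((Expr.hd (.hd (.tl (.tl (.var 15))))).eval s) = .ofNat (inp 0).val := by
      simp only [Expr.eval, h₁]; rfl
    by_cases h0 : (inp 0).val = 0
    · obtain ⟨s₂, e2, h3, a2⟩ := keepLonger_ensures E w.bits best _ s h₁ h₂
      refine ⟨s₂, (Ensures.ite_cons ?_ (Ensures.ite_nil ?_ (Ensures.ite_nil ?_ e2))).mono ?_,
        ?_, a2⟩
      · simp only [Expr.eval, h₁]; rfl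
      · simp only [Expr.eval, h₁]; rfl
      · rw [hinp, h0]; rfl
      · dsimp only; omega
      · have hc : IsCandidate (⟨w, 2, inp⟩ : Box k) := by
          refine ⟨rfl, fun i hi => ?_⟩
          have : i = (0 : Fin 2) := Fin.ext hi
          subst this
          exact h0
        rw [h3, longerWord]
        simp only [hc, true_and]
    · refine ⟨s₁, (Ensures.ite_cons ?_ (Ensures.ite_nil ?_ (Ensures.ite_cons ?_ e1))).mono ?_,
        ?_, ha1⟩
      · simp only [Expr.eval, h₁]; rfl
      · simp only [Expr.eval, h₁]; rfl
      · rw [hinp, Val.isNil_ofNat]; simpa using h0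
      · omega
      · rw [hskip, longerWord, if_neg fun h => h0 (h.1.2 (0 : Fin 2) rfl)]

theorem length_bits_le {T : Text} {B : ℕ} (hB : T.enc.size ≤ B) {b : Box T.wires}
    (hb : b ∈ T.boxes) : b.word.bits.length ≤ B := by
  have h1 := Val.length_le_size_ofList Val.ofBool b.word.bits
  have h2 := Val.size_le_size_ofList Box.enc T.boxes hb
  have h3 : (Val.ofNatBin b.word).size ≤ b.enc.size := by
    simp only [Box.enc, Val.ofList, Val.size]
    omega
  have h4 : (Val.ofList (T.boxes.map Box.enc)).size ≤ T.enc.size := by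
    simp only [Text.enc, Val.size]
    omega
  exact h1.trans (h3.trans (h2.trans (h4.trans hB)))

theorem length_foldl_longerWord_le {T : Text} {B : ℕ} (hB : T.enc.size ≤ B) :
    (T.boxes.foldl longerWord []).length ≤ B := by
  rcases (foldl_longerWord T.boxes).1 with h | ⟨b, hb, -, h⟩
  · rw [h]
    exact Nat.zero_le _
  · rw [h]
    exact length_bits_le hB hb

def search : Cmd :=
  .seq (.assign 14 (.tl (.var 11))) (.seq (.assign 16 .nil) (forEach 14 15 examine))

theorem search_ensures (E : Env) (T : Text) (B : ℕ) (hB : T.enc.size ≤ B) (s : Store)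
    (h : s 11 = T.enc) : ∃ s', Ensures E search s s' (B * (4 * B + 16) + 5) ∧
      s' 16 = .ofBits (T.boxes.foldl longerWord []) ∧ Agree {7, 14, 15, 16, 17, 18} s s' := by
  have e1 := Ensures.assign (E := E) (s := s) 14 (.tl (.var 11))
  set s₁ := Function.update s 14 ((Expr.tl (.var 11)).eval s) with hs₁
  have e2 := Ensures.assign (E := E) (s := s₁) 16 .nil
  set s₂ := Function.update s₁ 16 (Expr.nil.eval s₁) with hs₂
  have a2 : Agree {7, 14, 15, 16, 17, 18} s s₂ :=
    ((Agree.update _ _ _).trans (Agree.update _ _ _)).mono (by decide)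
  obtain ⟨s₃, e3, h3, a3⟩ := forEach_ensures (E := E)
    (fun best s' => s' 16 = .ofBits best ∧ Agree {7, 14, 15, 16, 17, 18} s s')
    longerWord Box.enc (l := 14) (h := 15) (by decide) examine (4 * B + 11)
    (fun a s' u v h => ⟨by simpa using h.1, (h.2.trans ((Agree.update _ _ _).trans
      (Agree.update _ _ _))).mono (by decide)⟩) T.boxes
    (by
      intro best s' b hb hs' hb'
      obtain ⟨s'', e, h4, h5⟩ := examine_ensures E b best s' hb' hs'.1
      refine ⟨s'', e.mono ?_, ⟨h4, (hs'.2.trans h5).mono (by decide)⟩, h5 14 (by decide)⟩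
      have := length_bits_le hB hb
      omega)
    [] s₂ ⟨by simp [hs₂, Expr.eval]; rfl, a2⟩ (by simp [hs₂, hs₁, Expr.eval, h]; rfl)
  refine ⟨s₃, (e1.seq (e2.seq e3)).mono ?_, h3, a3⟩
  have h5 : T.boxes.length ≤ B := by
    have h6 := Val.length_le_size_ofList Box.enc T.boxes
    have h4 : (Val.ofList (T.boxes.map Box.enc)).size ≤ T.enc.size := by
      simp only [Text.enc, Val.size]
      omega
    omega
  have h7 := Nat.mul_le_mul_right (4 * B + 11 + 5) h5
  have h8 : 4 * B + 11 + 5 = 4 * B + 16 := by omega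
  rw [h8] at h7 ⊢
  omega

def list₁ (a : Expr) : Expr := .cons a .nil

def list₂ (a b : Expr) : Expr := .cons a (list₁ b)

def list₃ (a b c : Expr) : Expr := .cons a (list₂ b c)

def list₄ (a b c d : Expr) : Expr := .cons a (list₃ b c d)

/-- The instance with the word in `16`. -/
def queryExpr : Expr :=
  list₃
    (list₃ (.var 2) (list₁ (list₃ (.var 16) two (.var 8)))
      (list₁ (list₃ two .nil (list₁ (list₂ .nil .nil)))))
    (.var 11) (list₂ (.var 12) (.var 13))

/-- The encoding of the instance in which the word `w` gets the circuit with the encoding `g`. -/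
def queryVal (q : ℕ) (w : List Bool) (g T Q₁ Q₂ : Val) : Val :=
  .ofList [.ofList [.ofNat q, .ofList [.ofList [.ofBits w, .ofNat 2, g]],
    .ofList [.ofList [.ofNat 2, .ofNat 0, .ofList [.ofList [.ofNat 0, .ofNat 0]]]]], T,
    .ofList [Q₁, Q₂]]

/-- The encoding of a gate on the qubits of the two wires of a box. -/
def splitGateEnc {n : ℕ} (g : Gate (Fin n)) : Val :=
  g.enc fun i => .cons (.ofNat (if i.val = 0 then 0 else 1)) (.ofNat i.val)

/-- The oracle is only trusted on encodings of genuine instances, so what the program assembles has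
to be literally such an encoding. -/
theorem enc_splitInstance (C : QCircuit) (w : ℕ) (T Q₁ Q₂ : Text) (h₁ : Q₁.wires ≤ T.wires)
    (h₂ : Q₂.wires ≤ T.wires) : (splitInstance C w T Q₁ Q₂ h₁ h₂).enc =
      queryVal C.qubits w.bits (.ofList (C.gates.map splitGateEnc)) T.enc Q₁.enc Q₂.enc := by
  have h : (C.gates.map (Gate.map (splitEmb C))).map
      (Gate.enc fun i => .cons (.ofNat i.1.val) (.ofNat i.2.val)) =
      C.gates.map splitGateEnc := by
    rw [List.map_map]
    refine List.map_congr_left fun g _ => ?_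
    have key : ∀ i : Fin C.qubits, (splitEmb C i).1.val = if i.val = 0 then 0 else 1 := by
      intro i
      change Fin.val (if i.val = 0 then (0 : Fin 2) else 1) = _
      split_ifs <;> rfl
    cases g <;> simp only [Function.comp_apply, Gate.map, Gate.enc, splitGateEnc, key,
      Function.Embedding.trans_apply] <;> rfl
  rw [← h]
  rfl

/-! ### Counting votes and deciding one round -/

def voteYes : Cmd :=
  .ite (.var 10) (.assign 10 (.tl (.var 10))) (.assign 9 (.cons .nil (.var 9)))

def voteNo : Cmd :=
  .ite (.var 9) (.assign 9 (.tl (.var 9))) (.assign 10 (.cons .nil (.var 10)))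

/-- The difference between the numbers of votes for "yes" and for "no". -/
def Margin (d : ℤ) (s : Store) : Prop :=
  s 9 = .ofNat d.toNat ∧ s 10 = .ofNat (-d).toNat

/-- The signed margin is held in two unary counters of which at most one is nonzero: a vote first
cancels an opposing vote, if there is one. -/
theorem voteYes_ensures (E : Env) (d : ℤ) (s : Store) (h : Margin d s) :
    ∃ s', Ensures E voteYes s s' 2 ∧ Margin (d + 1) s' ∧ Agree {9, 10} s s' := by
  obtain ⟨h1, h2⟩ := h
  by_cases hd : d < 0
  · refine ⟨_, Ensures.ite_cons ?_ (Ensures.assign _ _), ⟨?_, ?_⟩,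
      (Agree.update _ _ _).mono (by decide)⟩
    · rw [Expr.eval, h2, Val.isNil_ofNat, decide_eq_false_iff_not]
      omega
    · rw [Function.update_of_ne (by decide), h1]
      congr 1
      omega
    · rw [Function.update_self, Expr.eval, Expr.eval, h2, Val.tl_ofNat]
      congr 1
      omega
  · refine ⟨_, Ensures.ite_nil ?_ (Ensures.assign _ _), ⟨?_, ?_⟩,
      (Agree.update _ _ _).mono (by decide)⟩
    · rw [Expr.eval, h2, Val.isNil_ofNat, decide_eq_true_eq]
      omega
    · have : (d + 1).toNat = d.toNat + 1 := by omega
      rw [Function.update_self, Expr.eval, Expr.eval, h1, this]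
      rfl
    · rw [Function.update_of_ne (by decide), h2]
      congr 1
      omega

theorem voteNo_ensures (E : Env) (d : ℤ) (s : Store) (h : Margin d s) :
    ∃ s', Ensures E voteNo s s' 2 ∧ Margin (d - 1) s' ∧ Agree {9, 10} s s' := by
  obtain ⟨h1, h2⟩ := h
  by_cases hd : 0 < d
  · refine ⟨_, Ensures.ite_cons ?_ (Ensures.assign _ _), ⟨?_, ?_⟩,
      (Agree.update _ _ _).mono (by decide)⟩
    · rw [Expr.eval, h1, Val.isNil_ofNat, decide_eq_false_iff_not]
      omega
    · rw [Function.update_self, Expr.eval, Expr.eval, h1, Val.tl_ofNat]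
      congr 1
      omega
    · rw [Function.update_of_ne (by decide), h2]
      congr 1
      omega
  · refine ⟨_, Ensures.ite_nil ?_ (Ensures.assign _ _), ⟨?_, ?_⟩,
      (Agree.update _ _ _).mono (by decide)⟩
    · rw [Expr.eval, h1, Val.isNil_ofNat, decide_eq_true_eq]
      omega
    · rw [Function.update_of_ne (by decide), h1]
      congr 1
      omega
    · have : (-(d - 1)).toNat = (-d).toNat + 1 := by omega
      rw [Function.update_self, Expr.eval, Expr.eval, h2, this]
      rfl

/-- Choose a box of the context, query the oracle, and vote. -/
def decideRound : Cmd :=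
  .seq search (.seq (.query 19 queryExpr) (.ite (.var 19) voteYes voteNo))

/-- The vote that results from texts. -/
def vote (O : Val → ℕ) (q : ℕ) (g : Val) (T Q₁ Q₂ : Text) : ℤ :=
  if O (queryVal q (T.boxes.foldl longerWord []) g T.enc Q₁.enc Q₂.enc) = 0 then -1 else 1

theorem decideRound_ensures (E : Env) (T Q₁ Q₂ : Text) (B q G : ℕ) (g : Val)
    (hT : T.enc.size ≤ B) (hQ₁ : Q₁.enc.size ≤ B) (hQ₂ : Q₂.enc.size ≤ B) (hg : g.size ≤ G)
    (d : ℤ) (s : Store) (h2 : s 2 = .ofNat q) (h8 : s 8 = g) (hd : Margin d s)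
    (h11 : s 11 = T.enc) (h12 : s 12 = Q₁.enc) (h13 : s 13 = Q₂.enc) :
    ∃ s', Ensures E decideRound s s' (B * (4 * B + 16) + 7 * B + 2 * q + G + 70) ∧
      Margin (d + vote E.oracle q g T Q₁ Q₂) s' ∧
      Agree {7, 9, 10, 14, 15, 16, 17, 18, 19} s s' := by
  obtain ⟨s₁, e1, h16, a1⟩ := search_ensures E T B hT s h11
  have e2 := Ensures.query (E := E) (s := s₁) 19 queryExpr
  have hq : queryExpr.eval s₁ =
      queryVal q (T.boxes.foldl longerWord []) g T.enc Q₁.enc Q₂.enc := by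
    simp only [queryExpr, list₁, list₂, list₃, two, one, Expr.eval, h16, a1 2 (by decide),
      a1 8 (by decide), a1 11 (by decide), a1 12 (by decide), a1 13 (by decide), h2, h8, h11,
      h12, h13]
    rfl
  rw [hq] at e2
  set s₂ := Function.update s₁ 19 (.ofNat (E.oracle
    (queryVal q (T.boxes.foldl longerWord []) g T.enc Q₁.enc Q₂.enc))) with hs₂
  have a2 : Agree {7, 14, 15, 16, 17, 18, 19} s s₂ :=
    (a1.trans (Agree.update _ _ _)).mono (by decide)
  have hd2 : Margin d s₂ := by
    rwa [Margin, a2 9 (by decide), a2 10 (by decide)]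
  -- The texts contribute 3B, and the word 4B because each of its at most B bits costs at most 4
  -- nodes.
  have hsize : (queryVal q (T.boxes.foldl longerWord []) g T.enc Q₁.enc Q₂.enc).size ≤
      7 * B + 2 * q + G + 55 := by
    have h3 := Val.size_ofBits_le (T.boxes.foldl longerWord [])
    have h4 := length_foldl_longerWord_le hT
    simp only [queryVal, Val.ofList, Val.size, Val.size_ofNat]
    omega
  have h19 : ((Expr.var 19).eval s₂).isNil = decide (E.oracle
      (queryVal q (T.boxes.foldl longerWord []) g T.enc Q₁.enc Q₂.enc) = 0) := by
    rw [Expr.eval, hs₂, Function.update_self, Val.isNil_ofNat]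
  by_cases hO : E.oracle (queryVal q (T.boxes.foldl longerWord []) g T.enc Q₁.enc Q₂.enc) = 0
  · obtain ⟨s₃, e3, h3, a3⟩ := voteNo_ensures E d s₂ hd2
    refine ⟨s₃, (e1.seq (e2.seq (Ensures.ite_nil (by rw [h19]; simpa using hO) e3))).mono ?_,
      ?_, (a2.trans a3).mono (by decide)⟩
    · omega
    · rwa [vote, if_pos hO, ← sub_eq_add_neg]
  · obtain ⟨s₃, e3, h3, a3⟩ := voteYes_ensures E d s₂ hd2
    refine ⟨s₃, (e1.seq (e2.seq (Ensures.ite_cons (by rw [h19]; simpa using hO) e3))).mono ?_,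
      ?_, (a2.trans a3).mono (by decide)⟩
    · omega
    · rwa [vote, if_neg hO]

/-! ### The preparation -/

/-- Translate the qubit with the number in `e`. -/
def splitQubit (x : ℕ) (e : Expr) : Cmd :=
  .ite e (.assign x (.cons one e)) (.assign x (.cons .nil .nil))

theorem splitQubit_ensures (E : Env) (x : ℕ) (e : Expr) (s : Store) (i : ℕ)
    (h : e.eval s = .ofNat i) : Ensures E (splitQubit x e) s
      (Function.update s x (.cons (.ofNat (if i = 0 then 0 else 1)) (.ofNat i))) 2 := by
  by_cases hi : i = 0
  · subst hi
    exact Ensures.ite_nil (by rw [h]; rfl) (Ensures.assign _ _)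
  · have := Ensures.assign (E := E) (s := s) x (.cons one e)
    rw [Expr.eval, h] at this
    rw [if_neg hi]
    exact Ensures.ite_cons (by rw [h, Val.isNil_ofNat]; simpa using hi) this

/-- Translate the gate in `5`, and put it in front of the list in `6`. -/
def splitGate : Cmd :=
  .ite (.hd (.var 5))
    (.ite (.tl (.hd (.var 5)))
      (.seq (splitQubit 7 (.hd (.tl (.tl (.var 5)))))
        (.seq (splitQubit 22 (.hd (.tl (.tl (.tl (.var 5))))))
          (.assign 6 (.cons (list₄ (.hd (.var 5)) (.hd (.tl (.var 5))) (.var 7) (.var 22))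
            (.var 6)))))
      (.seq (splitQubit 7 (.hd (.tl (.tl (.var 5)))))
        (.assign 6 (.cons (list₃ (.hd (.var 5)) (.hd (.tl (.var 5))) (.var 7)) (.var 6)))))
    (.seq (splitQubit 7 (.hd (.tl (.var 5))))
      (.assign 6 (.cons (list₂ (.hd (.var 5)) (.var 7)) (.var 6))))

theorem splitGate_ensures (E : Env) {n : ℕ} (g : Gate (Fin n)) (s : Store)
    (h : s 5 = g.enc fun i => .ofNat i.val) :
    ∃ s', Ensures E splitGate s s' 9 ∧ s' 6 = .cons (splitGateEnc g) (s 6) ∧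
      Agree {6, 7, 22} s s' := by
  cases g with
  | not i =>
    have e1 := splitQubit_ensures E 7 (.hd (.tl (.var 5))) s i.val
      (by simp only [Expr.eval, h]; rfl)
    refine ⟨_, (Ensures.ite_nil ?_ (e1.seq (Ensures.assign _ _))).mono (by omega), ?_,
      ((Agree.update _ _ _).trans (Agree.update _ _ _)).mono (by decide)⟩
    · simp only [Expr.eval, h]; rfl
    · rw [Function.update_self]
      simp [Expr.eval, h, list₁, list₂]
      rfl
  | one w i =>
    have e1 := splitQubit_ensures E 7 (.hd (.tl (.tl (.var 5)))) s i.val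
      (by simp only [Expr.eval, h]; rfl)
    refine ⟨_, (Ensures.ite_cons ?_ (Ensures.ite_nil ?_ (e1.seq (Ensures.assign _ _)))).mono
      (by omega), ?_, ((Agree.update _ _ _).trans (Agree.update _ _ _)).mono (by decide)⟩
    · simp only [Expr.eval, h]; rfl
    · simp only [Expr.eval, h]; rfl
    · rw [Function.update_self]
      simp [Expr.eval, h, list₁, list₂, list₃]
      rfl
  | two w p =>
    have e1 := splitQubit_ensures E 7 (.hd (.tl (.tl (.var 5)))) s (p 0).val
      (by simp only [Expr.eval, h]; rfl)
    set s₁ := Function.update s 7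
      (.cons (.ofNat (if (p 0).val = 0 then 0 else 1)) (.ofNat (p 0).val)) with hs₁
    have h5 : s₁ 5 = s 5 := by simp [hs₁]
    have e2 := splitQubit_ensures E 22 (.hd (.tl (.tl (.tl (.var 5))))) s₁ (p 1).val
      (by simp only [Expr.eval, h5, h]; rfl)
    refine ⟨_, (Ensures.ite_cons ?_ (Ensures.ite_cons ?_ (e1.seq (e2.seq
      (Ensures.assign _ _))))).mono (by omega), ?_, (((Agree.update _ _ _).trans
        (Agree.update _ _ _)).trans (Agree.update _ _ _)).mono (by decide)⟩
    · simp only [Expr.eval, h]; rfl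
    · simp only [Expr.eval, h]; rfl
    · rw [Function.update_self]
      simp [Expr.eval, h, hs₁, list₁, list₂, list₃, list₄]
      rfl

end Prog

end QDisCo

end

noncomputable section

namespace QDisCo

open scoped ENNReal

theorem tsum_bind_mul {α β : Type} (p : PMF α) (f : α → PMF β) (g : β → ℝ≥0∞) :
    ∑' b, p.bind f b * g b = ∑' a, p a * ∑' b, f a b * g b := by
  simp only [PMF.bind_apply, ← ENNReal.tsum_mul_right, ← ENNReal.tsum_mul_left]
  rw [ENNReal.tsum_comm]
  simp only [mul_assoc]

theorem map_const_fun {α β : Type} (p : PMF α) (b : β) : p.map (fun _ => b) = PMF.pure b :=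
  PMF.map_const p b

/-! ### The texts drawn -/

theorem map_fst_drawTexts (D : TextModel) (k : ℕ) :
    (drawTexts D k).map (fun τ => τ.1) = D.dist k := by
  simp [drawTexts, PMF.map_bind, PMF.map_comp, Function.comp_def, PMF.bind_const, map_const_fun,
    PMF.bind_pure]

theorem map_fst_snd_drawTexts (D : TextModel) (k : ℕ) :
    (drawTexts D k).map (fun τ => τ.2.1) = D.dist 1 := by
  simp [drawTexts, PMF.map_bind, PMF.map_comp, Function.comp_def, PMF.bind_const, map_const_fun,
    PMF.bind_pure]

theorem map_snd_snd_drawTexts (D : TextModel) (k : ℕ) :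
    (drawTexts D k).map (fun τ => τ.2.2) = D.dist 1 := by
  simp only [drawTexts, PMF.map_bind, PMF.map_comp, Function.comp_def, PMF.bind_const]
  exact PMF.map_id _

theorem wires_of_mem_support (D : TextModel) (k : ℕ) : ∀ T ∈ (D.dist k).support, T.wires = k := by
  intro T hT
  simp only [TextModel.dist, PMF.mem_support_bind_iff, PMF.support_map, Set.mem_image] at hT
  obtain ⟨w, -, l, -, rfl⟩ := hT
  rfl

theorem dist_wires_ne (D : TextModel) (k : ℕ) : (D.dist k).toOuterMeasure {T | T.wires ≠ k} = 0 := by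
  rw [PMF.toOuterMeasure_apply_eq_zero_iff, Set.disjoint_left]
  exact fun T hT h => h (wires_of_mem_support D k T hT)

/-! ### Sizes of random texts -/

/-- A bound for the size of a text with `k` wires, `N` boxes and words of length `L`. -/
def textBound (N k L : ℕ) : ℕ := N * (4 * L + 2 * k ^ 2 + 4 * k + 9) + 2 * k + 3

theorem size_enc_box_le {k : ℕ} (b : Box k) (L : ℕ) (hL : b.word.bits.length ≤ L) :
    b.enc.size ≤ 4 * L + 2 * k ^ 2 + 4 * k + 8 := by
  have h1 : (Val.ofNatBin b.word).size ≤ 4 * L + 1 := by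
    have := Val.size_ofBits_le b.word.bits
    rw [Val.ofNatBin]
    omega
  have h2 : b.arity ≤ k := by simpa using Fintype.card_le_of_embedding b.inputs
  have h3 := Val.size_ofList_le_length (fun i => Val.ofNat (b.inputs i).val) (2 * k + 1)
    (List.finRange b.arity) fun i _ => by
      rw [Val.size_ofNat]
      have := (b.inputs i).2
      omega
  rw [List.length_finRange] at h3
  have h4 : b.arity * (2 * k + 1 + 1) ≤ k * (2 * k + 1 + 1) := Nat.mul_le_mul_right _ h2
  have h5 : k * (2 * k + 1 + 1) = 2 * k ^ 2 + 2 * k := by ring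
  simp only [Box.enc, Val.ofList, Val.size, Val.size_ofNat]
  omega

theorem size_enc_text_le (T : Text) (N L : ℕ) (hN : T.boxes.length ≤ N)
    (hL : ∀ b ∈ T.boxes, b.word.bits.length ≤ L) : T.enc.size ≤ textBound N T.wires L := by
  have h1 := Val.size_ofList_le_length Box.enc (4 * L + 2 * T.wires ^ 2 + 4 * T.wires + 8) T.boxes
    fun b hb => size_enc_box_le b L (hL b hb)
  have h2 := Nat.mul_le_mul_right (4 * L + 2 * T.wires ^ 2 + 4 * T.wires + 8 + 1) hN
  have e : 4 * L + 2 * T.wires ^ 2 + 4 * T.wires + 8 + 1 =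
    4 * L + 2 * T.wires ^ 2 + 4 * T.wires + 9 := by omega
  rw [e] at h1 h2
  simp only [Text.enc, Val.size, Val.size_ofNat, textBound]
  omega

theorem textBound_mono {N N' k k' L : ℕ} (hN : N ≤ N') (hk : k ≤ k') :
    textBound N k L ≤ textBound N' k' L := by
  unfold textBound
  gcongr

/-- Large texts are rare. -/
theorem dist_size_le (D : TextModel) {b : Polynomial ℕ}
    (hb : ∀ k, ∀ w ∈ (D.boxCount k).support, w ≤ b.eval k) (k L : ℕ) :
    (D.dist k).toOuterMeasure {T | ¬ T.enc.size ≤ textBound (b.eval k) k L} ≤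
      (b.eval k : ℕ) * D.words.toOuterMeasure {r | 2 ^ L ≤ r} := by
  rw [TextModel.dist]
  refine toOuterMeasure_bind_le_of_support _ _ _ _ fun w hw => ?_
  rw [PMF.toOuterMeasure_map_apply]
  have h1 := iid_exists_le (randomBox D.words D.arity k) {b | b.word ∈ {r | 2 ^ L ≤ r}} w
  rw [randomBox_word] at h1
  have h2 : (iid (randomBox D.words D.arity k) w).toOuterMeasure {l | l.length ≠ w} = 0 := by
    rw [PMF.toOuterMeasure_apply_eq_zero_iff, Set.disjoint_left]
    exact fun l hl h => h (length_of_mem_support_iid _ _ l hl)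
  -- The number of boxes is at most `b.eval k`, so a text is oversized only if one of its words has
  -- rank at least 2^L.
  refine le_trans (MeasureTheory.measure_mono (t := {l | l.length ≠ w} ∪
    {l | ∃ a ∈ l, a ∈ {b : Box k | b.word ∈ {r | 2 ^ L ≤ r}}}) ?_)
    ((MeasureTheory.measure_union_le _ _).trans ?_)
  · intro l hl
    by_contra h
    simp only [Set.mem_union, Set.mem_ofPred_eq, not_or, not_not, not_exists, not_and,
      not_le] at h
    refine hl (size_enc_text_le ⟨k, l⟩ _ L (h.1.le.trans (hb k w hw)) fun c hc => ?_)
    rw [Nat.size_eq_bits_len]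
    exact Nat.size_le.2 (h.2 c hc)
  · rw [h2, zero_add]
    refine h1.trans (mul_le_mul_left ?_ _)
    exact_mod_cast hb k w hw

/-- All three texts have bounded encodings. -/
def Sized (B : ℕ) (τ : Text × Text × Text) : Prop :=
  τ.1.enc.size ≤ B ∧ τ.2.1.enc.size ≤ B ∧ τ.2.2.enc.size ≤ B

/-- Union bound over the context and the two questions, which have at most `b.eval k` and twice
`b.eval 1` boxes. -/
theorem not_sized_le (D : TextModel) {b : Polynomial ℕ}
    (hb : ∀ k, ∀ w ∈ (D.boxCount k).support, w ≤ b.eval k) (k L B : ℕ)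
    (hB : textBound (b.eval k) k L ≤ B) (hB1 : textBound (b.eval 1) 1 L ≤ B) :
    (drawTexts D k).toOuterMeasure {τ | ¬ Sized B τ} ≤
      ((b.eval k + 2 * b.eval 1 : ℕ) : ℝ≥0∞) * D.words.toOuterMeasure {r | 2 ^ L ≤ r} := by
  have key : ∀ j, textBound (b.eval j) j L ≤ B → (D.dist j).toOuterMeasure
      {T | ¬ T.enc.size ≤ B} ≤ (b.eval j : ℕ) * D.words.toOuterMeasure {r | 2 ^ L ≤ r} :=
    fun j hj => by
      refine le_trans (MeasureTheory.measure_mono ?_) (dist_size_le D hb j L)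
      intro T (hT : ¬ T.enc.size ≤ B) h
      exact hT (le_trans h hj)
  have h1 := key k hB
  have h2 := key 1 hB1
  have h3 := h2
  rw [← map_fst_drawTexts D k, PMF.toOuterMeasure_map_apply] at h1
  rw [← map_fst_snd_drawTexts D k, PMF.toOuterMeasure_map_apply] at h2
  rw [← map_snd_snd_drawTexts D k, PMF.toOuterMeasure_map_apply] at h3
  have hsub : {τ : Text × Text × Text | ¬ Sized B τ} ⊆ ({τ | ¬ τ.1.enc.size ≤ B} ∪
      {τ | ¬ τ.2.1.enc.size ≤ B}) ∪ {τ | ¬ τ.2.2.enc.size ≤ B} := by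
    intro τ hτ
    by_contra h
    simp only [Set.mem_union, Set.mem_ofPred_eq, not_or, not_not] at h
    exact hτ ⟨h.1.1, h.1.2, h.2⟩
  refine (MeasureTheory.measure_mono hsub).trans ?_
  refine (MeasureTheory.measure_union_le _ _).trans ?_
  refine (add_le_add_left (MeasureTheory.measure_union_le _ _) _).trans ?_
  refine (add_le_add (add_le_add h1 h2) h3).trans (le_of_eq ?_)
  push_cast
  ring

/-! ### Texts on which a round votes correctly -/

/-- Texts that can be used for the circuit, with a correct answer of the oracle. -/
def Usable (L : GateLib) (ε : ℝ) (O : Val → ℕ) (k : ℕ) (τ : Text × Text × Text) : Prop :=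
  (∀ I : QAInstance, I.context = τ.1 → I.questions = [τ.2.1, τ.2.2] → I.IsAnswer L ε (O I.enc)) ∧
    GoodText τ.1 ∧ τ.1.wires = k ∧ τ.2.1.wires = 1 ∧ τ.2.2.wires = 1

/-- The oracle fails with probability at most δ and the context lacks a suitable box with
probability at most η. The numbers of wires are right almost surely; they are recorded so that the
instance can be formed. -/
theorem le_prob_usable (D : TextModel) (L : GateLib) (ε δ η : ℝ) (O : Val → ℕ) (k : ℕ) (hη : 0 ≤ η)
    (hO : SolvesOnAverage L D ε δ k O)
    (hg : (D.dist k).toOuterMeasure {T | ¬ GoodText T} ≤ ENNReal.ofReal η) :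
    1 - δ - η ≤ prob (drawTexts D k) {τ | Usable L ε O k τ} := by
  set Ω := drawTexts D k
  set S : Set (Text × Text × Text) := {τ | ∀ I : QAInstance, I.context = τ.1 →
    I.questions = [τ.2.1, τ.2.2] → I.IsAnswer L ε (O I.enc)} with hS
  have hg' : Ω.toOuterMeasure {τ | ¬ GoodText τ.1} ≤ ENNReal.ofReal η := by
    rw [← map_fst_drawTexts D k, PMF.toOuterMeasure_map_apply] at hg
    exact hg
  have w1 := dist_wires_ne D k
  have w2 := dist_wires_ne D 1
  have w3 := w2
  rw [← map_fst_drawTexts D k, PMF.toOuterMeasure_map_apply] at w1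
  rw [← map_fst_snd_drawTexts D k, PMF.toOuterMeasure_map_apply] at w2
  rw [← map_snd_snd_drawTexts D k, PMF.toOuterMeasure_map_apply] at w3
  set W : Set (Text × Text × Text) := ({τ | ¬ GoodText τ.1} ∪ {τ | τ.1.wires ≠ k}) ∪
    ({τ | τ.2.1.wires ≠ 1} ∪ {τ | τ.2.2.wires ≠ 1}) with hW
  have hWle : Ω.toOuterMeasure W ≤ ENNReal.ofReal η := by
    refine (MeasureTheory.measure_union_le _ _).trans ((add_le_add
      ((MeasureTheory.measure_union_le _ _).trans (add_le_add hg' w1.le))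
      ((MeasureTheory.measure_union_le _ _).trans (add_le_add w2.le w3.le))).trans ?_)
    simp
  have hWp : prob Ω W ≤ η := ENNReal.toReal_le_of_le_ofReal hη hWle
  have h1 : prob Ω S ≤ prob Ω {τ | Usable L ε O k τ} + prob Ω W := by
    refine (prob_mono Ω ?_).trans (prob_union_le Ω _ _)
    intro τ hτ
    by_contra h
    simp only [hW, Set.mem_union, Set.mem_ofPred_eq, not_or, not_not] at h
    exact h.1 ⟨hτ, h.2.1.1, h.2.1.2, h.2.2.1, h.2.2.2⟩
  have h2 : 1 - δ ≤ prob Ω S := hO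
  linarith

/-- Here the two halves meet: the search finds a box whose word is unique, so the query is the
instance whose overlaps are the outcome probabilities of the circuit. -/
theorem vote_of_usable {L : GateLib} {ε : ℝ} (hε : ε < 1 / 7) {O : Val → ℕ} {k : ℕ} (hk : 1 ≤ k)
    (C : QCircuit) {τ : Text × Text × Text} (h : Usable L ε O k τ) :
    (2 / 3 ≤ C.acceptProb L → Prog.vote O C.qubits (.ofList (C.gates.map Prog.splitGateEnc))
      τ.1 τ.2.1 τ.2.2 = 1) ∧
    (C.acceptProb L ≤ 1 / 3 → Prog.vote O C.qubits (.ofList (C.gates.map Prog.splitGateEnc))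
      τ.1 τ.2.1 τ.2.2 = -1) := by
  obtain ⟨⟨kT, bT⟩, ⟨k₁, q₁⟩, ⟨k₂, q₂⟩⟩ := τ
  obtain ⟨hans, hgood, hT, h₁, h₂⟩ := h
  dsimp only at hT h₁ h₂
  subst hT h₁ h₂
  obtain ⟨l₁, b, l₂, hsplit, hb, hl₁, hl₂, hbits⟩ : ∃ (l₁ : List (Box kT)) (b : Box kT)
      (l₂ : List (Box kT)), bT = l₁ ++ b :: l₂ ∧ IsCandidate b ∧ (∀ c ∈ l₁, c.word ≠ b.word) ∧
      (∀ c ∈ l₂, c.word ≠ b.word) ∧ bT.foldl longerWord [] = b.word.bits := hgood.split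
  have hI := hans (splitInstance C b.word ⟨kT, bT⟩ ⟨1, q₁⟩ ⟨1, q₂⟩ hk hk) rfl rfl
  have key : Prog.queryVal C.qubits (bT.foldl longerWord [])
      (.ofList (C.gates.map Prog.splitGateEnc)) (Text.enc ⟨kT, bT⟩) (Text.enc ⟨1, q₁⟩)
      (Text.enc ⟨1, q₂⟩) =
      (splitInstance C b.word ⟨kT, bT⟩ ⟨1, q₁⟩ ⟨1, q₂⟩ hk hk).enc := by
    rw [Prog.enc_splitInstance, hbits]
  subst hsplit
  obtain ⟨h1, h2⟩ := answer_of_isAnswer l₁ l₂ b hb hl₁ hl₂ q₁ q₂ hk hε hI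
  constructor
  · intro h
    rw [Prog.vote, key, if_neg (h1 h)]
  · intro h
    rw [Prog.vote, key, if_pos (h2 h)]

namespace Prog

/-! ### One round -/

def round : Cmd :=
  .seq (.assign 1 (.tl (.var 1))) (.seq (.sample 11 (.var 3)) (.seq (.sample 12 one)
    (.seq (.sample 13 one) decideRound)))

/-- Before another `R` rounds: the data that the rounds need, and the margin `d` so far. -/
def Ready (R q k : ℕ) (g : Val) (d : ℤ) (s : Store) : Prop :=
  s 1 = .ofNat R ∧ s 2 = .ofNat q ∧ s 3 = .ofNat k ∧ s 8 = g ∧ Margin d s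

/-- A bound for the time that one round takes. -/
def roundCost (B k q G : ℕ) : ℕ := B * (4 * B + 16) + 10 * B + 2 * q + G + 2 * k + 100

-- The success probability before a round is at least the average, over fresh texts, of a bound `v`
-- for the success probability after the resulting vote. Oversized texts contribute 0.
open Classical in
theorem round_success (D : TextModel) (O : Val → ℕ) (S : Set Val) (τ : ℕ) (rest : List Cmd)
    (B k q G R : ℕ) (g : Val) (hg : g.size ≤ G) (d : ℤ) (s : Store) (hs : Ready (R + 1) q k g d s)
    (v : ℤ → ℝ≥0∞)
    (h : ∀ e s', Ready R q k g (d + e) s' → v e ≤ success (textEnv D O) S τ (.loop (.var 1) round :: rest) s') :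
    ∑' x, drawTexts D k x * (if Sized B x then v (vote O q g x.1 x.2.1 x.2.2) else 0) ≤
      success (textEnv D O) S (τ + roundCost B k q G) (.loop (.var 1) round :: rest) s := by
  obtain ⟨h1, h2, h3, h8, hd⟩ := hs
  set E := textEnv D O with hE
  set C₀ := B * (4 * B + 16) + 7 * B + 2 * q + G + 70 with hC₀
  set lp : Cmd := .loop (.var 1) round with hlp
  set s₁ := Function.update s 1 (.ofNat R) with hs₁
  have hdec : ∀ T Q₁ Q₂ : Text, Sized B (T, Q₁, Q₂) → v (vote O q g T Q₁ Q₂) ≤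
      success E S (τ + C₀) (decideRound :: lp :: rest)
        (Function.update (Function.update (Function.update s₁ 11 T.enc) 12 Q₁.enc) 13 Q₂.enc) := by
    intro T Q₁ Q₂ hB
    set s₂ := Function.update (Function.update (Function.update s₁ 11 T.enc) 12 Q₁.enc) 13 Q₂.enc
      with hs₂
    have a2 : Agree {1, 11, 12, 13} s s₂ := (((Agree.update _ _ _).trans
      (Agree.update _ _ _)).trans ((Agree.update _ _ _).trans (Agree.update _ _ _))).mono
        (by decide)
    obtain ⟨s₃, e3, hd3, a3⟩ := decideRound_ensures E T Q₁ Q₂ B q G g hB.1 hB.2.1 hB.2.2 hg d s₂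
      (by rw [a2 2 (by decide), h2]) (by rw [a2 8 (by decide), h8])
      (by rwa [Margin, a2 9 (by decide), a2 10 (by decide)])
      (by simp [hs₂]) (by simp [hs₂]) (by simp [hs₂])
    refine (h _ s₃ ⟨?_, ?_, ?_, ?_, hd3⟩).trans (e3 S τ (lp :: rest))
    · rw [a3 1 (by decide)]
      simp [hs₂, hs₁]
    · rw [a3 2 (by decide), a2 2 (by decide), h2]
    · rw [a3 3 (by decide), a2 3 (by decide), h3]
    · rw [a3 8 (by decide), a2 8 (by decide), h8]
  -- The samples are peeled off from the last to the first. Drawing a text with one wire costs at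
  -- most 4 + B: one unit, 3 for the request, B for the text.
  have h13 : ∀ T Q₁ : Text, ∑' Q₂, D.dist 1 Q₂ * (if Sized B (T, Q₁, Q₂) then
      v (vote O q g T Q₁ Q₂) else 0) ≤
      success E S (τ + C₀ + (4 + B)) (.sample 13 one :: decideRound :: lp :: rest)
        (Function.update (Function.update s₁ 11 T.enc) 12 Q₁.enc) := by
    intro T Q₁
    refine le_trans ?_ (success_sample E S 13 one _ _ (τ + C₀) B)
    change _ ≤ ∑' y, (D.dist 1).map Text.enc y * _
    rw [tsum_map_mul]
    refine ENNReal.tsum_le_tsum fun Q₂ => mul_le_mul_right ?_ _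
    split_ifs with hB hB2
    · exact hdec T Q₁ Q₂ hB
    · exact absurd hB.2.2 hB2
    · exact zero_le
    · exact le_rfl
  have h12 : ∀ T : Text, ∑' Q₁, D.dist 1 Q₁ * ∑' Q₂, D.dist 1 Q₂ * (if Sized B (T, Q₁, Q₂) then
      v (vote O q g T Q₁ Q₂) else 0) ≤
      success E S (τ + C₀ + (4 + B) + 1 + (4 + B)) (.sample 12 one ::
        .seq (.sample 13 one) decideRound :: lp :: rest) (Function.update s₁ 11 T.enc) := by
    intro T
    refine le_trans ?_ (success_sample E S 12 one _ _ (τ + C₀ + (4 + B) + 1) B)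
    change _ ≤ ∑' y, (D.dist 1).map Text.enc y * _
    rw [tsum_map_mul]
    refine ENNReal.tsum_le_tsum fun Q₁ => mul_le_mul_right ?_ _
    split_ifs with hB
    · exact (h13 T Q₁).trans (success_of_step E S 0 _ rfl)
    · refine le_of_eq (ENNReal.tsum_eq_zero.2 fun Q₂ => ?_)
      rw [if_neg fun h => hB h.2.1, mul_zero]
  have hk : (Expr.var 3).eval s₁ = .ofNat k := by simp [Expr.eval, hs₁, h3]
  have h11 : ∑' T, D.dist k T * ∑' Q₁, D.dist 1 Q₁ * ∑' Q₂, D.dist 1 Q₂ *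
      (if Sized B (T, Q₁, Q₂) then v (vote O q g T Q₁ Q₂) else 0) ≤
      success E S (τ + C₀ + (4 + B) + 1 + (4 + B) + 1 + (1 + (2 * k + 1) + B)) (.sample 11 (.var 3) ::
        .seq (.sample 12 one) (.seq (.sample 13 one) decideRound) :: lp :: rest) s₁ := by
    have hsm := success_sample E S 11 (.var 3) (.seq (.sample 12 one)
      (.seq (.sample 13 one) decideRound) :: lp :: rest) s₁ (τ + C₀ + (4 + B) + 1 + (4 + B) + 1) B
    rw [hk, Val.size_ofNat, Val.toNat_ofNat] at hsm
    refine le_trans ?_ hsm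
    change _ ≤ ∑' y, (D.dist k).map Text.enc y * _
    rw [tsum_map_mul]
    refine ENNReal.tsum_le_tsum fun T => mul_le_mul_right ?_ _
    split_ifs with hB
    · exact (h12 T).trans (success_of_step E S 0 _ rfl)
    · refine le_of_eq (ENNReal.tsum_eq_zero.2 fun Q₁ => ?_)
      rw [ENNReal.tsum_eq_zero.2 fun Q₂ => by rw [if_neg fun h => hB h.1, mul_zero], mul_zero]
  have hsum : ∑' x, drawTexts D k x *
      (if Sized B x then v (vote O q g x.1 x.2.1 x.2.2) else 0) =
      ∑' T, D.dist k T * ∑' Q₁, D.dist 1 Q₁ * ∑' Q₂, D.dist 1 Q₂ *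
      (if Sized B (T, Q₁, Q₂) then v (vote O q g T Q₁ Q₂) else 0) := by
    rw [drawTexts, tsum_bind_mul]
    refine tsum_congr fun T => ?_
    rw [tsum_bind_mul]
    congr 1
    refine tsum_congr fun Q₁ => ?_
    rw [tsum_map_mul]
  rw [hsum]
  refine h11.trans ?_
  have e1 : Ensures E (.assign 1 (.tl (.var 1))) s s₁ 1 := by
    have := Ensures.assign (E := E) (s := s) 1 (.tl (.var 1))
    rwa [Expr.eval, Expr.eval, h1] at this
  refine (success_of_step (s := s₁) (l := .seq (.sample 11 (.var 3)) (.seq (.sample 12 one)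
    (.seq (.sample 13 one) decideRound)) :: lp :: rest) E S 0 _ rfl).trans ((e1 S _ _).trans
    ((success_of_step (s := s) (l := round :: lp :: rest) E S 0 _ rfl).trans
    ((success_of_step (s := s) (l := lp :: rest) E S 0 _ ?_).trans (success_mono E S ?_ _ _))))
  · rw [hlp, step, if_neg]
    rw [Expr.eval, h1, Val.isNil_ofNat]
    simp
  · rw [roundCost, hC₀]
    omega

/-! ### The vote -/

def finish : List Cmd := [.loop (.var 1) round, .assign 0 (.var 9)]

/-- The margin in the right direction is positive, up to an exponentially small probability. -/
theorem votes_success (D : TextModel) (O : Val → ℕ) (S : Set Val) (B k q G : ℕ) (g : Val)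
    (hg : g.size ≤ G) (σ : ℤ) (hσ : σ = 1 ∨ σ = -1)
    (hS : ∀ (d : ℤ), 0 < σ * d → Val.ofNat d.toNat ∈ S) (p z β : ℝ) (hp : 0 ≤ p) (hz : 1 < z)
    (hβ : 0 ≤ β)
    (hgood : 1 - p ≤ prob (drawTexts D k) {x | vote O q g x.1 x.2.1 x.2.2 = σ})
    (hsize : prob (drawTexts D k) {x | ¬ Sized B x} ≤ β) (R : ℕ) (d : ℤ) (s : Store)
    (hs : Ready R q k g d s) :
    ENNReal.ofReal (1 - ((1 - p) / z + p * z) ^ R * z ^ (-(σ * d)) - R * β) ≤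
      success (textEnv D O) S (R * roundCost B k q G + 2) finish s := by
  classical
  -- The exponential moment method: z^(−σd) is divided by z by a correct vote and multiplied by z by
  -- a wrong one, so a round multiplies its mean by at most ρ. The failure probability is bounded by
  -- this potential, plus β per round for oversized texts.
  set ρ := (1 - p) / z + p * z with hρ
  have hz0 : 0 < z := by linarith
  induction R generalizing d s with
  | zero =>
    by_cases hd : 0 < σ * d
    · obtain ⟨h1, -, -, -, h9, -⟩ := hs
      have e1 : Ensures (textEnv D O) (.loop (.var 1) round) s s 1 :=
        Ensures.loop_nil (by rw [Expr.eval, h1]; rfl)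
      have e2 := Ensures.assign (E := textEnv D O) (s := s) 0 (.var 9)
      have h : (1 : ℝ≥0∞) ≤ success (textEnv D O) S (0 * roundCost B k q G + 2) finish s := by
        have h3 := (e2 S 0 []).trans (e1 S (0 + 1) _)
        rw [success_nil] at h3
        · simpa [finish] using h3
        · rw [Function.update_self, Expr.eval, h9]
          exact hS d hd
      refine le_trans ?_ h
      rw [← ENNReal.ofReal_one]
      refine ENNReal.ofReal_le_ofReal ?_
      have : 0 < z ^ (-(σ * d)) := by positivity
      rw [Nat.cast_zero, pow_zero, one_mul, zero_mul, sub_zero]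
      linarith
    -- With a margin that is not in the right direction the potential is at least 1, and the claim
    -- is empty.
    · rw [ENNReal.ofReal_of_nonpos]
      · exact zero_le
      · have : 1 ≤ z ^ (-(σ * d)) := one_le_zpow₀ hz.le (by omega)
        rw [Nat.cast_zero, pow_zero, one_mul, zero_mul, sub_zero]
        linarith
  | succ R ih =>
    set u : ℤ → ℝ := fun d => 1 - ρ ^ R * z ^ (-(σ * d)) - R * β with hu
    have h1 := round_success D O S (R * roundCost B k q G + 2) [.assign 0 (.var 9)] B k q G R g hg d
      s hs (fun e => ENNReal.ofReal (u (d + e))) fun e s' hs' => ih (d + e) s' hs'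
    have e1 : R * roundCost B k q G + 2 + roundCost B k q G =
        (R + 1) * roundCost B k q G + 2 := by ring
    rw [e1] at h1
    refine le_trans ?_ h1
    set Ω := drawTexts D k
    set X₁ : Set (Text × Text × Text) := {x | Sized B x ∧ vote O q g x.1 x.2.1 x.2.2 = σ} with hX₁
    set X₂ : Set (Text × Text × Text) := {x | Sized B x ∧ vote O q g x.1 x.2.1 x.2.2 ≠ σ} with hX₂
    have hvote : ∀ x : Text × Text × Text, vote O q g x.1 x.2.1 x.2.2 ≠ σ →
        vote O q g x.1 x.2.1 x.2.2 = -σ := by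
      intro x hx
      rw [vote] at hx ⊢
      rcases hσ with rfl | rfl <;> split_ifs at hx ⊢ <;> simp_all
    have hσn : -σ ≠ σ := by omega
    have hsum : ∑' x, Ω x * (if Sized B x then
        ENNReal.ofReal (u (d + vote O q g x.1 x.2.1 x.2.2)) else 0) =
        Ω.toOuterMeasure X₁ * ENNReal.ofReal (u (d + σ)) +
          Ω.toOuterMeasure X₂ * ENNReal.ofReal (u (d + -σ)) := by
      rw [PMF.toOuterMeasure_apply, PMF.toOuterMeasure_apply, ← ENNReal.tsum_mul_right,
        ← ENNReal.tsum_mul_right, ← ENNReal.tsum_add]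
      refine tsum_congr fun x => ?_
      by_cases hx : Sized B x
      · by_cases hv : vote O q g x.1 x.2.1 x.2.2 = σ
        · simp [hX₁, hX₂, hx, hv]
        · simp [hX₁, hX₂, hx, hvote x hv, hσn]
      · simp [hX₁, hX₂, hx]
    rw [hsum, ← ofReal_prob, ← ofReal_prob, ← ENNReal.ofReal_mul (prob_nonneg _ _),
      ← ENNReal.ofReal_mul (prob_nonneg _ _)]
    -- The values of `u` may be negative; truncation at 0 only enlarges the right-hand side.
    refine le_trans (ENNReal.ofReal_le_ofReal ?_) ENNReal.ofReal_add_le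
    have hP₂ : prob Ω X₂ ≤ p := by
      have h2 := prob_add_compl Ω {x | vote O q g x.1 x.2.1 x.2.2 = σ}
      have h3 : prob Ω X₂ ≤ prob Ω {x | vote O q g x.1 x.2.1 x.2.2 = σ}ᶜ :=
        prob_mono Ω fun x hx => hx.2
      linarith
    have hge : 1 - β ≤ prob Ω X₁ + prob Ω X₂ := by
      have h2 := prob_add_compl Ω {x | ¬ Sized B x}
      have h3 : prob Ω {x | ¬ Sized B x}ᶜ ≤ prob Ω (X₁ ∪ X₂) := by
        refine prob_mono Ω fun x hx => ?_
        have hx : Sized B x := not_not.1 hx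
        by_cases hv : vote O q g x.1 x.2.1 x.2.2 = σ
        · exact Or.inl ⟨hx, hv⟩
        · exact Or.inr ⟨hx, hv⟩
      have h4 := prob_union_le Ω X₁ X₂
      linarith
    have hle : prob Ω X₁ + prob Ω X₂ ≤ 1 := by
      have h2 := prob_add_compl Ω {x | vote O q g x.1 x.2.1 x.2.2 = σ}
      have h3 : prob Ω X₂ ≤ prob Ω {x | vote O q g x.1 x.2.1 x.2.2 = σ}ᶜ :=
        prob_mono Ω fun x hx => hx.2
      have h4 : prob Ω X₁ ≤ prob Ω {x | vote O q g x.1 x.2.1 x.2.2 = σ} :=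
        prob_mono Ω fun x hx => hx.2
      linarith
    have hσσ : σ * σ = 1 := by rcases hσ with rfl | rfl <;> norm_num
    have z1 : z ^ (-(σ * (d + σ))) = z ^ (-(σ * d)) * z⁻¹ := by
      rw [mul_add, hσσ, neg_add, zpow_add₀ hz0.ne', zpow_neg_one]
    have z2 : z ^ (-(σ * (d + -σ))) = z ^ (-(σ * d)) * z := by
      rw [mul_add, mul_neg, hσσ, neg_add, neg_neg, zpow_add₀ hz0.ne', zpow_one]
    have hY : 0 ≤ ρ ^ R * z ^ (-(σ * d)) := by
      by_cases hp1 : p ≤ 1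
      · have : 0 ≤ ρ := add_nonneg (div_nonneg (by linarith) hz0.le) (by positivity)
        positivity
      · have : 0 ≤ ρ := by
          have : ρ = z⁻¹ + p * (z - z⁻¹) := by rw [hρ]; ring
          rw [this]
          have : z⁻¹ ≤ z := (inv_le_one_of_one_le₀ hz.le).trans hz.le
          have : 0 ≤ p * (z - z⁻¹) := mul_nonneg hp (by linarith)
          positivity
        positivity
    -- As a function of the error probability, ρ is z⁻¹ + p (z − z⁻¹), which is increasing because z
    -- > 1.
    have hmix : prob Ω X₁ * z⁻¹ + prob Ω X₂ * z ≤ ρ := by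
      have hzz : z⁻¹ ≤ z := (inv_le_one_of_one_le₀ hz.le).trans hz.le
      have hzi : 0 < z⁻¹ := by positivity
      have : ρ = z⁻¹ + p * (z - z⁻¹) := by rw [hρ]; ring
      rw [this]
      nlinarith [mul_le_mul_of_nonneg_right hP₂ (sub_nonneg.2 hzz)]
    have hfin := mul_le_mul_of_nonneg_left hmix hY
    have hR : 0 ≤ (R : ℝ) * β := by positivity
    simp only [hu, z1, z2]
    rw [pow_succ]
    push_cast
    nlinarith [mul_nonneg hR (sub_nonneg.2 hle)]

end Prog

end QDisCo

end

noncomputable section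

namespace QDisCo

open scoped ENNReal

namespace Prog

/-! ### The whole program -/

/-- Initialize the number of rounds, of wires, and the circuit of the box. -/
def setup (a K : ℕ) : Cmd :=
  .seq (.assign 1 (addNat a .nil)) (.seq (.assign 20 (.hd (.var 0)))
    (.seq (forEach 20 21 (.assign 1 (addNat a (.var 1)))) (.seq (.assign 2 (.hd (.tl (.var 0))))
      (.seq (.assign 3 (addNat K (.var 2))) (.seq (.assign 4 (.tl (.tl (.var 0))))
        (.seq (.assign 6 .nil) (.seq (forEach 4 5 (.seq (.assign 3 (.cons .nil (.var 3))) splitGate))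
          (.seq (.assign 8 .nil) (.seq (forEach 6 23 (.assign 8 (.cons (.var 23) (.var 8))))
            (.seq (.assign 9 .nil) (.assign 10 .nil)))))))))))

theorem foldl_cons {α : Type} (l acc : List α) :
    l.foldl (fun acc a => a :: acc) acc = l.reverse ++ acc := by
  induction l generalizing acc with
  | nil => rfl
  | cons a l ih => simp [ih]

theorem setup_ensures (E : Env) (a K r : ℕ) (C : QCircuit) (s : Store)
    (hs : s 0 = withParam r C.enc) : ∃ s',
      Ensures E (setup a K) s s' (6 * r + 22 * C.gates.length + 40) ∧
      Ready (a * (r + 1)) C.qubits (C.gates.length + C.qubits + K)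
        (.ofList (C.gates.map splitGateEnc)) 0 s' := by
  have e1 := Ensures.assign (E := E) (s := s) 1 (addNat a .nil)
  set s₁ := Function.update s 1 ((addNat a .nil).eval s) with hs₁
  have e2 := Ensures.assign (E := E) (s := s₁) 20 (.hd (.var 0))
  set s₂ := Function.update s₁ 20 ((Expr.hd (.var 0)).eval s₁) with hs₂
  have h20 : s₂ 20 = .ofNat r := by simp [hs₂, hs₁, Expr.eval, hs, withParam, Val.hd]
  have h21 : s₂ 1 = .ofNat a := by
    have := eval_addNat a .nil s 0 rfl
    rw [zero_add] at this
    simp [hs₂, hs₁, this]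
  obtain ⟨s₃, e3, h31, a3⟩ := forEach_ensures (E := E)
    (fun n s' => s' 1 = .ofNat n ∧ Agree {1, 20, 21} s s') (fun n (_ : Unit) => n + a)
    (fun _ => Val.nil) (l := 20) (h := 21) (by decide) (.assign 1 (addNat a (.var 1))) 1
    (fun n s' u v h => ⟨by simpa using h.1, (h.2.trans ((Agree.update _ _ _).trans
      (Agree.update _ _ _))).mono (by decide)⟩) (List.replicate r ())
    (by
      intro n s' _ _ h _
      refine ⟨_, Ensures.assign _ _, ⟨?_, (h.2.trans (Agree.update _ _ _)).mono (by decide)⟩,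
        Function.update_of_ne (by decide) _ _⟩
      rw [Function.update_self]
      exact eval_addNat a _ s' n h.1)
    a s₂ ⟨h21, ((Agree.update _ _ _).trans (Agree.update _ _ _)).mono (by decide)⟩
    (by rw [h20, Val.ofNat_eq_ofList])
  have h31' : s₃ 1 = .ofNat (a * (r + 1)) := by
    rw [h31]
    congr 1
    have : ∀ j n : ℕ, (List.replicate j ()).foldl (fun n _ => n + a) n = n + a * j := by
      intro j
      induction j with
      | zero => simp
      | succ j ih =>
        intro n
        rw [List.replicate_succ, List.foldl_cons, ih]
        ring
    rw [this]
    ring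
  have h30 : s₃ 0 = withParam r C.enc := by rw [a3 0 (by decide), hs]
  have e4 := Ensures.assign (E := E) (s := s₃) 2 (.hd (.tl (.var 0)))
  set s₄ := Function.update s₃ 2 ((Expr.hd (.tl (.var 0))).eval s₃) with hs₄
  have h42 : s₄ 2 = .ofNat C.qubits := by
    simp [hs₄, Expr.eval, h30, withParam, QCircuit.enc, Val.hd, Val.tl]
  have e5 := Ensures.assign (E := E) (s := s₄) 3 (addNat K (.var 2))
  set s₅ := Function.update s₄ 3 ((addNat K (.var 2)).eval s₄) with hs₅
  have h53 : s₅ 3 = .ofNat (C.qubits + K) := by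
    rw [hs₅, Function.update_self]
    exact eval_addNat K _ s₄ _ h42
  have e6 := Ensures.assign (E := E) (s := s₅) 4 (.tl (.tl (.var 0)))
  set s₆ := Function.update s₅ 4 ((Expr.tl (.tl (.var 0))).eval s₅) with hs₆
  have h64 : s₆ 4 = .ofList (C.gates.map (Gate.enc fun i => .ofNat i.val)) := by
    simp [hs₆, hs₅, hs₄, Expr.eval, h30, withParam, QCircuit.enc, Val.tl]
  have e7 := Ensures.assign (E := E) (s := s₆) 6 .nil
  set s₇ := Function.update s₆ 6 (Expr.nil.eval s₆) with hs₇
  have h71 : s₇ 1 = .ofNat (a * (r + 1)) := by simp [hs₇, hs₆, hs₅, hs₄, h31']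
  have h72 : s₇ 2 = .ofNat C.qubits := by simp [hs₇, hs₆, hs₅, h42]
  have h73 : s₇ 3 = .ofNat (C.qubits + K) := by simp [hs₇, hs₆, h53]
  have h74 : s₇ 4 = .ofList (C.gates.map (Gate.enc fun i => .ofNat i.val)) := by simp [hs₇, h64]
  -- One pass translates the gates and adds their number to the wires in variable 3. It leaves the
  -- list reversed, and the next loop restores the order.
  obtain ⟨s₈, e8, h86, h83, h81, h82⟩ := forEach_ensures (E := E)
    (fun (acc : List (Gate (Fin C.qubits))) s' => s' 6 = .ofList (acc.map splitGateEnc) ∧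
      s' 3 = .ofNat (acc.length + C.qubits + K) ∧ s' 1 = .ofNat (a * (r + 1)) ∧
      s' 2 = .ofNat C.qubits)
    (fun acc g => g :: acc) (Gate.enc fun i => .ofNat i.val) (l := 4) (h := 5) (by decide)
    (.seq (.assign 3 (.cons .nil (.var 3))) splitGate) 11
    (fun acc s' u v h => by simpa using h) C.gates
    (by
      intro acc s' g _ h h5
      have f1 := Ensures.assign (E := E) (s := s') 3 (.cons .nil (.var 3))
      obtain ⟨s'', f2, h6, a6⟩ := splitGate_ensures E g (Function.update s' 3
        ((Expr.cons .nil (.var 3)).eval s')) (by simpa using h5)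
      refine ⟨s'', (f1.seq f2).mono le_rfl, ⟨?_, ?_, ?_, ?_⟩, ?_⟩
      · rw [h6, Function.update_of_ne (by decide), h.1]
        rfl
      · rw [a6 3 (by decide), Function.update_self, Expr.eval, Expr.eval, Expr.eval, h.2.1]
        have : (g :: acc).length + C.qubits + K = acc.length + C.qubits + K + 1 := by
          rw [List.length_cons]
          omega
        rw [this]
        rfl
      · rw [a6 1 (by decide), Function.update_of_ne (by decide), h.2.2.1]
      · rw [a6 2 (by decide), Function.update_of_ne (by decide), h.2.2.2]
      · rw [a6 4 (by decide), Function.update_of_ne (by decide)])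
    [] s₇ ⟨by simp [hs₇, Expr.eval, Val.ofList], by simpa using h73, h71, h72⟩ h74
  rw [foldl_cons, List.append_nil] at h86 h83
  have e9 := Ensures.assign (E := E) (s := s₈) 8 .nil
  set s₉ := Function.update s₈ 8 (Expr.nil.eval s₈) with hs₉
  have a9 : Agree {8} s₈ s₉ := Agree.update _ _ _
  obtain ⟨s₁₀, e10, h108, a10⟩ := forEach_ensures (E := E)
    (fun (acc : List (Gate (Fin C.qubits))) s' => s' 8 = .ofList (acc.map splitGateEnc) ∧
      Agree {6, 8, 23} s₈ s')
    (fun acc g => g :: acc) splitGateEnc (l := 6) (h := 23) (by decide)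
    (.assign 8 (.cons (.var 23) (.var 8))) 1
    (fun acc s' u v h => ⟨by simpa using h.1, (h.2.trans ((Agree.update _ _ _).trans
      (Agree.update _ _ _))).mono (by decide)⟩) C.gates.reverse
    (by
      intro acc s' g _ h h23
      refine ⟨_, Ensures.assign _ _, ⟨?_, (h.2.trans (Agree.update _ _ _)).mono (by decide)⟩,
        Function.update_of_ne (by decide) _ _⟩
      rw [Function.update_self, Expr.eval, Expr.eval, Expr.eval, h23, h.1]
      rfl)
    [] s₉ ⟨by simp [hs₉, Expr.eval, Val.ofList], a9.mono (by decide)⟩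
    (by rw [a9 6 (by decide), h86])
  rw [foldl_cons, List.append_nil, List.reverse_reverse] at h108
  have e11 := Ensures.assign (E := E) (s := s₁₀) 9 .nil
  set s₁₁ := Function.update s₁₀ 9 (Expr.nil.eval s₁₀) with hs₁₁
  have e12 := Ensures.assign (E := E) (s := s₁₁) 10 .nil
  set s₁₂ := Function.update s₁₁ 10 (Expr.nil.eval s₁₁) with hs₁₂
  have a12 : Agree {6, 8, 9, 10, 23} s₈ s₁₂ := ((a10.trans (Agree.update _ _ _)).trans
    (Agree.update _ _ _)).mono (by decide)
  have c9 := e9.seq (e10.seq (e11.seq e12))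
  have c5 := e5.seq (e6.seq (e7.seq (e8.seq c9)))
  have c1 := e1.seq (e2.seq (e3.seq (e4.seq c5)))
  unfold setup
  refine ⟨s₁₂, ?_, ?_⟩
  · refine c1.mono ?_
    simp only [List.length_replicate, List.length_reverse]
    omega
  refine ⟨?_, ?_, ?_, ?_, ?_, ?_⟩
  · rw [a12 1 (by decide), h81]
  · rw [a12 2 (by decide), h82]
  · rw [a12 3 (by decide), h83, List.length_reverse]
  · simp [hs₁₂, hs₁₁, h108]
  · simp [hs₁₂, hs₁₁, Expr.eval]
    rfl
  · simp [hs₁₂, Expr.eval]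
    rfl

/-- The algorithm: the majority vote of `a` rounds for every unit of the parameter, each of them
with texts that have `K` wires more than the circuit has gates and qubits. -/
def decideCircuit (a K : ℕ) : Cmd :=
  .seq (setup a K) (.seq (.loop (.var 1) round) (.assign 0 (.var 9)))

end Prog

end QDisCo

end

noncomputable section

namespace QDisCo

open scoped ENNReal

/-! ### Error and running time of the algorithm on a circuit -/

theorem eval_mono_nat (b : Polynomial ℕ) {m n : ℕ} (h : m ≤ n) : b.eval m ≤ b.eval n := by
  rw [Polynomial.eval_eq_sum, Polynomial.eval_eq_sum, Polynomial.sum, Polynomial.sum]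
  gcongr

namespace Prog

theorem size_splitGateEnc_le {n : ℕ} (g : Gate (Fin n)) :
    (splitGateEnc g).size ≤ 9 * (g.enc fun i => Val.ofNat i.val).size := by
  have h : ∀ i : Fin n, (Val.cons (.ofNat (if i.val = 0 then 0 else 1)) (.ofNat i.val)).size ≤
      2 * i.val + 5 := by
    intro i
    rw [Val.size, Val.size_ofNat, Val.size_ofNat]
    split_ifs <;> omega
  cases g with
  | not i =>
    have := h i
    simp only [splitGateEnc, Gate.enc, Val.ofList, Val.size, Val.size_ofNat] at this ⊢
    omega
  | one w i =>
    have := h i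
    simp only [splitGateEnc, Gate.enc, Val.ofList, Val.size, Val.size_ofNat] at this ⊢
    omega
  | two w p =>
    have h0 := h (p 0)
    have h1 := h (p 1)
    simp only [splitGateEnc, Gate.enc, Val.ofList, Val.size, Val.size_ofNat] at h0 h1 ⊢
    omega

theorem roundCost_mono {B B' k k' q q' G G' : ℕ} (hB : B ≤ B') (hk : k ≤ k') (hq : q ≤ q')
    (hG : G ≤ G') : roundCost B k q G ≤ roundCost B' k' q' G' := by
  unfold roundCost
  gcongr

end Prog

/-- The claim amounts to (z − 1)(p z − (1 − p)) < 0. For z = 3/2 − p the second factor is −(1/2 −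
p)(2 − p). Unlike the optimal √((1 − p)/p), this choice also covers p = 0. -/
theorem amplification_base {p : ℝ} (hp0 : 0 ≤ p) (hp : p < 1 / 2) :
    ∃ z : ℝ, 1 < z ∧ 0 ≤ (1 - p) / z + p * z ∧ (1 - p) / z + p * z < 1 := by
  refine ⟨1 + (1 / 2 - p), by linarith, ?_, ?_⟩
  · exact add_nonneg (div_nonneg (by linarith) (by linarith)) (mul_nonneg hp0 (by linarith))
  · rw [← lt_sub_iff_add_lt, div_lt_iff₀ (by linarith)]
    have h : 0 < (1 / 2 - p) * ((1 / 2 - p) * (2 - p)) :=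
      mul_pos (by linarith) (mul_pos (by linarith) (by linarith))
    linear_combination h

/-- The error that is due to large texts. -/
theorem oversize_le (A N c r M : ℕ) (hM : A + N + c + (r + 1) ≤ M) :
    (A : ℝ) * (N * (c * (1 / 2 : ℝ) ^ M)) ≤ (1 / 2) ^ (r + 1) := by
  -- Each of the three factors is absorbed by its own share of the exponent M.
  have h1 : ∀ n : ℕ, (n : ℝ) ≤ 2 ^ n := fun n => by exact_mod_cast Nat.lt_two_pow_self.le
  have h2 : (1 / 2 : ℝ) ^ M ≤ (1 / 2) ^ (A + N + c + (r + 1)) :=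
    pow_le_pow_of_le_one (by norm_num) (by norm_num) hM
  calc (A : ℝ) * (N * (c * (1 / 2 : ℝ) ^ M))
      ≤ 2 ^ A * (2 ^ N * (2 ^ c * (1 / 2) ^ (A + N + c + (r + 1)))) := by
        gcongr
        · exact h1 A
        · exact h1 N
        · exact h1 c
    _ = (1 / 2) ^ (r + 1) := by
        rw [pow_add, pow_add, pow_add]
        have h3 : ∀ n : ℕ, (2 : ℝ) ^ n * (1 / 2) ^ n = 1 := fun n => by
          rw [← mul_pow]
          norm_num
        calc _ = (2 ^ A * (1 / 2 : ℝ) ^ A) * (2 ^ N * (1 / 2 : ℝ) ^ N) *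
              (2 ^ c * (1 / 2 : ℝ) ^ c) * (1 / 2) ^ (r + 1) := by ring
          _ = _ := by rw [h3, h3, h3]; ring

theorem success_seq_seq {E : Env} {a : Cmd} {s s' : Store} {n : ℕ} (h : Ensures E a s s' n)
    (S : Set Val) (b c : Cmd) (τ : ℕ) :
    success E S τ [b, c] s' ≤ success E S (τ + n + 2) [.seq a (.seq b c)] s := by
  have h1 : success E S τ [b, c] s' ≤ success E S (τ + 1) [.seq b c] s' :=
    success_of_step E S 0 τ rfl
  have h2 : success E S (τ + 1 + n) [a, .seq b c] s ≤
      success E S (τ + 1 + n + 1) [.seq a (.seq b c)] s := success_of_step E S 0 _ rfl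
  exact (h1.trans ((h S (τ + 1) _).trans h2)).trans (success_mono E S (by omega) _ _)

/-- The algorithm decides, for any circuit, whether it accepts. -/
theorem decideCircuit_success (D : TextModel) {δ : ℝ} (hδ₀ : 0 ≤ δ) (hδ : δ < 1 / 2) :
    ∃ (a K : ℕ) (t : Polynomial ℕ), ∀ (L : GateLib) (ε : ℝ), ε < 1 / 7 →
      ∀ (C : QCircuit) (O : Val → ℕ),
        SolvesOnAverage L D ε δ (C.gates.length + C.qubits + K) O →
        ∀ (r : ℕ) (s : Store), s 0 = withParam r C.enc →
          (2 / 3 ≤ C.acceptProb L → ENNReal.ofReal (1 - (1 / 2) ^ r) ≤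
            success (textEnv D O) accepting (t.eval (C.enc.size + r)) [Prog.decideCircuit a K] s) ∧
          (C.acceptProb L ≤ 1 / 3 → ENNReal.ofReal (1 - (1 / 2) ^ r) ≤
            success (textEnv D O) rejecting (t.eval (C.enc.size + r))
              [Prog.decideCircuit a K] s) := by
  -- Half of the distance from δ to 1/2 goes to texts without a suitable box, so the error p of a
  -- round stays below 1/2.
  set η : ℝ := (1 / 2 - δ) / 2 with hη
  set p : ℝ := δ + η with hp
  have hη0 : 0 < η := by rw [hη]; linarith
  have hp0 : 0 ≤ p := by linarith
  have hp2 : p < 1 / 2 := by rw [hp, hη]; linarith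
  obtain ⟨K, hK2, hgood⟩ := exists_good_text D hη0
  obtain ⟨z, hz, hρ0, hρ1⟩ := amplification_base hp0 hp2
  -- With a (r + 1) rounds the vote fails with probability at most (1/4)^(r+1), well below half of
  -- the permitted error.
  obtain ⟨a, ha⟩ := exists_pow_lt_of_lt_one (by norm_num : (0 : ℝ) < 1 / 4) hρ1
  set ρ : ℝ := (1 - p) / z + p * z with hρ
  obtain ⟨c, e, hc, he, hw⟩ := D.zipf.exponent
  obtain ⟨C₀, τ, hC₀, hτ, hlong⟩ := long_word_le hc he hw
  have hbase : (2 : ℝ) ^ (-τ) < 1 :=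
    Real.rpow_lt_one_of_one_lt_of_neg (by norm_num) (by linarith)
  -- A word needs more than h M bits with probability at most C₀ 2^(−M).
  obtain ⟨h, hh⟩ := exists_pow_lt_of_lt_one (by norm_num : (0 : ℝ) < 1 / 2) hbase
  obtain ⟨b, hb⟩ := D.poly_boxes
  set c₁ : ℕ := ⌈C₀⌉₊ with hc₁
  -- M is the sum of bounds for the number of rounds, the number of boxes, the constant and r + 1,
  -- as `oversize_le` wants it: the other half of the permitted error covers oversized texts in all
  -- rounds.
  set Mp : Polynomial ℕ := .C a * (.X + 1) + (b.comp (.X + .C K) + .C (2 * b.eval 1)) + .C c₁ +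
    (.X + 1) with hMp
  set Bp : Polynomial ℕ := (b.comp (.X + .C K) + .C (b.eval 1)) *
    (4 * (.C h * Mp) + 2 * (.X + .C K + 1) ^ 2 + 4 * (.X + .C K + 1) + 9) +
      2 * (.X + .C K + 1) + 3 with hBp
  set cp : Polynomial ℕ := Bp * (4 * Bp + 16) + 10 * Bp + 2 * .X + 9 * .X + 2 * (.X + .C K) + 100
    with hcp
  refine ⟨a, K, .C a * (.X + 1) * cp + 28 * .X + 50, fun L ε hε C O hO r s hs => ?_⟩
  set x := C.enc.size + r with hx
  set k := C.gates.length + C.qubits + K with hk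
  set g := Val.ofList (C.gates.map Prog.splitGateEnc) with hg
  have hsize : C.gates.length + C.qubits ≤ C.enc.size := by
    have := Val.length_le_size_ofList (Gate.enc fun i : Fin C.qubits => .ofNat i.val) C.gates
    rw [QCircuit.enc, Val.size, Val.size_ofNat]
    omega
  have hkx : k ≤ x + K := by omega
  have hG : g.size ≤ 9 * x := by
    have h1 := Val.size_ofList_le_mul (Gate.enc fun i : Fin C.qubits => .ofNat i.val)
      Prog.splitGateEnc 9 (by norm_num) C.gates fun g _ => Prog.size_splitGateEnc_le g
    have h2 : (Val.ofList (C.gates.map (Gate.enc fun i => .ofNat i.val))).size ≤ C.enc.size := by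
      rw [QCircuit.enc, Val.size]
      omega
    rw [hg]
    omega
  have hbk : b.eval k ≤ b.eval (x + K) := eval_mono_nat b hkx
  set M := Mp.eval x with hM
  have hMe : M = a * (x + 1) + (b.eval (x + K) + 2 * b.eval 1) + c₁ + (x + 1) := by
    simp [hM, hMp]
  set B := Bp.eval x with hB
  have hBe : B = textBound (b.eval (x + K) + b.eval 1) (x + K + 1) (h * M) := by
    simp [hB, hBp, textBound, hM]
  set R := a * (r + 1) with hR
  -- the error due to large texts
  set β : ℝ := ((b.eval k + 2 * b.eval 1 : ℕ) : ℝ) * (c₁ * (1 / 2 : ℝ) ^ M) with hβ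
  have hβ0 : 0 ≤ β := by positivity
  have hsized : prob (drawTexts D k) {τ | ¬ Sized B τ} ≤ β := by
    refine ENNReal.toReal_le_of_le_ofReal hβ0 ?_
    refine (not_sized_le D hb k (h * M) B ?_ ?_).trans ?_
    · rw [hBe]
      exact textBound_mono (by omega) (by omega)
    · rw [hBe]
      exact textBound_mono (by omega) (by omega)
    · rw [hβ, ENNReal.ofReal_mul (by positivity), ENNReal.ofReal_natCast]
      refine mul_le_mul_right ((hlong _).trans (ENNReal.ofReal_le_ofReal ?_)) _
      rw [pow_mul]
      gcongr
      exact Nat.le_ceil C₀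
  have hRβ : (R : ℝ) * β ≤ (1 / 2) ^ (r + 1) := by
    refine oversize_le R (b.eval k + 2 * b.eval 1) c₁ r M ?_
    have h1 : R ≤ a * (x + 1) := Nat.mul_le_mul_left a (by omega)
    omega
  have hρR : ρ ^ R ≤ (1 / 2) ^ (r + 1) := by
    rw [hR, pow_mul]
    exact pow_le_pow_left₀ (by positivity) (ha.le.trans (by norm_num)) _
  have husable := le_prob_usable D L ε δ η O k hη0.le hO (hgood k (by omega))
  obtain ⟨s₁, hs₁, hready⟩ := Prog.setup_ensures (textEnv D O) a K r C s hs
  have key : ∀ (S : Set Val) (σ : ℤ), (σ = 1 ∨ σ = -1) →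
      (∀ d : ℤ, 0 < σ * d → Val.ofNat d.toNat ∈ S) →
      (∀ y, Usable L ε O k y → Prog.vote O C.qubits g y.1 y.2.1 y.2.2 = σ) →
      ENNReal.ofReal (1 - (1 / 2) ^ r) ≤ success (textEnv D O) S
        ((Polynomial.C a * (.X + 1) * cp + 28 * .X + 50).eval x) [Prog.decideCircuit a K] s := by
    intro S σ hσ hS hvote
    have h1 := Prog.votes_success D O S B k C.qubits (9 * x) g hG σ hσ hS p z β hp0 hz hβ0
      (by
        refine le_trans (by linarith) (husable.trans (prob_mono _ fun y hy => hvote y hy)))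
      hsized R 0 s₁ hready
    have h2 : ENNReal.ofReal (1 - (1 / 2) ^ r) ≤
        ENNReal.ofReal (1 - ρ ^ R * z ^ (-(σ * 0)) - R * β) := by
      refine ENNReal.ofReal_le_ofReal ?_
      rw [mul_zero, neg_zero, zpow_zero, mul_one]
      have : (1 / 2 : ℝ) ^ r = (1 / 2) ^ (r + 1) + (1 / 2) ^ (r + 1) := by
        rw [pow_succ]
        ring
      linarith
    refine (h2.trans h1).trans ?_
    refine (success_seq_seq hs₁ S _ _ _).trans (success_mono _ S ?_ _ _)
    have h3 : R * Prog.roundCost B k C.qubits (9 * x) ≤ a * (x + 1) * cp.eval x := by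
      refine Nat.mul_le_mul (Nat.mul_le_mul_left a (by omega)) ?_
      refine (Prog.roundCost_mono le_rfl hkx (by omega : C.qubits ≤ x) le_rfl).trans ?_
      simp only [hcp, Prog.roundCost, ← hB, Polynomial.eval_add, Polynomial.eval_mul,
        Polynomial.eval_X, Polynomial.eval_C, Polynomial.eval_ofNat]
      omega
    simp only [Polynomial.eval_add, Polynomial.eval_mul, Polynomial.eval_X, Polynomial.eval_C,
      Polynomial.eval_ofNat, Polynomial.eval_one]
    omega
  have hk1 : 1 ≤ k := by omega
  constructor
  · intro hacc
    refine key accepting 1 (Or.inl rfl) (fun d hd => ?_) fun y hy =>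
      (vote_of_usable hε hk1 C hy).1 hacc
    change (Val.ofNat d.toNat).isNil = false
    rw [Val.isNil_ofNat, decide_eq_false_iff_not]
    omega
  · intro hrej
    refine key rejecting (-1) (Or.inr rfl) (fun d hd => ?_) fun y hy =>
      (vote_of_usable hε hk1 C hy).2 hrej
    change (Val.ofNat d.toNat).isNil = true
    rw [Val.isNil_ofNat, decide_eq_true_eq]
    omega

/-! ### Problems in BQP -/

/-- Compute a circuit with the program `P`, whose variables are below `b`, and decide it. -/
def decideComputed (P : Cmd) (b a K : ℕ) : Cmd :=
  .seq (.assign b (.hd (.var 0))) (.seq (.assign 0 (.tl (.var 0))) (.seq P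
    (.seq (.assign 0 (.cons (.var b) (.var 0))) (Prog.decideCircuit a K))))

/-- The parameter r has to survive the run of `P`. It is kept in a variable that `P` does not use
and that is not the input variable, whence the maximum with 1; everything else `P` can see is clean.
-/
theorem success_decideComputed (E : Env) (S : Set Val) (P : Cmd) (a K : ℕ) (x y : Val) (n r T : ℕ)
    (hP : haltProb E P x n {y} = 1) (v : ℝ≥0∞)
    (h : ∀ s : Store, s 0 = withParam r y → v ≤ success E S T [Prog.decideCircuit a K] s) :
    v ≤ success E S (T + n + 10) [decideComputed P (max P.bound 1) a K]
      fun i => if i = 0 then withParam r x else .nil := by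
  set b := max P.bound 1 with hb
  have hb1 : 1 ≤ b := le_max_right _ _
  set s : Store := fun i => if i = 0 then withParam r x else .nil with hs
  have e1 := Ensures.assign (E := E) (s := s) b (.hd (.var 0))
  set s₁ := Function.update s b ((Expr.hd (.var 0)).eval s) with hs₁
  have e2 := Ensures.assign (E := E) (s := s₁) 0 (.tl (.var 0))
  set s₂ := Function.update s₁ 0 ((Expr.tl (.var 0)).eval s₁) with hs₂
  have h10 : s₁ 0 = withParam r x := by
    rw [hs₁, Function.update_of_ne (by omega)]
    rfl
  have h20 : s₂ 0 = x := by
    rw [hs₂, Function.update_self, Expr.eval, Expr.eval, h10]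
    rfl
  have h2b : s₂ b = .ofNat r := by
    rw [hs₂, Function.update_of_ne (by omega), hs₁, Function.update_self]
    rfl
  have h2i : ∀ i, i ≠ 0 → i < b → s₂ i = .nil := by
    intro i hi hib
    rw [hs₂, Function.update_of_ne hi, hs₁, Function.update_of_ne (by omega), hs]
    exact if_neg hi
  have h3 : v ≤ success E S (T + 3 + n) (P :: [.seq (.assign 0 (.cons (.var b) (.var 0)))
      (Prog.decideCircuit a K)]) s₂ := by
    refine success_subprogram E S P (le_max_left _ _) hb1 x y n (T + 3) hP _ s₂ h20 h2i v ?_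
    intro s' hs'0 hs'b
    have e3 := Ensures.assign (E := E) (s := s') 0 (.cons (.var b) (.var 0))
    refine (h _ ?_).trans ((e3 S T _).trans ((success_of_step E S 0 _ rfl).trans
      (success_mono E S (by omega) _ _)))
    rw [Function.update_self, Expr.eval, Expr.eval, Expr.eval, hs'0, hs'b b le_rfl, h2b]
    rfl
  refine h3.trans ((success_of_step (s := s₂) E S 0 _ rfl).trans ((e2 S _ _).trans
    ((success_of_step (s := s₁) E S 0 _ rfl).trans ((e1 S _ _).trans
      ((success_of_step (s := s) E S 0 _ rfl).trans (success_mono E S (by omega) _ _))))))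

theorem le_haltProb {E : Env} {P : Cmd} {x : Val} {T : ℕ} {S : Set Val} {v : ℝ}
    (h : ENNReal.ofReal v ≤ success E S T [P] fun i => if i = 0 then x else .nil) :
    v ≤ haltProb E P x T S := by
  rw [haltProb_eq_success]
  exact (ENNReal.ofReal_le_iff_le_toReal (ne_top_of_le_ne_top ENNReal.one_ne_top
    (toOuterMeasure_le_one _ _))).1 h

end QDisCo

end

theorem theorem6 (D : QDisCo.TextModel) (δ : ℝ) (hδ₀ : 0 ≤ δ) (hδ : δ < 1 / 2) :
    ∃ f : MvPolynomial (Fin 2) ℕ,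
      (∃ (P : QDisCo.Cmd) (t : Polynomial ℕ),
        ∀ (L : QDisCo.GateLib) (ε : ℝ), 0 < ε → ε < 1 / 7 →
        ∀ (C : QDisCo.QCircuit) (O : QDisCo.Val → ℕ),
          QDisCo.SolvesOnAverage L D ε δ (MvPolynomial.eval ![C.gates.length, C.qubits] f) O →
          ∀ r : ℕ,
            (2 / 3 ≤ C.acceptProb L →
              1 - (1 / 2 : ℝ) ^ r ≤
                QDisCo.haltProb (QDisCo.textEnv D O) P (QDisCo.withParam r C.enc)
                  (t.eval (C.enc.size + r)) QDisCo.accepting) ∧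
            (C.acceptProb L ≤ 1 / 3 →
              1 - (1 / 2 : ℝ) ^ r ≤
                QDisCo.haltProb (QDisCo.textEnv D O) P (QDisCo.withParam r C.enc)
                  (t.eval (C.enc.size + r)) QDisCo.rejecting)) ∧
      ∀ ε : ℝ, 0 < ε → ε < 1 / 7 →
        QDisCo.AverageCaseBQPHard D ε δ
          {k | ∃ m n : ℕ, 1 ≤ n ∧ k = MvPolynomial.eval ![m, n] f} := by
  open QDisCo in
  obtain ⟨a, K, t, h⟩ := decideCircuit_success D hδ₀ hδ
  have hf : ∀ m n : ℕ, MvPolynomial.eval ![m, n]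
      (MvPolynomial.X 0 + MvPolynomial.X 1 + MvPolynomial.C K) = m + n + K := by
    intro m n
    simp
  -- f(m, n) = m + n + K. The constant K brings every context into the range in which good texts are
  -- likely, and the program finds m + n by counting.
  refine ⟨MvPolynomial.X 0 + MvPolynomial.X 1 + MvPolynomial.C K,
    ⟨Prog.decideCircuit a K, t, fun L ε _ hε C O hO r => ?_⟩, fun ε _ hε yes no hBQP => ?_⟩
  · rw [hf] at hO
    obtain ⟨h1, h2⟩ := h L ε hε C O hO r (fun i => if i = 0 then withParam r C.enc else .nil) rfl
    exact ⟨fun hacc => le_haltProb (h1 hacc), fun hrej => le_haltProb (h2 hrej)⟩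
  · obtain ⟨P, t₀, C, hP, hyes, hno⟩ := hBQP
    refine ⟨decideComputed P (max P.bound 1) a K, t.comp (t₀ + .X) + t₀ + 10,
      fun O hO x r => ?_⟩
    -- A BQP program works in every environment, in particular in this one, and the circuit it
    -- outputs has polynomial size; so composing `t` with `t₀` bounds the time.
    obtain ⟨hP1, hP2⟩ := hP (textEnv D O) x
    have hO' : SolvesOnAverage standardLib D ε δ ((C x).gates.length + (C x).qubits + K) O :=
      hO _ ⟨(C x).gates.length, (C x).qubits, (C x).pos, (hf _ _).symm⟩
    have hmain := h standardLib ε hε (C x) O hO' r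
    have ht₀ : t₀.eval x.length ≤ t₀.eval (x.length + r) := eval_mono_nat t₀ (by omega)
    have hT : t.eval ((C x).enc.size + r) + t₀.eval x.length + 10 ≤
        (t.comp (t₀ + .X) + t₀ + 10).eval (x.length + r) := by
      have h1 : t.eval ((C x).enc.size + r) ≤ t.eval (t₀.eval (x.length + r) + (x.length + r)) :=
        eval_mono_nat t (by omega)
      simp only [Polynomial.eval_add, Polynomial.eval_comp, Polynomial.eval_X,
        Polynomial.eval_ofNat]
      omega
    constructor
    · intro hx
      exact le_haltProb ((success_decideComputed _ accepting P a K _ _ _ r _ hP1 _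
        fun s hs => (hmain s hs).1 (hyes x hx)).trans (success_mono _ _ hT _ _))
    · intro hx
      exact le_haltProb ((success_decideComputed _ rejecting P a K _ _ _ r _ hP1 _
        fun s hs => (hmain s hs).2 (hno x hx)).trans (success_mono _ _ hT _ _))
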